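/- **Notation.** The Yangian $Y(gl(2))$ is the unital associative $\mathbb C$-algebra with generators $T_{ij}^{(s)}$, $i,j\in\{1,2\}$, $s\in\mathbb Z_{\ge 0}$, $T_{ij}^{(0)}=\delta_{ij}$, and relations $(x-y)[T_{ij}(x),T_{kl}(y)]=T_{kj}(y)T_{il}(x)-T_{kj}(x)T_{il}(y)$, where $T_{ij}(u)=\sum_{s\ge0}T_{ij}^{(s)}u^{-s}$. Let $n\ge 1$ and $z,\lambda\in\mathbb C^n$. Put $\omega_l(t)=\prod_{1\le a<b\le l}\frac{t_a-t_b}{t_a-t_b+1}$. Let $\mathfrak F_l(z,\lambda)$ be the space of rational functions $$P(t_1,\dots,t_l)\prod_{a=1}^n\prod_{b=1}^l\frac1{t_b-z_a-\lambda_a}\;\omega_l(t),$$ where $P$ is a symmetric complex polynomial of degree less than $n$ in each variable, and let $\mathfrak F(z,\lambda)=\bigoplus_{l\ge0}\mathfrak F_l(z,\lambda)$. For a function $g$ of $t_1,\dots,t_l$ and $\sigma\in S_l$ put $[g]_\sigma(t)=g(t_{\sigma(1)},\dots,t_{\sigma(l)})\,\omega_l(t)/\omega_l(t_{\sigma(1)},\dots,t_{\sigma(l)})$;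 thus $[g]_{(i,i+1)}(t)=g(\dots,t_{i+1},t_i,\dots)\frac{t_i-t_{i+1}-1}{t_i-t_{i+1}+1}$. Put $h(x)=\prod_{a=1}^n\frac{x-z_a+\lambda_a}{x-z_a-\lambda_a}$ and $\widetilde T_{ij}(u)=T_{ij}(u)\prod_{a=1}^n\frac{u}{u-z_a-\lambda_a}$. The action of $Y(gl(2))$ on $\mathfrak F(z,\lambda)$ is the one given, for $f\in\mathfrak F_l(z,\lambda)$, by the following formulas, where rational functions are expanded in Laurent series at $u=\infty$: $$(\widetilde T_{11}(u)f)(t_1,\dots,t_l)=f(t)\,h(u)\prod_{a=1}^l\frac{u-t_a-1}{u-t_a}+\prod_{a=1}^l\frac{u-t_a-1}{u-t_a}\sum_{a=1}^l\Big[\frac{f(t_1,\dots,t_{l-1},u)}{u-t_l-1}\,h(t_l)\Big]_{(a,l)},$$ $$(\widetilde T_{22}(u)f)(t_1,\dots,t_l)=f(t)\prod_{a=1}^l\frac{u-t_a+1}{u-t_a}-\prod_{a=1}^l\frac{u-t_a+1}{u-t_a}\sum_{a=1}^l\Big[\frac{f(u,t_2,\dots,t_l)}{u-t_1+1}\Big]_{(1,a)},$$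 $$(\widetilde T_{12}(u)f)(t_1,\dots,t_{l+1})=\sum_{a=1}^{l+1}\Big[\frac{f(t_2,\dots,t_{l+1})}{u-t_1}\Big(h(t_1)\prod_{c=2}^{l+1}\frac{u-t_c+1}{u-t_c}\,\frac{t_1-t_c-1}{t_1-t_c+1}-h(u)\prod_{c=2}^{l+1}\frac{u-t_c-1}{u-t_c}\Big)\Big]_{(1,a)}$$ $$\qquad-\prod_{a=1}^{l+1}\frac{u-t_a+1}{u-t_a}\sum_{\substack{a,b=1\\a\ne b}}^{l+1}\Big[\frac{f(u,t_2,\dots,t_l)}{(u-t_1+1)(u-t_{l+1}+1)}\,h(t_{l+1})\Big]_{\sigma_{a,b}},$$ $$(\widetilde T_{21}(u)f)(t_1,\dots,t_{l-1})=f(t_1,\dots,t_{l-1},u)\prod_{a=1}^{l-1}\frac{u-t_a-1}{u-t_a}\quad(l>0),\qquad \widetilde T_{21}(u)f=0\quad(l=0).$$ Here $\sigma_{a,b}$ is a permutation with $\sigma_{a,b}(1)=a$ and $\sigma_{a,b}(l+1)=b$, namely $\sigma_{a,b}=(1,a)(b,l+1)$ (right factor applied first) if $b\neq1$, and $\sigma_{a,1}=(1,a)(a,l+1)$.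 **Theorem.** Let $n\ge1$ and $z,\lambda\in\mathbb C^n$. Suppose that $2\lambda_1=k\in\mathbb Z_{\ge0}$ and that $z_1+\lambda_1-j\ne z_a+\lambda_a$ for all $a=2,\dots,n$ and $j=0,1,\dots,k$. Put $\lambda'=(-\lambda_1-1,\lambda_2,\dots,\lambda_n)$. The formulas above make $\mathfrak F(z,\lambda)$ and $\mathfrak F(z,\lambda')$ into $Y(gl(2))$-modules. For $f\in\mathfrak F_l(z,\lambda)$ put $\iota^*f=0$ if $l\le k$, and if $l>k$ put $$\tilde f(t_1,\dots,t_l)=f(t_1,\dots,t_l)\,(t_1-z_1-\lambda_1)\prod_{a=1}^{k+1}\prod_{b=k+2}^{l}\frac{t_a-t_b+1}{t_a-t_b-1},$$ $$(\iota^*f)(t_1,\dots,t_{l-k-1})=\tilde f(z_1+\lambda_1,\,z_1+\lambda_1-1,\,\dots,\,z_1-\lambda_1,\,t_1,\dots,t_{l-k-1}).$$ Then $\iota^*$ is a well defined linear map $\mathfrak F(z,\lambda)\to\mathfrak F(z,\lambda')$, it is surjective, and it is a homomorphism of $Y(gl(2))$-modules. -/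

import Mathlib

open scoped DirectSum

noncomputable section

/-! ## The Yangian of gl(2) -/

/-- Labels of the generators `T_{ij}^{(s)}`, `i, j ∈ {1, 2}` (written `0, 1` here), `s = 0, 1, …`. -/
abbrev YangianGen : Type := Fin 2 × Fin 2 × ℕ

/-- The free generator `T_{ij}^{(s)}`. -/
def freeT (i j : Fin 2) (s : ℕ) : FreeAlgebra ℂ YangianGen :=
  FreeAlgebra.ι ℂ (i, j, s)

/-- The defining relations. With `T_{ij}(x) = ∑ T_{ij}^{(s)} x^{-s}` and `R(x) = x Id + P`, the matrix
entries of `R(x - y) T_{(1)}(x) T_{(2)}(y) = T_{(2)}(y) T_{(1)}(x) R(x - y)` are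
`(x - y) [T_{ij}(x), T_{kl}(y)] = T_{kj}(y) T_{il}(x) - T_{kj}(x) T_{il}(y)`;
`rtt` is the coefficient of `x^{-r} y^{-s}` with `r, s ≥ 0`. The remaining coefficients (those of
`x y^{-s}` and `x^{-r} y`) say that `T_{ij}^{(0)}` is central, which follows from the usual
normalization `T_{ij}^{(0)} = δ_{ij}`. -/
inductive YangianRel : FreeAlgebra ℂ YangianGen → FreeAlgebra ℂ YangianGen → Prop
  | unit (i j : Fin 2) : YangianRel (freeT i j 0) (if i = j then 1 else 0)
  | rtt (i j k l : Fin 2) (r s : ℕ) : YangianRel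
      ((freeT i j (r + 1) * freeT k l s - freeT k l s * freeT i j (r + 1))
        - (freeT i j r * freeT k l (s + 1) - freeT k l (s + 1) * freeT i j r))
      (freeT k j s * freeT i l r - freeT k j r * freeT i l s)

/-- The Yangian `Y(gl(2))`. -/
abbrev Yangian : Type := RingQuot YangianRel

/-- The generator `T_{ij}^{(s)}` of the Yangian. -/
def Yangian.T (i j : Fin 2) (s : ℕ) : Yangian :=
  RingQuot.mkAlgHom ℂ YangianRel (freeT i j s)

/-! ## Rational functions -/

/-- Rational functions over `ℂ` in the variables `t_1, …, t_l` (indexed by `Fin l`). -/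
abbrev RatFn (l : ℕ) : Type := FractionRing (MvPolynomial (Fin l) ℂ)

/-- The variable `t_{i+1}` as a rational function. -/
def RatFn.var {l : ℕ} (i : Fin l) : RatFn l :=
  algebraMap (MvPolynomial (Fin l) ℂ) (RatFn l) (MvPolynomial.X i)

/-- The value of a rational function at a point with coordinates in a field extension of `ℂ`:
the value of the reduced numerator over the value of the reduced denominator. -/
def RatFn.evalAt {l : ℕ} {L : Type} [Field L] [Algebra ℂ L] (f : RatFn l) (p : Fin l → L) : L :=
  MvPolynomial.aeval p (IsFractionRing.num (MvPolynomial (Fin l) ℂ) f) /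
    MvPolynomial.aeval p
      ((IsFractionRing.den (MvPolynomial (Fin l) ℂ) f : MvPolynomial (Fin l) ℂ))

/-- The value can be computed from any fraction whose denominator does not vanish at the point. -/
theorem RatFn.evalAt_eq {l : ℕ} {L : Type} [Field L] [Algebra ℂ L] (p : Fin l → L)
    (P Q : MvPolynomial (Fin l) ℂ) (hQ : MvPolynomial.aeval p Q ≠ 0) :
    RatFn.evalAt (algebraMap _ (RatFn l) P / algebraMap _ (RatFn l) Q) p =
      MvPolynomial.aeval p P / MvPolynomial.aeval p Q := by
  have hQ0 : Q ≠ 0 := by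
    rintro rfl
    simp at hQ
  have hQ1 : algebraMap _ (RatFn l) Q ≠ 0 := by
    simpa using hQ0
  set f : RatFn l := algebraMap _ (RatFn l) P / algebraMap _ (RatFn l) Q with hf
  set N := IsFractionRing.num (MvPolynomial (Fin l) ℂ) f with hN
  set D : MvPolynomial (Fin l) ℂ := (IsFractionRing.den (MvPolynomial (Fin l) ℂ) f :
    MvPolynomial (Fin l) ℂ) with hD
  have hD0 : D ≠ 0 := nonZeroDivisors.ne_zero (IsFractionRing.den (MvPolynomial (Fin l) ℂ) f).2
  have hD1 : algebraMap _ (RatFn l) D ≠ 0 := by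
    simpa using hD0
  have hND : algebraMap _ (RatFn l) N / algebraMap _ (RatFn l) D = f := by
    have h := IsFractionRing.mk'_num_den (MvPolynomial (Fin l) ℂ) f
    rwa [IsFractionRing.mk'_eq_div] at h
  have hcross : N * Q = P * D := by
    apply IsFractionRing.injective (MvPolynomial (Fin l) ℂ) (RatFn l)
    rw [map_mul, map_mul]
    rw [hf, div_eq_div_iff hD1 hQ1] at hND
    exact hND
  have hrel : IsRelPrime N D := IsFractionRing.num_den_reduced (MvPolynomial (Fin l) ℂ) f
  have hdvd : D ∣ Q := by
    have h1 : D ∣ N * Q := ⟨P, by rw [hcross, mul_comm]⟩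
    exact hrel.symm.dvd_of_dvd_mul_left h1
  have hDp : MvPolynomial.aeval p D ≠ 0 := by
    obtain ⟨E, hE⟩ := hdvd
    intro h
    apply hQ
    rw [hE, map_mul, h, zero_mul]
  have h2 := congrArg (MvPolynomial.aeval p) hcross
  rw [map_mul, map_mul] at h2
  change MvPolynomial.aeval p N / MvPolynomial.aeval p D = _
  rw [div_eq_div_iff hDp hQ]
  exact h2

/-! ## The rational hypergeometric space -/

/-- `∏_{a<b} (t_a - t_b) / (t_a - t_b + 1)`. -/
def omegaFactor {l : ℕ} {L : Type} [Field L] (t : Fin l → L) : L :=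
  ∏ p : Fin l × Fin l with p.1 < p.2, (t p.1 - t p.2) / (t p.1 - t p.2 + 1)

/-- `∏_a ∏_b 1 / (t_b - z_a - λ_a) ∏_{a<b} (t_a - t_b) / (t_a - t_b + 1)`. -/
def hypWeight {n : ℕ} (z lam : Fin n → ℂ) (l : ℕ) : RatFn l :=
  (∏ a : Fin n, ∏ b : Fin l, 1 / (RatFn.var b - algebraMap ℂ (RatFn l) (z a + lam a))) *
    omegaFactor (RatFn.var : Fin l → RatFn l)

/-- The component `𝔉_l(z, λ)`. -/
def hypComponent {n : ℕ} [NeZero n] (z lam : Fin n → ℂ) (l : ℕ) : Submodule ℂ (RatFn l) where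
  carrier := {f | ∃ P : MvPolynomial (Fin l) ℂ, P.IsSymmetric ∧ (∀ i, P.degreeOf i < n) ∧
    f = algebraMap _ (RatFn l) P * hypWeight z lam l}
  zero_mem' := ⟨0, MvPolynomial.IsSymmetric.zero,
    fun i => by simpa [MvPolynomial.degreeOf_zero] using Nat.pos_of_ne_zero (NeZero.ne n), by simp⟩
  add_mem' := by
    rintro _ _ ⟨P, hP, hPd, rfl⟩ ⟨Q, hQ, hQd, rfl⟩
    exact ⟨P + Q, hP.add hQ, fun i => (MvPolynomial.degreeOf_add_le i P Q).trans_lt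
      (max_lt (hPd i) (hQd i)), by rw [map_add, add_mul]⟩
  smul_mem' := by
    rintro c _ ⟨P, hP, hPd, rfl⟩
    refine ⟨MvPolynomial.C c * P, (MvPolynomial.IsSymmetric.C c).mul hP,
      fun i => (MvPolynomial.degreeOf_C_mul_le P i c).trans_lt (hPd i), ?_⟩
    rw [← MvPolynomial.smul_eq_C_mul, ← smul_mul_assoc]
    congr 1
    rw [Algebra.smul_def, Algebra.smul_def, map_mul,
      ← IsScalarTower.algebraMap_apply ℂ (MvPolynomial (Fin l) ℂ) (RatFn l)]

/-- The rational hypergeometric space `𝔉(z, λ) = ⨁_l 𝔉_l(z, λ)`, as the graded subspace of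
`⨁_l ℂ(t_1, …, t_l)` with components `𝔉_l(z, λ)`. -/
def hypSpace {n : ℕ} [NeZero n] (z lam : Fin n → ℂ) : Submodule ℂ (⨁ l, RatFn l) where
  carrier := {x | ∀ l, x l ∈ hypComponent z lam l}
  zero_mem' := fun l => (hypComponent z lam l).zero_mem
  add_mem' := fun hx hy l => (hypComponent z lam l).add_mem (hx l) (hy l)
  smul_mem' := fun c _ hx l => (hypComponent z lam l).smul_mem c (hx l)

/-- A function in `𝔉_l(z, λ)` as a homogeneous element of `𝔉(z, λ)`. -/
def hypSpace.homog {n : ℕ} [NeZero n] {z lam : Fin n → ℂ} {l : ℕ} (f : hypComponent z lam l) :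
    hypSpace z lam :=
  ⟨DirectSum.lof ℂ ℕ RatFn l (f : RatFn l), by
    intro m
    by_cases h : l = m
    · subst h
      rw [DirectSum.lof_apply]
      exact f.2
    · rw [DirectSum.lof_eq_of, DirectSum.of_eq_of_ne _ _ _ (Ne.symm h)]
      exact (hypComponent z lam m).zero_mem⟩

/-! ## The Yangian action -/

/-- The function `[G]_σ^{rat}`. The rule for simple transpositions and the fact that this is an
action of the symmetric group are proved below. -/
def bracket {m : ℕ} {L : Type} [Field L] (σ : Equiv.Perm (Fin m)) (G : (Fin m → L) → L) :
    (Fin m → L) → L :=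
  fun t => G (t ∘ σ) * (omegaFactor t / omegaFactor (t ∘ σ))

theorem bracket_bracket {m : ℕ} {L : Type} [Field L] (σ τ : Equiv.Perm (Fin m))
    (G : (Fin m → L) → L) (t : Fin m → L) (ht : omegaFactor (t ∘ τ) ≠ 0) :
    bracket τ (bracket σ G) t = bracket (τ * σ) G t := by
  have h : (t ∘ τ) ∘ σ = t ∘ (τ * σ : Equiv.Perm (Fin m)) := rfl
  simp only [bracket, h]
  rw [mul_assoc, mul_comm (omegaFactor (t ∘ τ) / _), div_mul_div_cancel₀ ht]

theorem bracket_swap {m : ℕ} {L : Type} [Field L] (G : (Fin m → L) → L) (t : Fin m → L)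
    (h0 : ∀ a b, a ≠ b → t a ≠ t b) (h1 : ∀ a b, t a - t b + 1 ≠ 0)
    (i j : Fin m) (hij : (i : ℕ) + 1 = j) :
    bracket (Equiv.swap i j) G t =
      G (t ∘ Equiv.swap i j) * ((t i - t j - 1) / (t i - t j + 1)) := by
  have hlt : i < j := by
    rw [Fin.lt_def]
    omega
  have hne : ∀ p : Fin m × Fin m, p ≠ (i, j) → p.1 < p.2 →
      Equiv.swap i j p.1 < Equiv.swap i j p.2 ∧
        (Equiv.swap i j p.1, Equiv.swap i j p.2) ≠ (i, j) := by
    rintro ⟨a, b⟩ hp hab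
    simp only [ne_eq, Prod.mk.injEq, not_and] at hp ⊢
    simp only [Equiv.swap_apply_def, Fin.lt_def, Fin.ext_iff] at *
    split_ifs <;> simp_all <;> omega
  set φ : Fin m × Fin m → L := fun p => (t p.1 - t p.2) / (t p.1 - t p.2 + 1) with hφ
  have hmem : (i, j) ∈ Finset.univ.filter (fun p : Fin m × Fin m => p.1 < p.2) := by
    simpa using hlt
  have e1 : omegaFactor t = φ (i, j) *
      ∏ p ∈ (Finset.univ.filter (fun p : Fin m × Fin m => p.1 < p.2)).erase (i, j), φ p := by
    rw [Finset.mul_prod_erase _ _ hmem]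
    rfl
  have e2 : omegaFactor (t ∘ Equiv.swap i j) = φ (j, i) *
      ∏ p ∈ (Finset.univ.filter (fun p : Fin m × Fin m => p.1 < p.2)).erase (i, j), φ p := by
    have : omegaFactor (t ∘ Equiv.swap i j) =
        ∏ p ∈ Finset.univ.filter (fun p : Fin m × Fin m => p.1 < p.2),
          φ (Equiv.swap i j p.1, Equiv.swap i j p.2) := rfl
    rw [this, ← Finset.mul_prod_erase _ _ hmem]
    congr 1
    · simp
    · refine Finset.prod_nbij' (fun p => (Equiv.swap i j p.1, Equiv.swap i j p.2))
        (fun p => (Equiv.swap i j p.1, Equiv.swap i j p.2)) ?_ ?_ ?_ ?_ ?_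
      · intro p hp
        simp only [Finset.mem_erase, Finset.mem_filter, Finset.mem_univ, true_and] at hp ⊢
        exact ⟨(hne p hp.1 hp.2).2, (hne p hp.1 hp.2).1⟩
      · intro p hp
        simp only [Finset.mem_erase, Finset.mem_filter, Finset.mem_univ, true_and] at hp ⊢
        exact ⟨(hne p hp.1 hp.2).2, (hne p hp.1 hp.2).1⟩
      · intro p _
        simp
      · intro p _
        simp
      · intro p _
        rfl
  have hprod : ∏ p ∈ (Finset.univ.filter (fun p : Fin m × Fin m => p.1 < p.2)).erase (i, j),
      φ p ≠ 0 := by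
    rw [Finset.prod_ne_zero_iff]
    intro p hp
    simp only [Finset.mem_erase, Finset.mem_filter, Finset.mem_univ, true_and] at hp
    exact div_ne_zero (sub_ne_zero.mpr (h0 _ _ hp.2.ne)) (h1 _ _)
  unfold bracket
  congr 1
  rw [e1, e2, mul_div_mul_right _ _ hprod]
  have a1 := h1 i j
  have a2 := h1 j i
  have a3 : t i - t j ≠ 0 := sub_ne_zero.mpr (h0 _ _ hlt.ne)
  have a4 : t j - t i ≠ 0 := sub_ne_zero.mpr (h0 _ _ hlt.ne')
  simp only [hφ]
  field_simp
  ring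

section Formulas

/- In the formulas below `t` is a point with coordinates in an extension field `L` of `ℂ`
and `u` is an element of `L`. The index `0` is that of `t_1`. -/
variable {n : ℕ} (z lam : Fin n → ℂ) {L : Type} [Field L] [Algebra ℂ L]

/-- `∏_a (x - z_a + λ_a) / (x - z_a - λ_a)`. -/
def highestWeight (x : L) : L :=
  ∏ a : Fin n, (x - algebraMap ℂ L (z a) + algebraMap ℂ L (lam a)) /
    (x - algebraMap ℂ L (z a) - algebraMap ℂ L (lam a))

/-- The first index, `i` being a witness that there is one. -/
def firstIdx {l : ℕ} (i : Fin l) : Fin l := ⟨0, i.pos⟩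

/-- The last index, `i` being a witness that there is one. -/
def lastIdx {l : ℕ} (i : Fin l) : Fin l := ⟨l - 1, Nat.sub_lt i.pos Nat.one_pos⟩

/-- `(T̃_{11}(u) f)(t_1, …, t_l)` for `f = f(t_1, …, t_l)`. -/
def tilde11 {l : ℕ} (f : RatFn l) (u : L) (t : Fin l → L) : L :=
  f.evalAt t * highestWeight z lam u * (∏ a, (u - t a - 1) / (u - t a)) +
    (∏ a, (u - t a - 1) / (u - t a)) *
      ∑ a : Fin l, bracket (Equiv.swap a (lastIdx a))
        (fun t => f.evalAt (Function.update t (lastIdx a) u) / (u - t (lastIdx a) - 1) *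
          highestWeight z lam (t (lastIdx a))) t

/-- `(T̃_{22}(u) f)(t_1, …, t_l)` for `f = f(t_1, …, t_l)`. -/
def tilde22 {l : ℕ} (f : RatFn l) (u : L) (t : Fin l → L) : L :=
  f.evalAt t * (∏ a, (u - t a + 1) / (u - t a)) -
    (∏ a, (u - t a + 1) / (u - t a)) *
      ∑ a : Fin l, bracket (Equiv.swap (firstIdx a) a)
        (fun t => f.evalAt (Function.update t (firstIdx a) u) / (u - t (firstIdx a) + 1)) t

/-- For `a ≠ b`, a permutation that takes the first index to `a` and the last one to `b`. It is
`(1, a) (b, l + 1)` if `b` is not the first index, and `(1, a) (a, l + 1)` otherwise. -/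
def pairPerm {l : ℕ} (a b : Fin (l + 1)) : Equiv.Perm (Fin (l + 1)) :=
  Equiv.swap 0 a * Equiv.swap (if b = 0 then a else b) (Fin.last l)

/-- `(T̃_{12}(u) f)(t_1, …, t_{l+1})` for `f = f(t_1, …, t_l)`. -/
def tilde12 {l : ℕ} (f : RatFn l) (u : L) (t : Fin (l + 1) → L) : L :=
  (∑ a : Fin (l + 1), bracket (Equiv.swap 0 a)
    (fun t => f.evalAt (fun i : Fin l => t i.succ) / (u - t 0) *
      (highestWeight z lam (t 0) *
          (∏ c : Fin l, (u - t c.succ + 1) / (u - t c.succ) *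
            ((t 0 - t c.succ - 1) / (t 0 - t c.succ + 1))) -
        highestWeight z lam u * ∏ c : Fin l, (u - t c.succ - 1) / (u - t c.succ))) t) -
  (∏ a, (u - t a + 1) / (u - t a)) *
    ∑ p : Fin (l + 1) × Fin (l + 1) with p.1 ≠ p.2, bracket (pairPerm p.1 p.2)
      (fun t => f.evalAt (fun i : Fin l => if (i : ℕ) = 0 then u else t i.castSucc) /
        ((u - t 0 + 1) * (u - t (Fin.last l) + 1)) * highestWeight z lam (t (Fin.last l))) t

/-- `(T̃_{21}(u) f)(t_1, …, t_l)` for `f = f(t_1, …, t_{l+1})`. -/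
def tilde21 {l : ℕ} (f : RatFn (l + 1)) (u : L) (t : Fin l → L) : L :=
  f.evalAt (Fin.snoc t u : Fin (l + 1) → L) * ∏ a, (u - t a - 1) / (u - t a)

end Formulas

theorem pairPerm_first {l : ℕ} (a b : Fin (l + 1)) (h : a ≠ b) : pairPerm a b 0 = a := by
  have hl : Fin.last l ≠ 0 := by
    rintro h0
    apply h
    have : l = 0 := by simpa [Fin.ext_iff] using h0
    subst this
    exact Fin.ext (by omega)
  unfold pairPerm
  rw [Equiv.Perm.mul_apply, Equiv.swap_apply_of_ne_of_ne _ hl.symm, Equiv.swap_apply_left]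
  split_ifs with hb
  · rintro h0
    exact h (h0.symm.trans hb.symm)
  · exact fun h0 => hb h0.symm

theorem pairPerm_last {l : ℕ} (a b : Fin (l + 1)) (h : a ≠ b) :
    pairPerm a b (Fin.last l) = b := by
  unfold pairPerm
  rw [Equiv.Perm.mul_apply, Equiv.swap_apply_right]
  split_ifs with hb
  · rw [Equiv.swap_apply_right, hb]
  · exact Equiv.swap_apply_of_ne_of_ne hb h.symm

/-- The field in which expansions at `u = ∞` live: Laurent series in `u⁻¹` whose coefficients are
rational functions in `t_1, …, t_l`; the coefficient of `u^{-s}` is `HahnSeries.coeff _ s`. -/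
abbrev SeriesAtInfinity (l : ℕ) : Type := LaurentSeries (RatFn l)

/-- The constants `ℂ` inside `SeriesAtInfinity l`, through the constant series. -/
instance seriesAlgebra (l : ℕ) : Algebra ℂ (SeriesAtInfinity l) :=
  HahnSeries.instAlgebra

theorem algebraMap_series (l : ℕ) (c : ℂ) :
    algebraMap ℂ (SeriesAtInfinity l) c = HahnSeries.C (algebraMap ℂ (RatFn l) c) :=
  rfl

/-- The element `u`. -/
def uVar (l : ℕ) : SeriesAtInfinity l := HahnSeries.single (-1 : ℤ) (1 : RatFn l)

/-- The point `(t_1, …, t_l)` with coordinates the variables. -/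
def varPoint (l : ℕ) : Fin l → SeriesAtInfinity l := fun i => HahnSeries.C (RatFn.var i)

/-- Passing from `T̃(u)` to `T(u) = T̃(u) ∏_a (u - z_a - λ_a) / u`: the coefficient of `u^{-s}` in
`G ∏_a (u - z_a - λ_a) / u`. -/
def yangianCoeff {n : ℕ} (z lam : Fin n → ℂ) {l : ℕ} (G : SeriesAtInfinity l) (s : ℕ) : RatFn l :=
  HahnSeries.coeff (G * ∏ a : Fin n,
    (uVar l - algebraMap ℂ (SeriesAtInfinity l) (z a)
      - algebraMap ℂ (SeriesAtInfinity l) (lam a)) / uVar l) (s : ℤ)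

/-- `ρ` is the Yangian module structure on `𝔉(z, λ)` given by the formulas for `T̃_{ij}(u)`. -/
structure IsHypergeometricAction {n : ℕ} [NeZero n] (z lam : Fin n → ℂ)
    (ρ : Yangian →ₐ[ℂ] Module.End ℂ (hypSpace z lam)) : Prop where
  act11 : ∀ (s l : ℕ) (f : hypComponent z lam l),
    (ρ (Yangian.T 0 0 s) (hypSpace.homog f) : ⨁ l, RatFn l) = DirectSum.lof ℂ ℕ RatFn l
      (yangianCoeff z lam (tilde11 z lam (f : RatFn l) (uVar l) (varPoint l)) s)
  act22 : ∀ (s l : ℕ) (f : hypComponent z lam l),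
    (ρ (Yangian.T 1 1 s) (hypSpace.homog f) : ⨁ l, RatFn l) = DirectSum.lof ℂ ℕ RatFn l
      (yangianCoeff z lam (tilde22 (f : RatFn l) (uVar l) (varPoint l)) s)
  act12 : ∀ (s l : ℕ) (f : hypComponent z lam l),
    (ρ (Yangian.T 0 1 s) (hypSpace.homog f) : ⨁ l, RatFn l) = DirectSum.lof ℂ ℕ RatFn (l + 1)
      (yangianCoeff z lam
        (tilde12 z lam (f : RatFn l) (uVar (l + 1)) (varPoint (l + 1))) s)
  act21 : ∀ (s l : ℕ) (f : hypComponent z lam (l + 1)),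
    (ρ (Yangian.T 1 0 s) (hypSpace.homog f) : ⨁ l, RatFn l) = DirectSum.lof ℂ ℕ RatFn l
      (yangianCoeff z lam (tilde21 (f : RatFn (l + 1)) (uVar l) (varPoint l)) s)
  act21_zero : ∀ (s : ℕ) (f : hypComponent z lam 0),
    ρ (Yangian.T 1 0 s) (hypSpace.homog f) = 0

/-! ## The map `ι*` -/

/-- `λ' = (-λ_1 - 1, λ_2, …, λ_n)`. -/
def reflectFirst {n : ℕ} [NeZero n] (lam : Fin n → ℂ) : Fin n → ℂ :=
  Function.update lam 0 (-lam 0 - 1)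

/-- The function `f̃(t_1, …, t_l)`, for `l = k + 1 + m`. -/
def iotaTilde {n : ℕ} [NeZero n] (z lam : Fin n → ℂ) (k m : ℕ) (f : RatFn (k + 1 + m)) :
    RatFn (k + 1 + m) :=
  f * (RatFn.var (Fin.castAdd m 0) - algebraMap ℂ (RatFn (k + 1 + m)) (z 0 + lam 0)) *
    ∏ a : Fin (k + 1), ∏ b : Fin m,
      (RatFn.var (Fin.castAdd m a) - RatFn.var (Fin.natAdd (k + 1) b) + 1) /
        (RatFn.var (Fin.castAdd m a) - RatFn.var (Fin.natAdd (k + 1) b) - 1)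

/-- The point `(z_1 + λ_1, z_1 + λ_1 - 1, …, z_1 + λ_1 - k, t_1, …, t_m)`. -/
def iotaPoint {n : ℕ} [NeZero n] (z lam : Fin n → ℂ) (k m : ℕ) : Fin (k + 1 + m) → RatFn m :=
  Fin.append (fun a : Fin (k + 1) => algebraMap ℂ (RatFn m) (z 0 + lam 0 - ((a : ℕ) : ℂ)))
    RatFn.var

/-- `ι` is the linear map `ι* : 𝔉(z, λ) → 𝔉(z, λ')`. -/
structure IsIotaStar {n : ℕ} [NeZero n] (z lam : Fin n → ℂ) (k : ℕ)
    (ι : hypSpace z lam →ₗ[ℂ] hypSpace z (reflectFirst lam)) : Prop where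
  low : ∀ (l : ℕ) (f : hypComponent z lam l), l ≤ k → ι (hypSpace.homog f) = 0
  high : ∀ (m : ℕ) (f : hypComponent z lam (k + 1 + m)),
    (ι (hypSpace.homog f) : ⨁ l, RatFn l) = DirectSum.lof ℂ ℕ RatFn m
      ((iotaTilde z lam k m (f : RatFn (k + 1 + m))).evalAt (iotaPoint z lam k m))

end

/-! Division by the weight function identifies `hypSpace z lam` with `SymSpace n`, the finite
sequences of symmetric polynomials of degree less than `n` in each variable. There `u^n T_ij(u)` are
polynomials `A`, `B`, `C`, `D` in `u` with operator coefficients, and `C(u)` is the substitution of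
`u` for one variable. With `c = z_1 + λ_1`, the map `ι*` becomes a nonzero constant times `C(c) C(c
- 1) ⋯ C(c - k)`, the substitution of the ladder `c, c - 1, …, c - k` for `k + 1` variables
(`algebraMap_lowerProd`, `evalAt_iotaTilde`).

Module structure. `diagOp` and `raiseOp` define the coefficients of `A`, `D` and `B` by recursion on
the number of variables, so that their exchange relations with `C` hold by construction. A vector is
zero once its vacuum component is zero and almost all `C(w)` annihilate it
(`SymSpace.eq_zero_of_lower`). Applying `C(w)` and inducting on the degree therefore yields all the
other relations of the Yangian (`LoweringData.rtt`). The closed formulas `diagSum` and `raiseSum`,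
sums over finite sets of points, obey the same recursions (`diagSum_insert`, `raiseSum_insert`).
Hence the recursive operators preserve symmetry, and they agree with the formulas that define the
action (`tilde11_eq` and its companions).

Intertwining. The closed formulas depend on `λ` only through `q(x) = ∏ (x - z_a + λ_a)` and `p(x) =
∏ (x - z_a - λ_a)`; the rest consists of products of `(x - y ∓ 1) / (x - y)` over points `y`. Over
the ladder these products telescope and turn `q`, `p` into the polynomials for `λ'`. A term that
would replace a ladder point vanishes: a neighbouring ladder point contributes a zero factor, or the
point is an end of the ladder and is a root of `q` or `p`. It is here that `2λ_1 = k` enters. So the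
formulas for `λ` on the union of the ladder and `T` are the formulas for `λ'` on `T`
(`diagSum_union`, `raiseSum_union`, `lowerProd_symRep`).

Surjectivity. Each `C(w)` is locally nilpotent and has a partner `e` with `[C(w), e] = 1`, which
forces surjectivity in characteristic zero (`surjective_of_commutator`). The condition on the poles
makes the constant in `ι*` well defined and nonzero. -/

noncomputable section

/-! ### RTT relations deduced from the relations with the lowering operators -/

/-- The exchange relations of the lowering operators `C` with `A`, `B`, `D`, together with a
filtration by subspaces `N l` and a functional `π` that detect whether a vector vanishes. -/
structure LoweringData (E : Type) [AddCommGroup E] [Module ℂ E] where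
  A : ℂ → Module.End ℂ E
  B : ℂ → Module.End ℂ E
  C : ℂ → Module.End ℂ E
  D : ℂ → Module.End ℂ E
  CC : ∀ x y v, C x (C y v) = C y (C x v)
  CA : ∀ x y v, (x - y) • C x (A y v) = (x - y + 1) • A y (C x v) - A x (C y v)
  CD : ∀ x y v, (x - y) • C x (D y v) = (x - y - 1) • D y (C x v) + D x (C y v)
  CB : ∀ x y v, (x - y) • (C x (B y v) - B y (C x v)) = A y (D x v) - A x (D y v)
  N : ℕ → Submodule ℂ E
  N_zero : ∀ v ∈ N 0, v = 0
  N_exhaust : ∀ v, ∃ l, v ∈ N l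
  C_N : ∀ l w v, v ∈ N (l + 1) → C w v ∈ N l
  π : E →ₗ[ℂ] ℂ
  detect : ∀ (s : Finset ℂ) (v : E), (∀ w ∉ s, C w v = 0) → π v = 0 → v = 0
  q : ℂ → ℂ
  p : ℂ → ℂ
  π_A : ∀ x v, π (A x v) = q x * π v
  π_D : ∀ x v, π (D x v) = p x * π v
  π_B : ∀ x v, π (B x v) = 0

namespace LoweringData

variable {E : Type} [AddCommGroup E] [Module ℂ E] (M : LoweringData E)

theorem CA' {x y : ℂ} (h : x ≠ y) (v : E) : M.C x (M.A y v) =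
    ((x - y + 1) / (x - y)) • M.A y (M.C x v) - (1 / (x - y)) • M.A x (M.C y v) := by
  have h' : x - y ≠ 0 := sub_ne_zero.2 h
  rw [← smul_right_injective E h' |>.eq_iff, M.CA, smul_sub, smul_smul, smul_smul,
    mul_div_cancel₀ _ h', mul_div_cancel₀ _ h', one_smul]

theorem CD' {x y : ℂ} (h : x ≠ y) (v : E) : M.C x (M.D y v) =
    ((x - y - 1) / (x - y)) • M.D y (M.C x v) + (1 / (x - y)) • M.D x (M.C y v) := by
  have h' : x - y ≠ 0 := sub_ne_zero.2 h
  rw [← smul_right_injective E h' |>.eq_iff, M.CD, smul_add, smul_smul, smul_smul,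
    mul_div_cancel₀ _ h', mul_div_cancel₀ _ h', one_smul]

theorem CB' {x y : ℂ} (h : x ≠ y) (v : E) : M.C x (M.B y v) =
    M.B y (M.C x v) + (1 / (x - y)) • (M.A y (M.D x v) - M.A x (M.D y v)) := by
  have h' : x - y ≠ 0 := sub_ne_zero.2 h
  rw [← M.CB, smul_smul, one_div, inv_mul_cancel₀ h', one_smul]
  abel

/-- A family of operators vanishes if it does so in degree zero and up to what it does to vectors
of lower degree. -/
theorem eq_of_lowering {ι : Type} (X Y : ι → E → E) (s : ι → Finset ℂ)
    (h0 : ∀ i v, X i 0 = Y i 0 ∧ M.π (X i v) = M.π (Y i v))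
    (hC : ∀ l, (∀ i, ∀ v ∈ M.N l, X i v = Y i v) → ∀ i, ∀ v ∈ M.N (l + 1),
      ∀ w ∉ s i, M.C w (X i v) = M.C w (Y i v)) (i : ι) (v : E) : X i v = Y i v := by
  obtain ⟨l, hl⟩ := M.N_exhaust v
  have key : ∀ l, ∀ i, ∀ v ∈ M.N l, X i v = Y i v := by
    intro l
    induction l with
    | zero =>
      intro i v hv
      rw [M.N_zero v hv]
      exact (h0 i v).1
    | succ l ih =>
      intro i v hv
      rw [← sub_eq_zero]
      refine M.detect (s i) _ (fun w hw => ?_) ?_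
      · rw [map_sub, hC l ih i v hv w hw, sub_self]
      · rw [map_sub, (h0 i v).2, sub_self]
  exact key l i v hl

/-- Moving `C(w)` to the right through both products leaves terms `A A C v` in the arguments `x, y,
w`. The inductive hypothesis makes the two `A` commute there, because `C v` has smaller degree. What
remains is an identity of rational functions in `w, x, y`. -/
theorem AA (x y : ℂ) (v : E) : M.A x (M.A y v) = M.A y (M.A x v) := by
  refine M.eq_of_lowering (fun i : ℂ × ℂ => fun v => M.A i.1 (M.A i.2 v))
    (fun i v => M.A i.2 (M.A i.1 v)) (fun i => {i.1, i.2}) ?_ ?_ (x, y) v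
  · intro i v
    simp only [map_zero, M.π_A, true_and]
    ring
  · rintro l ih ⟨x, y⟩ v hv w hw
    simp only [Finset.mem_insert, Finset.mem_singleton, not_or] at hw
    obtain ⟨hx, hy⟩ := hw
    -- The relation is trivial at equal arguments; for different ones the exchange relations can be
    -- solved with denominator `x - y`.
    rcases eq_or_ne x y with rfl | hxy
    · rfl
    have ih' : ∀ a b c, M.A a (M.A b (M.C c v)) = M.A b (M.A a (M.C c v)) :=
      fun a b c => ih (a, b) _ (M.C_N l c v hv)
    simp only [M.CA' hx, M.CA' hy, M.CA' hxy, M.CA' hxy.symm, map_sub, map_smul]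
    -- A fixed order of the arguments, so that equal vectors become equal atoms for `match_scalars`.
    rw [ih' y x w, ih' w x, ih' w y]
    have h1 := sub_ne_zero.2 hx
    have h2 := sub_ne_zero.2 hy
    have h3 := sub_ne_zero.2 hxy
    have h4 := sub_ne_zero.2 hxy.symm
    match_scalars <;> field_simp <;> ring1

theorem DD (x y : ℂ) (v : E) : M.D x (M.D y v) = M.D y (M.D x v) := by
  refine M.eq_of_lowering (fun i : ℂ × ℂ => fun v => M.D i.1 (M.D i.2 v))
    (fun i v => M.D i.2 (M.D i.1 v)) (fun i => {i.1, i.2}) ?_ ?_ (x, y) v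
  · intro i v
    simp only [map_zero, M.π_D, true_and]
    ring
  · rintro l ih ⟨x, y⟩ v hv w hw
    simp only [Finset.mem_insert, Finset.mem_singleton, not_or] at hw
    obtain ⟨hx, hy⟩ := hw
    rcases eq_or_ne x y with rfl | hxy
    · rfl
    have ih' : ∀ a b c, M.D a (M.D b (M.C c v)) = M.D b (M.D a (M.C c v)) :=
      fun a b c => ih (a, b) _ (M.C_N l c v hv)
    simp only [M.CD' hx, M.CD' hy, M.CD' hxy, M.CD' hxy.symm, map_add, map_smul]
    rw [ih' y x w, ih' w x, ih' w y]
    have h1 := sub_ne_zero.2 hx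
    have h2 := sub_ne_zero.2 hy
    have h3 := sub_ne_zero.2 hxy
    have h4 := sub_ne_zero.2 hxy.symm
    match_scalars <;> field_simp <;> ring1

/-- Passing `C(w)` through `B` creates products `A D C v`, which are compared with those from the
left side. The inductive hypothesis reorders `D A` on `C v` at the price of terms `B C C v`, and
these match because the `C` commute. -/
theorem AD (x y : ℂ) (v : E) : (x - y) • (M.A x (M.D y v) - M.D y (M.A x v)) =
    M.B x (M.C y v) - M.B y (M.C x v) := by
  refine M.eq_of_lowering
    (fun i : ℂ × ℂ => fun v => (i.1 - i.2) • (M.A i.1 (M.D i.2 v) - M.D i.2 (M.A i.1 v)))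
    (fun i v => M.B i.1 (M.C i.2 v) - M.B i.2 (M.C i.1 v)) (fun i => {i.1, i.2}) ?_ ?_ (x, y) v
  · intro i v
    simp only [map_zero, M.π_A, M.π_D, M.π_B, map_sub, map_smul, smul_eq_mul, sub_self,
      smul_zero, true_and]
    ring
  · rintro l ih ⟨x, y⟩ v hv w hw
    simp only [Finset.mem_insert, Finset.mem_singleton, not_or] at hw
    obtain ⟨hx, hy⟩ := hw
    rcases eq_or_ne x y with rfl | hxy
    · simp
    have ih' : ∀ a b c, a ≠ b → M.D b (M.A a (M.C c v)) = M.A a (M.D b (M.C c v)) -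
        (1 / (a - b)) • (M.B a (M.C b (M.C c v)) - M.B b (M.C a (M.C c v))) := by
      intro a b c hab
      rw [← ih (a, b) _ (M.C_N l c v hv), smul_smul, one_div,
        inv_mul_cancel₀ (sub_ne_zero.2 hab), one_smul]
      abel
    simp only [M.CA' hx, M.CD' hy, M.CA' hxy.symm, M.CD' hxy, M.CB' hx, M.CB' hy, map_sub, map_add,
      map_smul]
    simp only [ih' _ _ _ hxy, ih' _ _ _ hy, ih' _ _ _ (Ne.symm hx),
      ih' _ _ _ (Ne.symm hy)]
    rw [M.CC y x, M.CC w x, M.CC w y]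
    have h1 := sub_ne_zero.2 hx
    have h2 := sub_ne_zero.2 hy
    have h3 := sub_ne_zero.2 hxy
    have h4 := sub_ne_zero.2 hxy.symm
    have h5 := sub_ne_zero.2 (Ne.symm hx)
    match_scalars <;> field_simp <;> ring1

theorem DA {x y : ℂ} (h : x ≠ y) (v : E) : M.D y (M.A x v) =
    M.A x (M.D y v) - (1 / (x - y)) • (M.B x (M.C y v) - M.B y (M.C x v)) := by
  rw [← M.AD, smul_smul, one_div, inv_mul_cancel₀ (sub_ne_zero.2 h), one_smul]
  abel

/-- The commutator of `C(w)` with `B` brings in `A A D v` and `A D A v`. So besides the inductive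
hypothesis, the relations `AA` and `DA` already proved for arbitrary vectors are needed. -/
theorem AB (x y : ℂ) (v : E) : (x - y) • (M.A x (M.B y v) - M.B y (M.A x v)) =
    M.B x (M.A y v) - M.B y (M.A x v) := by
  refine M.eq_of_lowering
    (fun i : ℂ × ℂ => fun v => (i.1 - i.2) • (M.A i.1 (M.B i.2 v) - M.B i.2 (M.A i.1 v)))
    (fun i v => M.B i.1 (M.A i.2 v) - M.B i.2 (M.A i.1 v)) (fun i => {i.1, i.2}) ?_ ?_ (x, y) v
  · intro i v
    simp only [map_zero, M.π_A, M.π_B, map_sub, map_smul, smul_eq_mul, sub_self,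
      smul_zero, mul_zero, true_and]
  · rintro l ih ⟨x, y⟩ v hv w hw
    simp only [Finset.mem_insert, Finset.mem_singleton, not_or] at hw
    obtain ⟨hx, hy⟩ := hw
    rcases eq_or_ne x y with rfl | hxy
    · simp
    have ih' : ∀ a b c, a ≠ b → M.A a (M.B b (M.C c v)) = M.B b (M.A a (M.C c v)) +
        (1 / (a - b)) • (M.B a (M.A b (M.C c v)) - M.B b (M.A a (M.C c v))) := by
      intro a b c hab
      rw [← ih (a, b) _ (M.C_N l c v hv), smul_smul, one_div,
        inv_mul_cancel₀ (sub_ne_zero.2 hab), one_smul]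
      abel
    have hx' := Ne.symm hx
    have hy' := Ne.symm hy
    simp only [M.CA' hx, M.CA' hy, M.CB' hx, M.CB' hy, M.CB' hxy, map_sub, map_add,
      map_smul, M.DA hxy, M.DA hxy.symm, M.DA hx', M.DA hy']
    simp only [ih' _ _ _ hxy, ih' _ _ _ hxy.symm, ih' _ _ _ hx, ih' _ _ _ hx', ih' _ _ _ hy,
      ih' _ _ _ hy']
    rw [M.AA y x, M.AA w x, M.AA w y]
    have h1 := sub_ne_zero.2 hx
    have h2 := sub_ne_zero.2 hy
    have h3 := sub_ne_zero.2 hxy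
    have h4 := sub_ne_zero.2 hxy.symm
    have h5 := sub_ne_zero.2 hx'
    have h6 := sub_ne_zero.2 hy'
    match_scalars <;> field_simp <;> ring1

theorem DB (x y : ℂ) (v : E) : (x - y) • (M.D x (M.B y v) - M.B y (M.D x v)) =
    M.B y (M.D x v) - M.B x (M.D y v) := by
  refine M.eq_of_lowering
    (fun i : ℂ × ℂ => fun v => (i.1 - i.2) • (M.D i.1 (M.B i.2 v) - M.B i.2 (M.D i.1 v)))
    (fun i v => M.B i.2 (M.D i.1 v) - M.B i.1 (M.D i.2 v)) (fun i => {i.1, i.2}) ?_ ?_ (x, y) v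
  · intro i v
    simp only [map_zero, M.π_D, M.π_B, map_sub, map_smul, smul_eq_mul, sub_self,
      smul_zero, mul_zero, true_and]
  · rintro l ih ⟨x, y⟩ v hv w hw
    simp only [Finset.mem_insert, Finset.mem_singleton, not_or] at hw
    obtain ⟨hx, hy⟩ := hw
    rcases eq_or_ne x y with rfl | hxy
    · simp
    have ih' : ∀ a b c, a ≠ b → M.D a (M.B b (M.C c v)) = M.B b (M.D a (M.C c v)) +
        (1 / (a - b)) • (M.B b (M.D a (M.C c v)) - M.B a (M.D b (M.C c v))) := by
      intro a b c hab
      rw [← ih (a, b) _ (M.C_N l c v hv), smul_smul, one_div,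
        inv_mul_cancel₀ (sub_ne_zero.2 hab), one_smul]
      abel
    have hx' := Ne.symm hx
    have hy' := Ne.symm hy
    simp only [M.CD' hx, M.CD' hy, M.CB' hx, M.CB' hy, M.CB' hxy, map_sub, map_add,
      map_smul, M.DA hxy.symm, M.DA hx, M.DA hx', M.DA hy']
    simp only [M.CD' hxy, M.CD' hxy.symm, M.CD' hx', M.CD' hy', map_add,
      map_smul]
    simp only [ih' _ _ _ hxy, ih' _ _ _ hy]
    rw [M.DD y x, M.DD w x, M.DD w y]
    have h1 := sub_ne_zero.2 hx
    have h2 := sub_ne_zero.2 hy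
    have h3 := sub_ne_zero.2 hxy
    have h4 := sub_ne_zero.2 hxy.symm
    have h5 := sub_ne_zero.2 hx'
    have h6 := sub_ne_zero.2 hy'
    match_scalars <;> field_simp <;> ring1

theorem AB' {x y : ℂ} (h : x ≠ y) (v : E) : M.A x (M.B y v) = M.B y (M.A x v) +
    (1 / (x - y)) • (M.B x (M.A y v) - M.B y (M.A x v)) := by
  rw [← M.AB, smul_smul, one_div, inv_mul_cancel₀ (sub_ne_zero.2 h), one_smul]
  abel

theorem DB' {x y : ℂ} (h : x ≠ y) (v : E) : M.D x (M.B y v) = M.B y (M.D x v) +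
    (1 / (x - y)) • (M.B y (M.D x v) - M.B x (M.D y v)) := by
  rw [← M.DB, smul_smul, one_div, inv_mul_cancel₀ (sub_ne_zero.2 h), one_smul]
  abel

/-- After `C(w)` is applied, the mixed relations `AB'` and `DB'` carry every remaining `B` to the
left of `A` and `D`; the terms with two `B` end in `C v` and are covered by induction. -/
theorem BB (x y : ℂ) (v : E) : M.B x (M.B y v) = M.B y (M.B x v) := by
  refine M.eq_of_lowering (fun i : ℂ × ℂ => fun v => M.B i.1 (M.B i.2 v))
    (fun i v => M.B i.2 (M.B i.1 v)) (fun i => {i.1, i.2}) ?_ ?_ (x, y) v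
  · intro i v
    simp only [map_zero, M.π_B, true_and]
  · rintro l ih ⟨x, y⟩ v hv w hw
    simp only [Finset.mem_insert, Finset.mem_singleton, not_or] at hw
    obtain ⟨hx, hy⟩ := hw
    rcases eq_or_ne x y with rfl | hxy
    · rfl
    have ih' : ∀ a b c, M.B a (M.B b (M.C c v)) = M.B b (M.B a (M.C c v)) :=
      fun a b c => ih (a, b) _ (M.C_N l c v hv)
    have hx' := Ne.symm hx
    have hy' := Ne.symm hy
    simp only [M.CB' hx, M.CB' hy, map_sub, map_add, map_smul, M.DB' hxy, M.DB' hxy.symm,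
      M.DB' hx, M.DB' hy, M.AB' hxy, M.AB' hxy.symm, M.AB' hx, M.AB' hx',
      M.AB' hy, M.AB' hy']
    rw [ih' y x w]
    have h1 := sub_ne_zero.2 hx
    have h2 := sub_ne_zero.2 hy
    have h3 := sub_ne_zero.2 hxy
    have h4 := sub_ne_zero.2 hxy.symm
    have h5 := sub_ne_zero.2 hx'
    have h6 := sub_ne_zero.2 hy'
    match_scalars <;> field_simp <;> ring1

/-- The generating functions `T_{ij}`. -/
def T (i j : Fin 2) : ℂ → Module.End ℂ E :=
  (![![M.A, M.B], ![M.C, M.D]] : Fin 2 → Fin 2 → ℂ → Module.End ℂ E) i j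

/-- The RTT relation has an equivalent form with the operators on the right in the opposite order.
Substituting the solved relations at `(x, y)` and `(y, x)` passes from one form to the other; the
next lemmas do this for the other pairs. -/
theorem BA_eq (x y : ℂ) (v : E) : (x - y) • (M.A x (M.B y v) - M.B y (M.A x v)) =
    M.A y (M.B x v) - M.A x (M.B y v) := by
  rcases eq_or_ne x y with rfl | h
  · simp
  have h1 := sub_ne_zero.2 h
  have h2 := sub_ne_zero.2 h.symm
  rw [M.AB' h, M.AB' h.symm]
  match_scalars <;> field_simp <;> ring1

theorem BD_eq (x y : ℂ) (v : E) : (x - y) • (M.B x (M.D y v) - M.D y (M.B x v)) =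
    M.D y (M.B x v) - M.D x (M.B y v) := by
  rcases eq_or_ne x y with rfl | h
  · simp
  have h1 := sub_ne_zero.2 h
  have h2 := sub_ne_zero.2 h.symm
  rw [M.DB' h, M.DB' h.symm]
  match_scalars <;> field_simp <;> ring1

theorem CA_eq (x y : ℂ) (v : E) : (x - y) • (M.A x (M.C y v) - M.C y (M.A x v)) =
    M.C y (M.A x v) - M.C x (M.A y v) := by
  rcases eq_or_ne x y with rfl | h
  · simp
  have h1 := sub_ne_zero.2 h
  have h2 := sub_ne_zero.2 h.symm
  rw [M.CA' h, M.CA' h.symm]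
  match_scalars <;> field_simp <;> ring1

theorem CD_eq (x y : ℂ) (v : E) : (x - y) • (M.C x (M.D y v) - M.D y (M.C x v)) =
    M.C y (M.D x v) - M.C x (M.D y v) := by
  rcases eq_or_ne x y with rfl | h
  · simp
  have h1 := sub_ne_zero.2 h
  have h2 := sub_ne_zero.2 h.symm
  rw [M.CD' h, M.CD' h.symm]
  match_scalars <;> field_simp <;> ring1

theorem AD_eq (x y : ℂ) (v : E) : (x - y) • (M.A x (M.D y v) - M.D y (M.A x v)) =
    M.C y (M.B x v) - M.C x (M.B y v) := by
  rcases eq_or_ne x y with rfl | h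
  · simp
  have h1 := sub_ne_zero.2 h
  have h2 := sub_ne_zero.2 h.symm
  rw [M.CB' h, M.CB' h.symm, M.AD]
  match_scalars <;> field_simp <;> ring1

theorem BC_eq (x y : ℂ) (v : E) : (x - y) • (M.B x (M.C y v) - M.C y (M.B x v)) =
    M.D y (M.A x v) - M.D x (M.A y v) := by
  rcases eq_or_ne x y with rfl | h
  · simp
  have h1 := sub_ne_zero.2 h
  have h2 := sub_ne_zero.2 h.symm
  rw [M.CB' h.symm, M.DA h, M.DA h.symm]
  match_scalars <;> field_simp <;> ring1

/-- The defining relations of the Yangian. -/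
theorem rtt (i j k l : Fin 2) (x y : ℂ) (v : E) :
    (x - y) • (M.T i j x (M.T k l y v) - M.T k l y (M.T i j x v)) =
      M.T k j y (M.T i l x v) - M.T k j x (M.T i l y v) := by
  fin_cases i <;> fin_cases j <;> fin_cases k <;> fin_cases l <;>
    simp only [T, Fin.zero_eta, Fin.mk_one, Matrix.cons_val_zero, Matrix.cons_val_one,
      Matrix.cons_val_fin_one, Fin.isValue]
  · rw [M.AA y x, sub_self, smul_zero]
  · rw [M.BA_eq]
  · rw [M.CA_eq]
  · rw [M.AD_eq]
  · linear_combination (norm := module) M.AB y x v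
  · rw [M.BB y x, sub_self, smul_zero]
  · rw [M.BC_eq]
  · rw [M.BD_eq]
  · linear_combination (norm := module) M.CA x y v
  · rw [← M.CB]
  · rw [M.CC y x, sub_self, smul_zero]
  · rw [M.CD_eq]
  · linear_combination (norm := module) M.AD y x v
  · linear_combination (norm := module) M.DB x y v
  · linear_combination (norm := module) M.CD y x v
  · rw [M.DD y x, sub_self, smul_zero]

end LoweringData

/-! ### Closed formulas on finite sets and their recursions -/

section ClosedFormulas

variable {L : Type} [Field L] [DecidableEq L]

/-- `∏_{c ∈ S} (x - c - ε) / (x - c)`. -/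
def ratioProd (ε x : L) (S : Finset L) : L := ∏ c ∈ S, (x - c - ε) / (x - c)

theorem ratioProd_insert {ε x w : L} {S : Finset L} (hw : w ∉ S) :
    ratioProd ε x (insert w S) = (x - w - ε) / (x - w) * ratioProd ε x S :=
  Finset.prod_insert hw

theorem ratioProd_erase {ε x a : L} {S : Finset L} (ha : a ∈ S) :
    ratioProd ε x S = (x - a - ε) / (x - a) * ratioProd ε x (S.erase a) :=
  (Finset.mul_prod_erase S _ ha).symm

/-- The action of the diagonal generators on symmetric functions, a symmetric function being
considered as a function of finite sets. -/
def diagSum (ε : L) (h : L → L) (F : Finset L → L) (u : L) (T : Finset L) : L :=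
  h u * F T * ratioProd ε u T +
    ∑ a ∈ T, ε * h a * F (insert u (T.erase a)) / (u - a) * ratioProd ε a (T.erase a)

/-- The action of the raising generator on symmetric functions. -/
def raiseSum (q p : L → L) (F : Finset L → L) (u : L) (T : Finset L) : L :=
  (∑ a ∈ T, F (T.erase a) / (u - a) *
    (p u * q a * ratioProd (-1) u (T.erase a) * ratioProd 1 a (T.erase a) -
      q u * p a * ratioProd 1 u (T.erase a) * ratioProd (-1) a (T.erase a))) -
  ∑ a ∈ T, ∑ b ∈ T.erase a, F (insert u ((T.erase a).erase b)) *
    (p a * q b / ((u - a) * (u - b)) * ((a - b + 1) / (a - b)) *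
      ratioProd (-1) a ((T.erase a).erase b) * ratioProd 1 b ((T.erase a).erase b))

/-- This is the exchange relation of `C` with `A` (`ε = 1`) or `D` (`ε = -1`), since `C(w)` inserts
the point `w`. The summand of `w` on the left supplies the leading term of the formula at `w`; the
others agree by partial fractions. -/
theorem diagSum_insert (ε : L) (h : L → L) (F : Finset L → L) {u w : L} {T : Finset L}
    (hu : u ∉ T) (hw : w ∉ T) (huw : u ≠ w) :
    (w - u) * diagSum ε h F u (insert w T) =
      (w - u + ε) * diagSum ε h (fun S => F (insert w S)) u T -
        ε * diagSum ε h (fun S => F (insert u S)) w T := by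
  have h1 : u - w ≠ 0 := sub_ne_zero.2 huw
  have key : (w - u) * ∑ a ∈ T, ε * h a * F (insert u ((insert w T).erase a)) / (u - a) *
      ratioProd ε a ((insert w T).erase a) =
      (w - u + ε) * ∑ a ∈ T, ε * h a * F (insert w (insert u (T.erase a))) / (u - a) *
        ratioProd ε a (T.erase a) -
      ε * ∑ a ∈ T, ε * h a * F (insert u (insert w (T.erase a))) / (w - a) *
        ratioProd ε a (T.erase a) := by
    rw [Finset.mul_sum, Finset.mul_sum, Finset.mul_sum, ← Finset.sum_sub_distrib]
    refine Finset.sum_congr rfl fun a ha => ?_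
    have haw : a ≠ w := fun e => hw (e ▸ ha)
    have hau : a ≠ u := fun e => hu (e ▸ ha)
    rw [Finset.erase_insert_of_ne haw.symm,
      ratioProd_insert (fun hh => hw (Finset.mem_of_mem_erase hh)), Finset.insert_comm w u]
    have h2 : u - a ≠ 0 := sub_ne_zero.2 hau.symm
    have h3 : a - w ≠ 0 := sub_ne_zero.2 haw
    have h4 : w - a ≠ 0 := sub_ne_zero.2 haw.symm
    field_simp
    ring1
  unfold diagSum
  rw [Finset.sum_insert hw, mul_add, mul_add (w - u) (_ / _ * _), key, Finset.erase_insert hw,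
    ratioProd_insert hw]
  field_simp
  ring1

/-- The product `A(u) D(w)` sorted by how many points of `T` have been replaced: none, one or two.
In this form it can be compared with the raising formula. -/
theorem diagSum_diagSum (q p : L → L) (F : Finset L → L) {u w : L} {T : Finset L}
    (hu : u ∉ T) :
    diagSum 1 q (diagSum (-1) p F w) u T =
      q u * p w * F T * ratioProd (-1) w T * ratioProd 1 u T +
      ∑ a ∈ T, (-(q u * p a * F (insert w (T.erase a)) / (w - a) * ratioProd (-1) a (T.erase a) *
          ((u - a - 1) / (u - a)) * ratioProd 1 u (T.erase a)) +
        q a / (u - a) * ratioProd 1 a (T.erase a) *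
          (p w * F (insert u (T.erase a)) * ((w - u + 1) / (w - u)) *
              ratioProd (-1) w (T.erase a) -
            p u * F (insert w (T.erase a)) / (w - u) * ratioProd (-1) u (T.erase a))) -
      ∑ a ∈ T, ∑ b ∈ T.erase a, F (insert w (insert u ((T.erase a).erase b))) *
        (q a * p b / ((u - a) * (w - b)) * ((a - b - 1) / (a - b)) * ((b - u + 1) / (b - u)) *
          ratioProd 1 a ((T.erase a).erase b) * ratioProd (-1) b ((T.erase a).erase b)) := by
  have key : ∀ a ∈ T, 1 * q a * diagSum (-1) p F w (insert u (T.erase a)) / (u - a) *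
      ratioProd 1 a (T.erase a) =
      q a / (u - a) * ratioProd 1 a (T.erase a) *
          (p w * F (insert u (T.erase a)) * ((w - u + 1) / (w - u)) *
              ratioProd (-1) w (T.erase a) -
            p u * F (insert w (T.erase a)) / (w - u) * ratioProd (-1) u (T.erase a)) -
      ∑ b ∈ T.erase a, F (insert w (insert u ((T.erase a).erase b))) *
        (q a * p b / ((u - a) * (w - b)) * ((a - b - 1) / (a - b)) * ((b - u + 1) / (b - u)) *
          ratioProd 1 a ((T.erase a).erase b) * ratioProd (-1) b ((T.erase a).erase b)) := by
    intro a ha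
    have hu' : u ∉ T.erase a := fun hh => hu (Finset.mem_of_mem_erase hh)
    have hsum : ∑ b ∈ T.erase a, F (insert w (insert u ((T.erase a).erase b))) *
        (q a * p b / ((u - a) * (w - b)) * ((a - b - 1) / (a - b)) * ((b - u + 1) / (b - u)) *
          ratioProd 1 a ((T.erase a).erase b) * ratioProd (-1) b ((T.erase a).erase b)) =
        -(q a / (u - a) * ratioProd 1 a (T.erase a) *
          ∑ b ∈ T.erase a, -1 * p b * F (insert w ((insert u (T.erase a)).erase b)) / (w - b) *
            ratioProd (-1) b ((insert u (T.erase a)).erase b)) := by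
      rw [Finset.mul_sum, ← Finset.sum_neg_distrib]
      refine Finset.sum_congr rfl fun b hb => ?_
      have hbu : b ≠ u := fun e => hu' (e ▸ hb)
      rw [Finset.erase_insert_of_ne hbu.symm,
        ratioProd_insert (fun hh => hu' (Finset.mem_of_mem_erase hh)), ratioProd_erase hb]
      simp only [div_eq_mul_inv, mul_inv]
      ring1
    rw [hsum]
    unfold diagSum
    -- The inner operator may replace the point `u` that the outer one has just inserted; that
    -- summand is the source of the terms with `p u`.
    rw [Finset.sum_insert hu', Finset.erase_insert hu', ratioProd_insert hu']
    ring1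
  rw [diagSum, Finset.sum_congr rfl key, Finset.sum_sub_distrib, Finset.sum_add_distrib]
  have hsum : ∑ a ∈ T, -(q u * p a * F (insert w (T.erase a)) / (w - a) *
      ratioProd (-1) a (T.erase a) * ((u - a - 1) / (u - a)) * ratioProd 1 u (T.erase a)) =
      q u * (∑ a ∈ T, -1 * p a * F (insert w (T.erase a)) / (w - a) *
        ratioProd (-1) a (T.erase a)) * ratioProd 1 u T := by
    rw [Finset.mul_sum, Finset.sum_mul]
    refine Finset.sum_congr rfl fun a ha => ?_
    rw [ratioProd_erase ha]
    ring1
  rw [hsum]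
  unfold diagSum
  ring1

theorem sum_sum_erase_comm (T : Finset L) (f : L → L → L) :
    ∑ a ∈ T, ∑ b ∈ T.erase a, f a b = ∑ b ∈ T, ∑ a ∈ T.erase b, f a b := by
  refine Finset.sum_comm' fun a b => ?_
  simp only [Finset.mem_erase]
  tauto

/-- This is `(w - u) [C(w), B(u)] = A(u) D(w) - A(w) D(u)` on functions of sets. Both sides are
grouped by the set at which `F` is evaluated, and the groups agree summand by summand. -/
theorem raiseSum_insert (q p : L → L) (F : Finset L → L) {u w : L} {T : Finset L}
    (hu : u ∉ T) (hw : w ∉ T) (huw : u ≠ w) :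
    (w - u) * raiseSum q p F u (insert w T) =
      (w - u) * raiseSum q p (fun S => F (insert w S)) u T +
        (diagSum 1 q (diagSum (-1) p F w) u T - diagSum 1 q (diagSum (-1) p F u) w T) := by
  have h1 : u - w ≠ 0 := sub_ne_zero.2 huw
  have h1' : w - u ≠ 0 := sub_ne_zero.2 huw.symm
  rw [diagSum_diagSum q p F hu, diagSum_diagSum q p F hw]
  -- In `raiseSum` the outer index carries `p`, in the product of diagonal operators it carries `q`;
  -- the order of summation is exchanged to align them.
  rw [sum_sum_erase_comm T fun a b => F (insert w (insert u ((T.erase a).erase b))) * _,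
    sum_sum_erase_comm T fun a b => F (insert u (insert w ((T.erase a).erase b))) * _]
  -- The point `w` may be the only point removed, one of the two replaced points, or a spectator
  -- that contributes a factor to the products.
  have e1 : raiseSum q p F u (insert w T) =
      F T / (u - w) * (p u * q w * ratioProd (-1) u T * ratioProd 1 w T -
        q u * p w * ratioProd 1 u T * ratioProd (-1) w T) +
      ∑ a ∈ T, (F (insert w (T.erase a)) / (u - a) *
        (p u * q a * ((u - w + 1) / (u - w)) * ((a - w - 1) / (a - w)) *
            ratioProd (-1) u (T.erase a) * ratioProd 1 a (T.erase a) -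
          q u * p a * ((u - w - 1) / (u - w)) * ((a - w + 1) / (a - w)) *
            ratioProd 1 u (T.erase a) * ratioProd (-1) a (T.erase a)) -
        F (insert u (T.erase a)) * (p w * q a / ((u - w) * (u - a)) * ((w - a + 1) / (w - a)) *
          ratioProd (-1) w (T.erase a) * ratioProd 1 a (T.erase a)) -
        F (insert u (T.erase a)) * (p a * q w / ((u - a) * (u - w)) * ((a - w + 1) / (a - w)) *
          ratioProd (-1) a (T.erase a) * ratioProd 1 w (T.erase a))) -
      ∑ a ∈ T, ∑ b ∈ T.erase a, F (insert u (insert w ((T.erase a).erase b))) *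
        (p a * q b / ((u - a) * (u - b)) * ((a - b + 1) / (a - b)) *
          ((a - w + 1) / (a - w)) * ((b - w - 1) / (b - w)) *
          ratioProd (-1) a ((T.erase a).erase b) * ratioProd 1 b ((T.erase a).erase b)) := by
    unfold raiseSum
    rw [Finset.sum_insert hw, Finset.sum_insert hw, Finset.erase_insert hw,
      Finset.sum_sub_distrib, Finset.sum_sub_distrib]
    have s1 : ∑ a ∈ T, F ((insert w T).erase a) / (u - a) *
        (p u * q a * ratioProd (-1) u ((insert w T).erase a) *
            ratioProd 1 a ((insert w T).erase a) -
          q u * p a * ratioProd 1 u ((insert w T).erase a) *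
            ratioProd (-1) a ((insert w T).erase a)) =
        ∑ a ∈ T, F (insert w (T.erase a)) / (u - a) *
          (p u * q a * ((u - w + 1) / (u - w)) * ((a - w - 1) / (a - w)) *
              ratioProd (-1) u (T.erase a) * ratioProd 1 a (T.erase a) -
            q u * p a * ((u - w - 1) / (u - w)) * ((a - w + 1) / (a - w)) *
              ratioProd 1 u (T.erase a) * ratioProd (-1) a (T.erase a)) := by
      refine Finset.sum_congr rfl fun a ha => ?_
      have haw : a ≠ w := fun e => hw (e ▸ ha)
      have hw' : w ∉ T.erase a := fun hh => hw (Finset.mem_of_mem_erase hh)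
      simp only [Finset.erase_insert_of_ne haw.symm, ratioProd_insert hw']
      ring1
    have s2 : ∑ a ∈ T, ∑ b ∈ (insert w T).erase a,
        F (insert u (((insert w T).erase a).erase b)) *
          (p a * q b / ((u - a) * (u - b)) * ((a - b + 1) / (a - b)) *
            ratioProd (-1) a (((insert w T).erase a).erase b) *
            ratioProd 1 b (((insert w T).erase a).erase b)) =
        ∑ a ∈ T, F (insert u (T.erase a)) * (p a * q w / ((u - a) * (u - w)) *
          ((a - w + 1) / (a - w)) *
          ratioProd (-1) a (T.erase a) * ratioProd 1 w (T.erase a)) +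
        ∑ a ∈ T, ∑ b ∈ T.erase a, F (insert u (insert w ((T.erase a).erase b))) *
        (p a * q b / ((u - a) * (u - b)) * ((a - b + 1) / (a - b)) *
          ((a - w + 1) / (a - w)) * ((b - w - 1) / (b - w)) *
          ratioProd (-1) a ((T.erase a).erase b) * ratioProd 1 b ((T.erase a).erase b)) := by
      rw [← Finset.sum_add_distrib]
      refine Finset.sum_congr rfl fun a ha => ?_
      have haw : a ≠ w := fun e => hw (e ▸ ha)
      have hw' : w ∉ T.erase a := fun hh => hw (Finset.mem_of_mem_erase hh)
      rw [Finset.erase_insert_of_ne haw.symm, Finset.sum_insert hw', Finset.erase_insert hw']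
      congr 1
      refine Finset.sum_congr rfl fun b hb => ?_
      have hbw : b ≠ w := fun e => hw' (e ▸ hb)
      have hw'' : w ∉ (T.erase a).erase b := fun hh => hw' (Finset.mem_of_mem_erase hh)
      simp only [Finset.erase_insert_of_ne hbw.symm, ratioProd_insert hw'', div_eq_mul_inv,
        mul_inv]
      ring1
    rw [s1, s2]
    ring1
  rw [e1]
  unfold raiseSum
  -- Terms in which exactly one point of `T` is missing from the argument of `F`.
  have t1 : (w - u) * ∑ a ∈ T, (F (insert w (T.erase a)) / (u - a) *
        (p u * q a * ((u - w + 1) / (u - w)) * ((a - w - 1) / (a - w)) *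
            ratioProd (-1) u (T.erase a) * ratioProd 1 a (T.erase a) -
          q u * p a * ((u - w - 1) / (u - w)) * ((a - w + 1) / (a - w)) *
            ratioProd 1 u (T.erase a) * ratioProd (-1) a (T.erase a)) -
        F (insert u (T.erase a)) * (p w * q a / ((u - w) * (u - a)) * ((w - a + 1) / (w - a)) *
          ratioProd (-1) w (T.erase a) * ratioProd 1 a (T.erase a)) -
        F (insert u (T.erase a)) * (p a * q w / ((u - a) * (u - w)) * ((a - w + 1) / (a - w)) *
          ratioProd (-1) a (T.erase a) * ratioProd 1 w (T.erase a))) =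
      (w - u) * ∑ a ∈ T, F (insert w (T.erase a)) / (u - a) *
        (p u * q a * ratioProd (-1) u (T.erase a) * ratioProd 1 a (T.erase a) -
          q u * p a * ratioProd 1 u (T.erase a) * ratioProd (-1) a (T.erase a)) +
      ∑ a ∈ T, (-(q u * p a * F (insert w (T.erase a)) / (w - a) * ratioProd (-1) a (T.erase a) *
          ((u - a - 1) / (u - a)) * ratioProd 1 u (T.erase a)) +
        q a / (u - a) * ratioProd 1 a (T.erase a) *
          (p w * F (insert u (T.erase a)) * ((w - u + 1) / (w - u)) *
              ratioProd (-1) w (T.erase a) -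
            p u * F (insert w (T.erase a)) / (w - u) * ratioProd (-1) u (T.erase a))) -
      ∑ a ∈ T, (-(q w * p a * F (insert u (T.erase a)) / (u - a) * ratioProd (-1) a (T.erase a) *
          ((w - a - 1) / (w - a)) * ratioProd 1 w (T.erase a)) +
        q a / (w - a) * ratioProd 1 a (T.erase a) *
          (p u * F (insert w (T.erase a)) * ((u - w + 1) / (u - w)) *
              ratioProd (-1) u (T.erase a) -
            p w * F (insert u (T.erase a)) / (u - w) * ratioProd (-1) w (T.erase a))) := by
    rw [Finset.mul_sum, Finset.mul_sum, ← Finset.sum_add_distrib, ← Finset.sum_sub_distrib]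
    refine Finset.sum_congr rfl fun a ha => ?_
    have haw : a ≠ w := fun e => hw (e ▸ ha)
    have hau : a ≠ u := fun e => hu (e ▸ ha)
    have h2 : u - a ≠ 0 := sub_ne_zero.2 hau.symm
    have h3 : a - w ≠ 0 := sub_ne_zero.2 haw
    have h4 : w - a ≠ 0 := sub_ne_zero.2 haw.symm
    field_simp
    ring1
  -- Terms in which two points of `T` are replaced by `u` and `w`.
  have t2 : (w - u) * ∑ a ∈ T, ∑ b ∈ T.erase a, F (insert u (insert w ((T.erase a).erase b))) *
        (p a * q b / ((u - a) * (u - b)) * ((a - b + 1) / (a - b)) *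
          ((a - w + 1) / (a - w)) * ((b - w - 1) / (b - w)) *
          ratioProd (-1) a ((T.erase a).erase b) * ratioProd 1 b ((T.erase a).erase b)) =
      (w - u) * ∑ a ∈ T, ∑ b ∈ T.erase a, F (insert w (insert u ((T.erase a).erase b))) *
        (p a * q b / ((u - a) * (u - b)) * ((a - b + 1) / (a - b)) *
          ratioProd (-1) a ((T.erase a).erase b) * ratioProd 1 b ((T.erase a).erase b)) +
      ∑ b ∈ T, ∑ a ∈ T.erase b, F (insert w (insert u ((T.erase a).erase b))) *
        (q a * p b / ((u - a) * (w - b)) * ((a - b - 1) / (a - b)) * ((b - u + 1) / (b - u)) *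
          ratioProd 1 a ((T.erase a).erase b) * ratioProd (-1) b ((T.erase a).erase b)) -
      ∑ b ∈ T, ∑ a ∈ T.erase b, F (insert u (insert w ((T.erase a).erase b))) *
        (q a * p b / ((w - a) * (u - b)) * ((a - b - 1) / (a - b)) * ((b - w + 1) / (b - w)) *
          ratioProd 1 a ((T.erase a).erase b) * ratioProd (-1) b ((T.erase a).erase b)) := by
    rw [Finset.mul_sum, Finset.mul_sum, ← Finset.sum_add_distrib, ← Finset.sum_sub_distrib]
    refine Finset.sum_congr rfl fun a ha => ?_
    rw [Finset.mul_sum, Finset.mul_sum, ← Finset.sum_add_distrib, ← Finset.sum_sub_distrib]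
    refine Finset.sum_congr rfl fun b hb => ?_
    have hbT := Finset.mem_of_mem_erase hb
    have hab := Finset.ne_of_mem_erase hb
    have haw : a ≠ w := fun e => hw (e ▸ ha)
    have hau : a ≠ u := fun e => hu (e ▸ ha)
    have hbw : b ≠ w := fun e => hw (e ▸ hbT)
    have hbu : b ≠ u := fun e => hu (e ▸ hbT)
    rw [Finset.erase_right_comm (a := b) (b := a), Finset.insert_comm u w]
    have h2 : u - a ≠ 0 := sub_ne_zero.2 hau.symm
    have h3 : a - w ≠ 0 := sub_ne_zero.2 haw
    have h4 : w - a ≠ 0 := sub_ne_zero.2 haw.symm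
    have h5 : u - b ≠ 0 := sub_ne_zero.2 hbu.symm
    have h6 : b - w ≠ 0 := sub_ne_zero.2 hbw
    have h7 : w - b ≠ 0 := sub_ne_zero.2 hbw.symm
    have h8 : a - b ≠ 0 := sub_ne_zero.2 hab.symm
    have h9 : b - a ≠ 0 := sub_ne_zero.2 hab
    have h10 : a - u ≠ 0 := sub_ne_zero.2 hau
    field_simp
    ring1
  have t0 : (w - u) * (F T / (u - w) * (p u * q w * ratioProd (-1) u T * ratioProd 1 w T -
        q u * p w * ratioProd 1 u T * ratioProd (-1) w T)) =
      -(F T * (p u * q w * ratioProd (-1) u T * ratioProd 1 w T -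
        q u * p w * ratioProd 1 u T * ratioProd (-1) w T)) := by
    field_simp
    ring1
  rw [mul_sub, mul_add, t0, t1, t2]
  ring1

end ClosedFormulas

/-! ### Expansion of a polynomial in powers of its first variable -/

section FirstVariable

open MvPolynomial

variable {l : ℕ}

/-- The coefficient of the `i`-th power of the first variable. -/
def headCoeff (i : ℕ) : MvPolynomial (Fin (l + 1)) ℂ →ₗ[ℂ] MvPolynomial (Fin l) ℂ where
  toFun P := (finSuccEquiv ℂ l P).coeff i
  map_add' P Q := by simp
  map_smul' c P := by simp

theorem headCoeff_apply (i : ℕ) (P : MvPolynomial (Fin (l + 1)) ℂ) :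
    headCoeff i P = (finSuccEquiv ℂ l P).coeff i := rfl

theorem finSuccEquiv_C (a : ℂ) : finSuccEquiv ℂ l (C a) = Polynomial.C (C a) :=
  (finSuccEquiv ℂ l).commutes a

/-- The product of a polynomial in all variables but the first with the `k`-th power of the first
variable. -/
def headMul (k : ℕ) : MvPolynomial (Fin l) ℂ →ₗ[ℂ] MvPolynomial (Fin (l + 1)) ℂ where
  toFun P := X 0 ^ k * rename Fin.succ P
  map_add' P Q := by rw [map_add, mul_add]
  map_smul' c P := by rw [map_smul, mul_smul_comm, RingHom.id_apply]

theorem headMul_apply (k : ℕ) (P : MvPolynomial (Fin l) ℂ) :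
    headMul k P = X 0 ^ k * rename Fin.succ P := rfl

theorem finSuccEquiv_headMul (k : ℕ) (P : MvPolynomial (Fin l) ℂ) :
    finSuccEquiv ℂ l (headMul k P) = Polynomial.monomial k P := by
  have h : finSuccEquiv ℂ l (rename Fin.succ P) = Polynomial.C P := by
    induction P using MvPolynomial.induction_on with
    | C a => rw [rename_C, finSuccEquiv_C]
    | add p q hp hq => rw [map_add, map_add, hp, hq, map_add]
    | mul_X p i hp => rw [map_mul, map_mul, hp, rename_X, finSuccEquiv_X_succ, map_mul]
  rw [headMul_apply, map_mul, map_pow, finSuccEquiv_X_zero, h, mul_comm, Polynomial.C_mul_X_pow_eq_monomial]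

theorem headCoeff_headMul (i k : ℕ) (P : MvPolynomial (Fin l) ℂ) :
    headCoeff i (headMul k P) = if k = i then P else 0 := by
  rw [headCoeff_apply, finSuccEquiv_headMul, Polynomial.coeff_monomial]

theorem headCoeff_sum_headMul (n i : ℕ) (c : ℕ → MvPolynomial (Fin l) ℂ) :
    headCoeff i (∑ k ∈ Finset.range n, headMul k (c k)) = if i < n then c i else 0 := by
  simp [map_sum, headCoeff_headMul]

theorem ext_headCoeff {P Q : MvPolynomial (Fin (l + 1)) ℂ}
    (h : ∀ i, headCoeff i P = headCoeff i Q) : P = Q :=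
  (finSuccEquiv ℂ l).injective (Polynomial.ext h)


variable {n : ℕ}

/-- All partial degrees are less than `n`. -/
def DegLT (n : ℕ) (P : MvPolynomial (Fin l) ℂ) : Prop := ∀ i, P.degreeOf i < n

theorem headCoeff_eq_zero {P : MvPolynomial (Fin (l + 1)) ℂ} (hP : DegLT n P) {i : ℕ}
    (h : n ≤ i) : headCoeff i P = 0 := by
  rw [headCoeff_apply]
  exact Polynomial.coeff_eq_zero_of_natDegree_lt
    (by rw [natDegree_finSuccEquiv]; exact (hP 0).trans_le h)

theorem DegLT.headCoeff {P : MvPolynomial (Fin (l + 1)) ℂ} (hP : DegLT n P) (i : ℕ) :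
    DegLT n (headCoeff i P) :=
  fun j => (degreeOf_coeff_finSuccEquiv P j i).trans_lt (hP j.succ)

theorem DegLT.zero (hn : 0 < n) : DegLT n (0 : MvPolynomial (Fin l) ℂ) := fun i => by
  rwa [degreeOf_zero]

theorem DegLT.add {P Q : MvPolynomial (Fin l) ℂ} (hP : DegLT n P) (hQ : DegLT n Q) :
    DegLT n (P + Q) :=
  fun i => (degreeOf_add_le i P Q).trans_lt (max_lt (hP i) (hQ i))

theorem DegLT.smul {P : MvPolynomial (Fin l) ℂ} (hP : DegLT n P) (c : ℂ) : DegLT n (c • P) := by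
  intro i
  rw [smul_eq_C_mul]
  exact (degreeOf_C_mul_le P i c).trans_lt (hP i)

theorem DegLT.sub {P Q : MvPolynomial (Fin l) ℂ} (hP : DegLT n P) (hQ : DegLT n Q) :
    DegLT n (P - Q) := by
  have := hP.add (hQ.smul (-1))
  rwa [neg_one_smul, ← sub_eq_add_neg] at this

theorem DegLT.sum (hn : 0 < n) {ι : Type} (s : Finset ι) {c : ι → MvPolynomial (Fin l) ℂ}
    (h : ∀ k ∈ s, DegLT n (c k)) : DegLT n (∑ k ∈ s, c k) :=
  fun i => (degreeOf_sum_le i s c).trans_lt ((Finset.sup_lt_iff hn).2 fun k hk => h k hk i)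

theorem DegLT.sum_headMul (hn : 0 < n) {c : ℕ → MvPolynomial (Fin l) ℂ}
    (h : ∀ k < n, DegLT n (c k)) : DegLT n (∑ k ∈ Finset.range n, headMul k (c k)) := by
  refine DegLT.sum hn _ fun k hk => ?_
  have hk' := Finset.mem_range.1 hk
  intro i
  refine (degreeOf_mul_le i _ _).trans_lt ?_
  refine Fin.cases ?_ (fun j => ?_) i
  · rw [degreeOf_X_self_pow]
    have : (rename Fin.succ (c k)).degreeOf 0 = 0 := by
      rw [← natDegree_finSuccEquiv]
      have h0 := finSuccEquiv_headMul 0 (c k)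
      rw [headMul_apply, pow_zero, one_mul] at h0
      rw [h0]
      exact Polynomial.natDegree_C _
    omega
  · rw [degreeOf_X_pow_of_ne _ (Fin.succ_ne_zero j),
      degreeOf_rename_of_injective (Fin.succ_injective _), zero_add]
    exact h k hk' j

/-- A permutation of the remaining variables extends to one that fixes the first variable, and such
a permutation acts coefficientwise. -/
theorem isSymmetric_headCoeff {P : MvPolynomial (Fin (l + 1)) ℂ} (hP : P.IsSymmetric) (i : ℕ) :
    (headCoeff i P).IsSymmetric := by
  intro e
  have key : ∀ Q : MvPolynomial (Fin (l + 1)) ℂ,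
      finSuccEquiv ℂ l (rename (Equiv.Perm.decomposeFin.symm (0, e)) Q) =
        Polynomial.map (rename e : MvPolynomial (Fin l) ℂ →ₐ[ℂ] MvPolynomial (Fin l) ℂ).toRingHom
          (finSuccEquiv ℂ l Q) := by
    intro Q
    induction Q using MvPolynomial.induction_on with
    | C a => simp only [rename_C, finSuccEquiv_C, Polynomial.map_C]; simp
    | add p q hp hq => simp only [map_add, hp, hq, Polynomial.map_add]
    | mul_X p i hp =>
      have hX : finSuccEquiv ℂ l (X (Equiv.Perm.decomposeFin.symm (0, e) i)) =
          Polynomial.map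
            (rename e : MvPolynomial (Fin l) ℂ →ₐ[ℂ] MvPolynomial (Fin l) ℂ).toRingHom
            (finSuccEquiv ℂ l (X i)) := by
        refine Fin.cases ?_ (fun j => ?_) i
        · rw [Equiv.Perm.decomposeFin_symm_apply_zero, finSuccEquiv_X_zero, Polynomial.map_X]
        · rw [Equiv.Perm.decomposeFin_symm_apply_succ, Equiv.swap_self, Equiv.refl_apply,
            finSuccEquiv_X_succ, finSuccEquiv_X_succ, Polynomial.map_C]
          exact congrArg _ (rename_X _ _).symm
      rw [map_mul, map_mul, map_mul, hp, rename_X, hX, Polynomial.map_mul]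
  have h := congrArg (fun R => Polynomial.coeff R i) (key P)
  simp only [Polynomial.coeff_map] at h
  rw [hP] at h
  exact h.symm

variable {L : Type} [Field L] [Algebra ℂ L]

/-- Substitution for the first variable as a generating function of the coefficients; the degree
bound makes `n` terms enough. This ties the lowering coefficients to evaluation. -/
theorem aeval_cons {P : MvPolynomial (Fin (l + 1)) ℂ} (hP : DegLT n P) (w : L) (t : Fin l → L) :
    aeval (Fin.cons w t : Fin (l + 1) → L) P =
      ∑ i ∈ Finset.range n, w ^ i * aeval t (headCoeff i P) := by
  have key : ∀ Q : MvPolynomial (Fin (l + 1)) ℂ, aeval (Fin.cons w t : Fin (l + 1) → L) Q =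
      Polynomial.eval₂ (aeval t : MvPolynomial (Fin l) ℂ →ₐ[ℂ] L).toRingHom w
        (finSuccEquiv ℂ l Q) := by
    intro Q
    induction Q using MvPolynomial.induction_on with
    | C a => simp only [finSuccEquiv_C, Polynomial.eval₂_C]; simp
    | add p q hp hq => simp only [map_add, hp, hq, Polynomial.eval₂_add]
    | mul_X p i hp =>
      have hX : (Fin.cons w t : Fin (l + 1) → L) i = Polynomial.eval₂
          (aeval t : MvPolynomial (Fin l) ℂ →ₐ[ℂ] L).toRingHom w (finSuccEquiv ℂ l (X i)) := by
        refine Fin.cases ?_ (fun j => ?_) i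
        · rw [Fin.cons_zero, finSuccEquiv_X_zero, Polynomial.eval₂_X]
        · rw [Fin.cons_succ, finSuccEquiv_X_succ, Polynomial.eval₂_C]
          exact (aeval_X _ _).symm
      rw [map_mul, map_mul, hp, aeval_X, hX, Polynomial.eval₂_mul]
  rw [key, Polynomial.eval₂_eq_sum_range' _ (n := n) (by
    rw [natDegree_finSuccEquiv]; exact hP 0)]
  exact Finset.sum_congr rfl fun i _ => mul_comm _ _

end FirstVariable

/-! ### Symmetric polynomials as functions of finite sets -/

section FinsetImages

variable {l : ℕ} {L : Type}

theorem exists_eq_image [DecidableEq L] (T : Finset L) :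
    ∃ s : Fin T.card → L, Function.Injective s ∧ Finset.univ.image s = T := by
  refine ⟨fun i => (T.equivFin.symm i : L), fun i j h => ?_, ?_⟩
  · exact T.equivFin.symm.injective (Subtype.ext h)
  · ext x
    simp only [Finset.mem_image, Finset.mem_univ, true_and]
    constructor
    · rintro ⟨i, rfl⟩
      exact (T.equivFin.symm i).2
    · intro hx
      exact ⟨T.equivFin ⟨x, hx⟩, by simp⟩

theorem cons_injective {w : L} {t : Fin l → L} (ht : Function.Injective t)
    (hw : ∀ i, t i ≠ w) : Function.Injective (Fin.cons w t : Fin (l + 1) → L) :=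
  Fin.cons_injective_iff.2 ⟨fun ⟨i, hi⟩ => hw i hi, ht⟩

theorem image_cons [DecidableEq L] (w : L) (t : Fin l → L) :
    Finset.univ.image (Fin.cons w t : Fin (l + 1) → L) = insert w (Finset.univ.image t) := by
  ext x
  simp only [Finset.mem_image, Finset.mem_univ, true_and, Finset.mem_insert, Fin.exists_fin_succ,
    Fin.cons_zero, Fin.cons_succ, eq_comm (a := x)]

end FinsetImages

section Values

open MvPolynomial

variable {l n : ℕ} {L : Type} [Field L] [Algebra ℂ L]

/-- The value of a symmetric polynomial at a finite set, zero if the number of elements does not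
fit. -/
def finsetVal (P : MvPolynomial (Fin l) ℂ) (S : Finset L) : L :=
  if h : S.card = l then aeval (fun i => ((S.equivFinOfCardEq h).symm i : L)) P else 0

theorem aeval_comp_perm {P : MvPolynomial (Fin l) ℂ} (hP : P.IsSymmetric)
    (s : Fin l → L) (e : Equiv.Perm (Fin l)) : aeval (s ∘ e) P = aeval s P := by
  rw [← aeval_rename, hP]

/-- The enumeration chosen in `finsetVal` differs from `s` by a permutation, which a symmetric
polynomial does not see. -/
theorem finsetVal_image [DecidableEq L] {P : MvPolynomial (Fin l) ℂ} (hP : P.IsSymmetric)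
    {s : Fin l → L} (hs : Function.Injective s) :
    finsetVal P (Finset.univ.image s) = aeval s P := by
  have hc : (Finset.univ.image s).card = l := by
    rw [Finset.card_image_of_injective _ hs, Finset.card_univ, Fintype.card_fin]
  rw [finsetVal, dif_pos hc]
  set E := (Finset.univ.image s).equivFinOfCardEq hc
  let f : Fin l → Fin l := fun i => E ⟨s i, Finset.mem_image_of_mem s (Finset.mem_univ i)⟩
  have hf : Function.Injective f := fun i j hij => by
    have := E.injective hij
    exact hs (Subtype.ext_iff.1 this)
  let e : Equiv.Perm (Fin l) := Equiv.ofBijective f (Finite.injective_iff_bijective.1 hf)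
  rw [← aeval_comp_perm hP _ e]
  congr 2
  funext i
  change ((E.symm (f i) : _) : L) = s i
  simp [f]

theorem finsetVal_insert [DecidableEq L] {P : MvPolynomial (Fin (l + 1)) ℂ} (hP : P.IsSymmetric)
    (hd : DegLT n P) {w : L} {T : Finset L} (hw : w ∉ T) (hT : T.card = l) :
    finsetVal P (insert w T) =
      ∑ i ∈ Finset.range n, w ^ i * finsetVal (headCoeff i P) T := by
  obtain ⟨s, hs, hT'⟩ : ∃ s : Fin l → L, Function.Injective s ∧ Finset.univ.image s = T := by
    subst hT
    exact exists_eq_image T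
  have hw' : ∀ i, s i ≠ w := fun i h => hw (by
    rw [← hT', ← h]; exact Finset.mem_image_of_mem _ (Finset.mem_univ i))
  rw [← hT', ← image_cons, finsetVal_image hP (cons_injective hs hw'), aeval_cons hd]
  refine Finset.sum_congr rfl fun i _ => ?_
  rw [finsetVal_image (isSymmetric_headCoeff hP i) hs]

/-- Polynomials agree if they do so at all points with different coordinates outside of a
finite set. -/
theorem eq_of_forall_injective (A : Finset ℂ) {P Q : MvPolynomial (Fin l) ℂ}
    (h : ∀ s : Fin l → ℂ, Function.Injective s → (∀ i, s i ∉ A) → aeval s P = aeval s Q) :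
    P = Q := by
  classical
  -- A nonzero polynomial that vanishes at every excluded point; hence `(P - Q) * R` vanishes
  -- everywhere.
  set R : MvPolynomial (Fin l) ℂ := (∏ p ∈ Finset.univ.filter fun p : Fin l × Fin l => p.1 ≠ p.2,
    (X p.1 - X p.2)) * ∏ i : Fin l, ∏ a ∈ A, (X i - C a) with hR
  have hR0 : R ≠ 0 := by
    rw [hR, mul_ne_zero_iff, Finset.prod_ne_zero_iff, Finset.prod_ne_zero_iff]
    refine ⟨fun p hp => ?_, fun i _ => Finset.prod_ne_zero_iff.2 fun a _ => ?_⟩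
    · rw [sub_ne_zero]
      exact fun e => (Finset.mem_filter.1 hp).2 (X_injective e)
    · intro e
      have := congrArg (eval fun _ => a + 1) e
      simp at this
  have : (P - Q) * R = 0 := by
    refine MvPolynomial.funext fun s => ?_
    rw [map_mul, map_sub, map_zero]
    by_cases hs : Function.Injective s ∧ ∀ i, s i ∉ A
    · rw [show eval s P = eval s Q from h s hs.1 hs.2, sub_self, zero_mul]
    · refine mul_eq_zero_of_right _ ?_
      rw [hR, map_mul, map_prod, map_prod, mul_eq_zero]
      by_cases h1 : Function.Injective s
      · right
        have : ∃ i, s i ∈ A := by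
          by_contra! h2
          exact hs ⟨h1, h2⟩
        obtain ⟨i, hi⟩ := this
        refine Finset.prod_eq_zero (Finset.mem_univ i) ?_
        rw [map_prod]
        exact Finset.prod_eq_zero hi (by simp)
      · left
        rw [Function.Injective] at h1
        push Not at h1
        obtain ⟨i, j, hij, hne⟩ := h1
        refine Finset.prod_eq_zero (Finset.mem_filter.2 ⟨Finset.mem_univ (i, j), hne⟩) ?_
        simp [hij]
  rcases mul_eq_zero.1 this with h' | h'
  · exact sub_eq_zero.1 h'
  · exact absurd h' hR0

/-- A polynomial identity with vector coefficients that holds outside of a finite set. -/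
theorem eq_zero_of_forall_sum_pow_smul {E : Type} [AddCommGroup E] [Module ℂ E] (A : Finset ℂ)
    (N : ℕ) (v : ℕ → E) (h : ∀ u ∉ A, ∑ j ∈ Finset.range N, u ^ j • v j = 0) :
    ∀ j < N, v j = 0 := by
  intro j hj
  -- Linear functionals reduce the claim to a scalar polynomial with infinitely many roots.
  rw [← Module.forall_dual_apply_eq_zero_iff ℂ]
  intro φ
  set P : Polynomial ℂ := ∑ j ∈ Finset.range N, Polynomial.monomial j (φ (v j)) with hP
  have hP0 : P = 0 := by
    refine Polynomial.eq_zero_of_infinite_isRoot P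
      (Set.Infinite.mono (s := {u | u ∉ A}) (fun u hu => ?_) A.finite_toSet.infinite_compl)
    have := congrArg φ (h u hu)
    simp only [map_sum, map_smul, map_zero, smul_eq_mul] at this
    rw [Set.mem_ofPred_eq, Polynomial.IsRoot, hP, Polynomial.eval_finsetSum, ← this]
    exact Finset.sum_congr rfl fun i _ => by rw [Polynomial.eval_monomial, mul_comm]
  have := congrArg (fun R => Polynomial.coeff R j) hP0
  simpa [hP, Polynomial.finsetSum_coeff, Polynomial.coeff_monomial, hj] using this

end Values

/-! ### Coefficients of divided antisymmetric generating functions -/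

section Antidiff

variable {M : Type} [AddCommGroup M]

/-- The coefficients of `(∑ (f j k - f k j) u^j w^k) / (w - u)`. -/
def antidiff (f : ℕ → ℕ → M) (j k : ℕ) : M :=
  ∑ m ∈ Finset.range (min j k + 1), (f m (j + k + 1 - m) - f (j + k + 1 - m) m)

theorem antidiff_eq_zero {f : ℕ → ℕ → M} {N j k : ℕ} (hf : ∀ a b, N < a ∨ N < b → f a b = 0)
    (h : N ≤ j ∨ N ≤ k) : antidiff f j k = 0 := by
  refine Finset.sum_eq_zero fun m hm => ?_
  rw [Finset.mem_range] at hm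
  rw [hf _ _ (Or.inr (by omega)), hf _ _ (Or.inl (by omega)), sub_zero]

/-- The sums on the left have the same total of indices and differ in at most one summand. This is
multiplication by `w - u` read off at `u^(j+1) w^(k+1)`. -/
theorem antidiff_step (f : ℕ → ℕ → M) (j k : ℕ) :
    antidiff f (j + 1) k - antidiff f j (k + 1) = f (j + 1) (k + 1) - f (k + 1) (j + 1) := by
  have e : ∀ m, j + 1 + k + 1 - m = j + (k + 1) + 1 - m := fun m => by omega
  unfold antidiff
  simp only [e]
  rcases lt_trichotomy j k with h | rfl | h
  · rw [min_eq_left (by omega : j + 1 ≤ k), min_eq_left (by omega : j ≤ k + 1),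
      Finset.sum_range_succ _ (j + 1), add_sub_cancel_left,
      show j + (k + 1) + 1 - (j + 1) = k + 1 by omega]
  · rw [min_eq_right (by omega : j ≤ j + 1), min_eq_left (by omega : j ≤ j + 1), sub_self, sub_self]
  · rw [min_eq_right (by omega : k ≤ j + 1), min_eq_right (by omega : k + 1 ≤ j),
      Finset.sum_range_succ _ (k + 1), sub_add_cancel_left,
      show j + (k + 1) + 1 - (k + 1) = j + 1 by omega, neg_sub]

theorem antidiff_zero_left (f : ℕ → ℕ → M) (k : ℕ) :
    antidiff f 0 k = f 0 (k + 1) - f (k + 1) 0 := by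
  simp [antidiff]

theorem antidiff_zero_right (f : ℕ → ℕ → M) (j : ℕ) :
    antidiff f j 0 = f 0 (j + 1) - f (j + 1) 0 := by
  simp [antidiff]

/-- Multiplication by `w` shifts `k` and multiplication by `u` shifts `j`. The terms that would
leave the range vanish by `antidiff_eq_zero`, interior coefficients are `antidiff_step`, and the
boundary ones are `antidiff_zero_left` and `antidiff_zero_right`. -/
theorem sum_antidiff {K : Type} [Field K] [Module K M] {f : ℕ → ℕ → M} {N : ℕ}
    (hf : ∀ a b, N < a ∨ N < b → f a b = 0) (u w : K) :
    (w - u) • ∑ j ∈ Finset.range (N + 1), ∑ k ∈ Finset.range (N + 1),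
        (u ^ j * w ^ k) • antidiff f j k =
      ∑ j ∈ Finset.range (N + 1), ∑ k ∈ Finset.range (N + 1),
        (u ^ j * w ^ k) • (f j k - f k j) := by
  have hz := fun j k => antidiff_eq_zero (j := j) (k := k) hf
  have s1 : w • ∑ j ∈ Finset.range (N + 1), ∑ k ∈ Finset.range (N + 1),
      (u ^ j * w ^ k) • antidiff f j k =
      ∑ j ∈ Finset.range N, ∑ k ∈ Finset.range N,
        (u ^ (j + 1) * w ^ (k + 1)) • antidiff f (j + 1) k +
      ∑ k ∈ Finset.range N, w ^ (k + 1) • antidiff f 0 k := by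
    simp only [Finset.sum_range_succ _ N, hz _ N (Or.inr le_rfl), smul_zero, add_zero]
    rw [← Finset.sum_range_succ (fun j => ∑ k ∈ Finset.range N,
      (u ^ j * w ^ k) • antidiff f j k) N, Finset.sum_range_succ', smul_add]
    simp only [Finset.smul_sum, smul_smul, pow_zero, one_mul, ← pow_succ']
    congr 1
    refine Finset.sum_congr rfl fun j _ => Finset.sum_congr rfl fun k _ => ?_
    congr 1
    ring
  have s2 : u • ∑ j ∈ Finset.range (N + 1), ∑ k ∈ Finset.range (N + 1),
      (u ^ j * w ^ k) • antidiff f j k =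
      ∑ j ∈ Finset.range N, ∑ k ∈ Finset.range N,
        (u ^ (j + 1) * w ^ (k + 1)) • antidiff f j (k + 1) +
      ∑ j ∈ Finset.range N, u ^ (j + 1) • antidiff f j 0 := by
    rw [Finset.sum_range_succ]
    simp only [hz N _ (Or.inl le_rfl), smul_zero, Finset.sum_const_zero, add_zero]
    simp only [Finset.sum_range_succ', Finset.sum_add_distrib, smul_add, Finset.smul_sum,
      smul_smul, pow_zero, mul_one, ← pow_succ']
    congr 1
    refine Finset.sum_congr rfl fun j _ => Finset.sum_congr rfl fun k _ => ?_
    congr 1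
    ring
  have s3 : ∑ j ∈ Finset.range N, ∑ k ∈ Finset.range N,
        (u ^ (j + 1) * w ^ (k + 1)) • antidiff f (j + 1) k -
      ∑ j ∈ Finset.range N, ∑ k ∈ Finset.range N,
        (u ^ (j + 1) * w ^ (k + 1)) • antidiff f j (k + 1) =
      ∑ j ∈ Finset.range N, ∑ k ∈ Finset.range N,
        (u ^ (j + 1) * w ^ (k + 1)) • f (j + 1) (k + 1) -
      ∑ j ∈ Finset.range N, ∑ k ∈ Finset.range N,
        (u ^ (j + 1) * w ^ (k + 1)) • f (k + 1) (j + 1) := by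
    simp only [← Finset.sum_sub_distrib, ← smul_sub, antidiff_step]
  rw [sub_smul, s1, s2, Finset.sum_range_succ']
  simp only [Finset.sum_range_succ' _ N, Finset.sum_add_distrib, pow_zero, mul_one, one_mul,
    sub_self, add_zero, smul_sub, Finset.sum_sub_distrib, antidiff_zero_left, antidiff_zero_right]
  rw [← sub_eq_zero] at s3 ⊢
  rw [← s3]
  abel

theorem antidiff_map {M' Φ : Type} [AddCommGroup M'] [FunLike Φ M M'] [AddMonoidHomClass Φ M M']
    (φ : Φ) (f : ℕ → ℕ → M) (j k : ℕ) :
    φ (antidiff f j k) = antidiff (fun a b => φ (f a b)) j k := by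
  simp [antidiff, map_sum]

end Antidiff

/-! ### Operators on polynomials defined by recursion -/

section Operators

open MvPolynomial

/-- The coefficients of the action of a diagonal generator on polynomials; the recursion comes
from the relation with the lowering generator. -/
def diagOp (n : ℕ) (ε : ℂ) (h : Polynomial ℂ) :
    (l : ℕ) → ℕ → MvPolynomial (Fin l) ℂ →ₗ[ℂ] MvPolynomial (Fin l) ℂ
  | 0, j => h.coeff j • LinearMap.id
  | l + 1, j => ∑ k ∈ Finset.range n, headMul k ∘ₗ (diagOp n ε h l j ∘ₗ headCoeff k +
      ε • antidiff (fun a b => diagOp n ε h l a ∘ₗ headCoeff b) j k)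

/-- The commutator term in the relation between the raising and the lowering generator. -/
def crossOp (n : ℕ) (q p : Polynomial ℂ) (l j k : ℕ) :
    MvPolynomial (Fin l) ℂ →ₗ[ℂ] MvPolynomial (Fin l) ℂ :=
  antidiff (fun a b => diagOp n 1 q l a ∘ₗ diagOp n (-1) p l b) j k

/-- The coefficients of the action of the raising generator on polynomials. -/
def raiseOp (n : ℕ) (q p : Polynomial ℂ) :
    (l : ℕ) → ℕ → MvPolynomial (Fin l) ℂ →ₗ[ℂ] MvPolynomial (Fin (l + 1)) ℂ
  | 0, j => ∑ k ∈ Finset.range n, headMul k ∘ₗ crossOp n q p 0 j k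
  | l + 1, j => ∑ k ∈ Finset.range n, headMul k ∘ₗ (raiseOp n q p l j ∘ₗ headCoeff k +
      crossOp n q p (l + 1) j k)

theorem antidiff_apply {V W : Type} [AddCommGroup V] [Module ℂ V] [AddCommGroup W] [Module ℂ W]
    (f : ℕ → ℕ → V →ₗ[ℂ] W) (j k : ℕ) (v : V) :
    antidiff f j k v = antidiff (fun a b => f a b v) j k :=
  antidiff_map (LinearMap.evalAddMonoidHom v) f j k

variable {n : ℕ} {ε : ℂ} {h q p : Polynomial ℂ} {l : ℕ}

theorem diagOp_eq_zero (hh : h.natDegree ≤ n) : ∀ {l : ℕ} {P : MvPolynomial (Fin l) ℂ},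
    DegLT n P → ∀ {j : ℕ}, n < j → diagOp n ε h l j P = 0
  | 0, P, _, j, hj => by
    rw [diagOp, Polynomial.coeff_eq_zero_of_natDegree_lt (hh.trans_lt hj), zero_smul,
      LinearMap.zero_apply]
  | l + 1, P, hP, j, hj => by
    rw [diagOp, LinearMap.sum_apply]
    refine Finset.sum_eq_zero fun k _ => ?_
    rw [LinearMap.comp_apply, LinearMap.add_apply, LinearMap.comp_apply,
      diagOp_eq_zero hh (hP.headCoeff k) hj, LinearMap.smul_apply, antidiff_apply,
      antidiff_eq_zero (N := n) _ (Or.inl hj.le), smul_zero, add_zero, map_zero]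
    rintro a b (ha | hb)
    · exact diagOp_eq_zero hh (hP.headCoeff b) ha
    · rw [LinearMap.comp_apply, headCoeff_eq_zero hP hb.le, map_zero]

theorem diagOp_headCoeff_eq_zero (hh : h.natDegree ≤ n) {P : MvPolynomial (Fin (l + 1)) ℂ}
    (hP : DegLT n P) (a b : ℕ) (hab : n < a ∨ n < b) : diagOp n ε h l a (headCoeff b P) = 0 := by
  rcases hab with ha | hb
  · exact diagOp_eq_zero hh (hP.headCoeff b) ha
  · rw [headCoeff_eq_zero hP hb.le, map_zero]

/-- The recursion in `diagOp` prescribes only the coefficients with `k < n`; for `k ≥ n` both sides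
are zero by the degree bound, so the relation holds without restriction on `k`. -/
theorem headCoeff_diagOp (hh : h.natDegree ≤ n) {P : MvPolynomial (Fin (l + 1)) ℂ}
    (hP : DegLT n P) (j k : ℕ) : headCoeff k (diagOp n ε h (l + 1) j P) =
      diagOp n ε h l j (headCoeff k P) +
        ε • antidiff (fun a b => diagOp n ε h l a (headCoeff b P)) j k := by
  rw [diagOp, LinearMap.sum_apply]
  simp only [LinearMap.comp_apply, LinearMap.add_apply, LinearMap.smul_apply, antidiff_apply]
  rw [headCoeff_sum_headMul]
  split_ifs with hk
  · rfl
  · rw [not_lt] at hk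
    rw [headCoeff_eq_zero hP hk, map_zero,
      antidiff_eq_zero (diagOp_headCoeff_eq_zero hh hP) (Or.inr hk), smul_zero, add_zero]

theorem DegLT.antidiff (hn : 0 < n) {f : ℕ → ℕ → MvPolynomial (Fin l) ℂ}
    (hf : ∀ a b, DegLT n (f a b)) (j k : ℕ) : DegLT n (antidiff f j k) :=
  DegLT.sum hn _ fun _ _ => (hf _ _).sub (hf _ _)

theorem DegLT.diagOp (hn : 0 < n) : ∀ {l : ℕ} {P : MvPolynomial (Fin l) ℂ},
    DegLT n P → ∀ j, DegLT n (diagOp n ε h l j P)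
  | 0, P, hP, j => fun i => i.elim0
  | l + 1, P, hP, j => by
    rw [_root_.diagOp, LinearMap.sum_apply]
    simp only [LinearMap.comp_apply, LinearMap.add_apply, LinearMap.smul_apply, antidiff_apply]
    exact DegLT.sum_headMul hn fun k _ => (DegLT.diagOp hn (hP.headCoeff k) j).add
      ((DegLT.antidiff hn (fun a b => DegLT.diagOp hn (hP.headCoeff b) a) j k).smul ε)

theorem crossOp_apply (j k : ℕ) (P : MvPolynomial (Fin l) ℂ) : crossOp n q p l j k P =
    antidiff (fun a b => diagOp n 1 q l a (diagOp n (-1) p l b P)) j k :=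
  antidiff_apply _ _ _ _

theorem diagOp_diagOp_eq_zero (hn : 0 < n) (hq : q.natDegree ≤ n) (hp : p.natDegree ≤ n)
    {P : MvPolynomial (Fin l) ℂ} (hP : DegLT n P) (a b : ℕ) (hab : n < a ∨ n < b) :
    diagOp n 1 q l a (diagOp n (-1) p l b P) = 0 := by
  rcases hab with ha | hb
  · exact diagOp_eq_zero hq (hP.diagOp hn b) ha
  · rw [diagOp_eq_zero hp hP hb, map_zero]

theorem crossOp_eq_zero (hn : 0 < n) (hq : q.natDegree ≤ n) (hp : p.natDegree ≤ n)
    {P : MvPolynomial (Fin l) ℂ} (hP : DegLT n P) {j k : ℕ} (hjk : n ≤ j ∨ n ≤ k) :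
    crossOp n q p l j k P = 0 := by
  rw [crossOp_apply, antidiff_eq_zero (diagOp_diagOp_eq_zero hn hq hp hP) hjk]

theorem DegLT.crossOp (hn : 0 < n) {P : MvPolynomial (Fin l) ℂ} (hP : DegLT n P) (j k : ℕ) :
    DegLT n (crossOp n q p l j k P) := by
  rw [crossOp_apply]
  exact DegLT.antidiff hn (fun a b => (hP.diagOp hn b).diagOp hn a) j k

theorem headCoeff_raiseOp_zero (hn : 0 < n) (hq : q.natDegree ≤ n) (hp : p.natDegree ≤ n)
    {P : MvPolynomial (Fin 0) ℂ} (hP : DegLT n P) (j k : ℕ) :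
    headCoeff k (raiseOp n q p 0 j P) = crossOp n q p 0 j k P := by
  rw [raiseOp, LinearMap.sum_apply]
  simp only [LinearMap.comp_apply]
  rw [headCoeff_sum_headMul]
  split_ifs with hk
  · rfl
  · rw [crossOp_eq_zero hn hq hp hP (Or.inr (not_lt.1 hk))]

theorem headCoeff_raiseOp_succ (hn : 0 < n) (hq : q.natDegree ≤ n) (hp : p.natDegree ≤ n)
    {P : MvPolynomial (Fin (l + 1)) ℂ} (hP : DegLT n P) (j k : ℕ) :
    headCoeff k (raiseOp n q p (l + 1) j P) =
      raiseOp n q p l j (headCoeff k P) + crossOp n q p (l + 1) j k P := by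
  rw [raiseOp, LinearMap.sum_apply]
  simp only [LinearMap.comp_apply, LinearMap.add_apply]
  rw [headCoeff_sum_headMul]
  split_ifs with hk
  · rfl
  · rw [not_lt] at hk
    rw [crossOp_eq_zero hn hq hp hP (Or.inr hk), headCoeff_eq_zero hP hk, map_zero, add_zero]

theorem DegLT.raiseOp (hn : 0 < n) : ∀ {l : ℕ} {P : MvPolynomial (Fin l) ℂ},
    DegLT n P → ∀ j, DegLT n (raiseOp n q p l j P)
  | 0, P, hP, j => by
    rw [_root_.raiseOp, LinearMap.sum_apply]
    exact DegLT.sum_headMul hn fun k _ => hP.crossOp hn j k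
  | l + 1, P, hP, j => by
    rw [_root_.raiseOp, LinearMap.sum_apply]
    exact DegLT.sum_headMul hn fun k _ =>
      (DegLT.raiseOp hn (hP.headCoeff k) j).add (hP.crossOp hn j k)

/-- The bound is one better than for the diagonal operators: dividing by `w - u` lowers the degree
in `u`. The missing coefficient of `u^n` is what makes `T_12^(0)` zero. -/
theorem raiseOp_eq_zero (hn : 0 < n) (hq : q.natDegree ≤ n) (hp : p.natDegree ≤ n) :
    ∀ {l : ℕ} {P : MvPolynomial (Fin l) ℂ}, DegLT n P → ∀ {j : ℕ}, n ≤ j →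
      raiseOp n q p l j P = 0
  | 0, P, hP, j, hj => ext_headCoeff fun k => by
    rw [headCoeff_raiseOp_zero hn hq hp hP, crossOp_eq_zero hn hq hp hP (Or.inl hj), map_zero]
  | l + 1, P, hP, j, hj => ext_headCoeff fun k => by
    rw [headCoeff_raiseOp_succ hn hq hp hP, crossOp_eq_zero hn hq hp hP (Or.inl hj),
      raiseOp_eq_zero hn hq hp (hP.headCoeff k) hj, map_zero, add_zero]

/-- The leading coefficient of a diagonal generator is the identity. -/
theorem diagOp_leading (hh : h.natDegree ≤ n) (h1 : h.coeff n = 1) :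
    ∀ {l : ℕ} {P : MvPolynomial (Fin l) ℂ}, DegLT n P → diagOp n ε h l n P = P
  | 0, P, _ => by rw [diagOp, h1, one_smul, LinearMap.id_apply]
  | l + 1, P, hP => ext_headCoeff fun k => by
    rw [headCoeff_diagOp hh hP, antidiff_eq_zero (diagOp_headCoeff_eq_zero hh hP) (Or.inl le_rfl),
      smul_zero, add_zero, diagOp_leading hh h1 (hP.headCoeff k)]

end Operators

/-! ### Linearity and locality of the closed formulas -/

section SumLinearity

variable {L : Type} [Field L] [DecidableEq L]

theorem diagSum_sum {ι : Type} (s : Finset ι) (c : ι → L) (ε : L) (h : L → L)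
    (F : ι → Finset L → L) (u : L) (T : Finset L) :
    diagSum ε h (fun S => ∑ i ∈ s, c i * F i S) u T = ∑ i ∈ s, c i * diagSum ε h (F i) u T := by
  unfold diagSum
  simp only [mul_add, Finset.sum_add_distrib, Finset.mul_sum, Finset.sum_mul, Finset.sum_div]
  rw [Finset.sum_comm]
  congr 1
  · exact Finset.sum_congr rfl fun i _ => by ring
  · exact Finset.sum_congr rfl fun i _ => Finset.sum_congr rfl fun a _ => by ring

/-- The sum looks only at sets of the size of `T` inside `T ∪ {u}`. This matters because `finsetVal`
is the value of the polynomial only at sets of the right size, and expansion in powers of `w` needs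
sets that avoid `w`. -/
theorem diagSum_congr {ε : L} {h : L → L} {F G : Finset L → L} {u : L} {T : Finset L} (hu : u ∉ T)
    (hFG : ∀ S, S.card = T.card → S ⊆ insert u T → F S = G S) :
    diagSum ε h F u T = diagSum ε h G u T := by
  unfold diagSum
  rw [hFG T rfl (Finset.subset_insert u T)]
  congr 1
  refine Finset.sum_congr rfl fun a ha => ?_
  rw [hFG _ _ (Finset.insert_subset_insert u (Finset.erase_subset a T))]
  rw [Finset.card_insert_of_notMem fun hh => hu (Finset.mem_of_mem_erase hh),
    Finset.card_erase_add_one ha]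

theorem raiseSum_sum {ι : Type} (s : Finset ι) (c : ι → L) (q p : L → L)
    (F : ι → Finset L → L) (u : L) (T : Finset L) :
    raiseSum q p (fun S => ∑ i ∈ s, c i * F i S) u T =
      ∑ i ∈ s, c i * raiseSum q p (F i) u T := by
  unfold raiseSum
  simp only [mul_sub (c _), Finset.sum_sub_distrib (s := s)]
  congr 1
  · simp only [Finset.mul_sum]
    rw [Finset.sum_comm]
    refine Finset.sum_congr rfl fun a _ => ?_
    rw [Finset.sum_div, Finset.sum_mul]
    exact Finset.sum_congr rfl fun i _ => by ring
  · simp only [Finset.mul_sum]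
    rw [Finset.sum_comm]
    refine Finset.sum_congr rfl fun a _ => ?_
    rw [Finset.sum_comm]
    refine Finset.sum_congr rfl fun b _ => ?_
    rw [Finset.sum_mul]
    exact Finset.sum_congr rfl fun i _ => mul_assoc _ _ _

theorem raiseSum_congr {q p : L → L} {F G : Finset L → L} {u : L} {T : Finset L} (hu : u ∉ T)
    (hFG : ∀ S, S.card + 1 = T.card → S ⊆ insert u T → F S = G S) :
    raiseSum q p F u T = raiseSum q p G u T := by
  unfold raiseSum
  congr 1
  · refine Finset.sum_congr rfl fun a ha => ?_
    rw [hFG _ (Finset.card_erase_add_one ha)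
      ((Finset.erase_subset a T).trans (Finset.subset_insert u T))]
  · refine Finset.sum_congr rfl fun a ha => Finset.sum_congr rfl fun b hb => ?_
    rw [hFG _ _ (Finset.insert_subset_insert u
      ((Finset.erase_subset b _).trans (Finset.erase_subset a T)))]
    rw [Finset.card_insert_of_notMem
      fun hh => hu (Finset.mem_of_mem_erase (Finset.mem_of_mem_erase hh)),
      Finset.card_erase_add_one hb, Finset.card_erase_add_one ha]

end SumLinearity

/-! ### Agreement of the recursive operators with the closed formulas -/

section ClosedFormulas

open MvPolynomial

variable {n : ℕ} {ε : ℂ} {h q p : Polynomial ℂ} {l : ℕ} {L : Type} [Field L] [Algebra ℂ L]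
  [DecidableEq L]

theorem DegLT.succ {P : MvPolynomial (Fin l) ℂ} (hP : DegLT n P) : DegLT (n + 1) P :=
  fun i => (hP i).trans n.lt_succ_self

/-- The closed formula for the diagonal generators. -/
theorem sum_aeval_diagOp (hh : h.natDegree ≤ n) : ∀ {l : ℕ} {P : MvPolynomial (Fin l) ℂ},
    P.IsSymmetric → DegLT n P → ∀ {s : Fin l → L}, Function.Injective s →
    ∀ {u : L}, u ∉ Finset.univ.image s →
    ∑ j ∈ Finset.range (n + 1), u ^ j * aeval s (diagOp n ε h l j P) =
      diagSum (algebraMap ℂ L ε) (fun x => Polynomial.aeval x h) (finsetVal P) u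
        (Finset.univ.image s)
  | 0, P, hsym, hdeg, s, hs, u, hu => by
    have he : (Finset.univ.image s : Finset L) = ∅ := rfl
    rw [diagSum, finsetVal_image hsym hs, he, Finset.sum_empty, add_zero, ratioProd,
      Finset.prod_empty, mul_one, Polynomial.aeval_eq_sum_range' (Nat.lt_succ_of_le hh),
      Finset.sum_mul]
    refine Finset.sum_congr rfl fun j _ => ?_
    rw [diagOp, LinearMap.smul_apply, LinearMap.id_apply, map_smul, Algebra.smul_def,
      Algebra.smul_def]
    ring
  | l + 1, P, hsym, hdeg, s, hs, u, hu => by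
    -- The first point plays the role of the argument of a lowering operator, so the recursion
    -- reduces to the remaining points.
    obtain ⟨w, t, rfl⟩ : ∃ w t, s = Fin.cons w t := ⟨s 0, Fin.tail s, (Fin.cons_self_tail s).symm⟩
    obtain ⟨hw, ht⟩ := Fin.cons_injective_iff.1 hs
    rw [image_cons] at hu ⊢
    set T : Finset L := Finset.univ.image t with hT
    have hTc : T.card = l := by
      rw [hT, Finset.card_image_of_injective _ ht, Finset.card_univ, Fintype.card_fin]
    have hwT : w ∉ T := by
      rw [hT, Finset.mem_image]
      rintro ⟨i, -, hi⟩
      exact hw ⟨i, hi⟩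
    have huT : u ∉ T := fun hh => hu (Finset.mem_insert_of_mem hh)
    have huw : u ≠ w := fun hh => hu (hh ▸ Finset.mem_insert_self _ _)
    have hwu : w - u ≠ 0 := sub_ne_zero.2 huw.symm
    let a : ℕ → ℕ → L := fun j k => aeval t (diagOp n ε h l j (headCoeff k P))
    have ha : ∀ j k, n < j ∨ n < k → a j k = 0 := fun j k hjk => by
      change aeval t (diagOp n ε h l j (headCoeff k P)) = 0
      rw [diagOp_headCoeff_eq_zero hh hdeg j k hjk, map_zero]
    have hS : ∀ u w : L, u ∉ T → w ∉ T → u ≠ w →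
        ∑ j ∈ Finset.range (n + 1), ∑ k ∈ Finset.range (n + 1), (u ^ j * w ^ k) * a j k =
        diagSum (algebraMap ℂ L ε) (fun x => Polynomial.aeval x h)
          (fun S => finsetVal P (insert w S)) u T := by
      intro u w huT hwT huw
      rw [diagSum_congr (G := fun S => ∑ i ∈ Finset.range (n + 1),
        w ^ i * finsetVal (headCoeff i P) S) huT, diagSum_sum, Finset.sum_comm]
      · refine Finset.sum_congr rfl fun k _ => ?_
        rw [← sum_aeval_diagOp hh (isSymmetric_headCoeff hsym k) (hdeg.headCoeff k) ht huT,
          Finset.mul_sum]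
        exact Finset.sum_congr rfl fun j _ => by ring
      · intro S hS hST
        exact finsetVal_insert hsym hdeg.succ
          (fun hh => by
            rcases Finset.mem_insert.1 (hST hh) with e | e
            · exact huw e.symm
            · exact hwT e) (hS.trans hTc)
    have hL : ∑ j ∈ Finset.range (n + 1), u ^ j * aeval (Fin.cons w t : Fin (l + 1) → L)
        (diagOp n ε h (l + 1) j P) =
        ∑ j ∈ Finset.range (n + 1), ∑ k ∈ Finset.range (n + 1), (u ^ j * w ^ k) * a j k +
        algebraMap ℂ L ε * ∑ j ∈ Finset.range (n + 1), ∑ k ∈ Finset.range (n + 1),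
          (u ^ j * w ^ k) * antidiff a j k := by
      rw [Finset.mul_sum, ← Finset.sum_add_distrib]
      refine Finset.sum_congr rfl fun j _ => ?_
      rw [aeval_cons (n := n + 1) _, Finset.mul_sum, Finset.mul_sum, ← Finset.sum_add_distrib]
      · refine Finset.sum_congr rfl fun k _ => ?_
        rw [headCoeff_diagOp hh hdeg, map_add, map_smul, Algebra.smul_def,
          show aeval t (antidiff (fun a b => diagOp n ε h l a (headCoeff b P)) j k) =
            antidiff a j k from antidiff_map (aeval t) _ j k]
        ring
      · rcases Nat.eq_zero_or_pos n with rfl | hn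
        · exact absurd (hdeg 0) (Nat.not_lt_zero _)
        · exact (hdeg.diagOp hn j).succ
    have hA := sum_antidiff ha u w
    simp only [smul_eq_mul, mul_sub, Finset.sum_sub_distrib] at hA
    rw [hS u w huT hwT huw] at hA hL
    -- The transposed coefficients give the same expression with `u` and `w` exchanged.
    have hS' := hS w u hwT huT huw.symm
    rw [Finset.sum_comm] at hS'
    rw [show ∑ j ∈ Finset.range (n + 1), ∑ k ∈ Finset.range (n + 1), (u ^ j * w ^ k) * a k j =
      _ from (Finset.sum_congr rfl fun j _ => Finset.sum_congr rfl fun k _ => by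
        rw [mul_comm (u ^ j)]).trans hS'] at hA
    -- After multiplication by `w - u`, `sum_antidiff` on one side and `diagSum_insert` on the other
    -- give the same combination.
    refine mul_left_cancel₀ hwu ?_
    rw [diagSum_insert _ _ _ huT hwT huw, hL]
    linear_combination (algebraMap ℂ L ε) * hA

/-- A generating polynomial whose values depend only on the set of points has symmetric
coefficients. Symmetry is not visible in the recursion, which singles out the first variable, and is
recovered here from the closed formula. -/
theorem isSymmetric_of_sum_aeval {N : ℕ} {R : ℕ → MvPolynomial (Fin l) ℂ} (hR : ∀ j, N ≤ j → R j = 0)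
    (G : ℂ → Finset ℂ → ℂ) (hG : ∀ (s : Fin l → ℂ), Function.Injective s → ∀ u : ℂ,
      u ∉ Finset.univ.image s →
        ∑ j ∈ Finset.range N, u ^ j * aeval s (R j) = G u (Finset.univ.image s)) (j : ℕ) :
    (R j).IsSymmetric := by
  intro σ
  rcases Nat.lt_or_ge j N with hj | hj
  · refine eq_of_forall_injective ∅ fun s hs _ => ?_
    rw [aeval_rename, ← sub_eq_zero]
    have hi : Finset.univ.image (s ∘ σ) = Finset.univ.image s := by
      rw [← Finset.image_image, Finset.image_univ_equiv]
    refine eq_zero_of_forall_sum_pow_smul (Finset.univ.image s) N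
      (fun j => aeval (s ∘ σ) (R j) - aeval s (R j)) (fun u hu => ?_) j hj
    simp only [smul_eq_mul, mul_sub, Finset.sum_sub_distrib]
    rw [hG s hs u hu, hG (s ∘ σ) (hs.comp σ.injective) u (by rwa [hi]), hi, sub_self]
  · rw [hR j hj, map_zero]

theorem isSymmetric_diagOp (hh : h.natDegree ≤ n) {P : MvPolynomial (Fin l) ℂ}
    (hsym : P.IsSymmetric) (hdeg : DegLT n P) (j : ℕ) : (diagOp n ε h l j P).IsSymmetric :=
  isSymmetric_of_sum_aeval (N := n + 1) (fun _ hj => diagOp_eq_zero hh hdeg hj) _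
    (fun _ hs _ hu => sum_aeval_diagOp hh hsym hdeg hs hu) j

/-- The closed formula can be applied twice because the first operator again yields symmetric
polynomials with the same degree bound. -/
theorem sum_aeval_diagOp_diagOp (hn : 0 < n) (hq : q.natDegree ≤ n) (hp : p.natDegree ≤ n)
    {P : MvPolynomial (Fin l) ℂ} (hsym : P.IsSymmetric) (hdeg : DegLT n P) {s : Fin l → L}
    (hs : Function.Injective s) {u w : L} (hu : u ∉ Finset.univ.image s)
    (hw : w ∉ Finset.univ.image s) (huw : u ≠ w) :
    ∑ j ∈ Finset.range (n + 1), ∑ k ∈ Finset.range (n + 1),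
      (u ^ j * w ^ k) * aeval s (diagOp n 1 q l j (diagOp n (-1) p l k P)) =
      diagSum 1 (fun x => Polynomial.aeval x q)
        (diagSum (-1) (fun x => Polynomial.aeval x p) (finsetVal P) w) u
        (Finset.univ.image s) := by
  have hc : (Finset.univ.image s).card = l := by
    rw [Finset.card_image_of_injective _ hs, Finset.card_univ, Fintype.card_fin]
  rw [diagSum_congr (G := fun S => ∑ k ∈ Finset.range (n + 1),
    w ^ k * finsetVal (diagOp n (-1) p l k P) S) hu, diagSum_sum, Finset.sum_comm]
  · refine Finset.sum_congr rfl fun k _ => ?_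
    have := sum_aeval_diagOp (ε := 1) hq (isSymmetric_diagOp (ε := -1) hp hsym hdeg k)
      (hdeg.diagOp hn k) hs hu
    rw [map_one] at this
    rw [← this, Finset.mul_sum]
    exact Finset.sum_congr rfl fun j _ => by ring
  · intro S hS hST
    rw [hc] at hS
    obtain ⟨t, ht, rfl⟩ : ∃ t : Fin l → L, Function.Injective t ∧ Finset.univ.image t = S := by
      subst hS
      exact exists_eq_image S
    have hwt : w ∉ Finset.univ.image t := fun hh => by
      rcases Finset.mem_insert.1 (hST hh) with e | e
      · exact huw e.symm
      · exact hw e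
    have := sum_aeval_diagOp (ε := -1) hp hsym hdeg ht hwt
    rw [map_neg, map_one] at this
    rw [← this]
    refine Finset.sum_congr rfl fun k _ => ?_
    rw [finsetVal_image (isSymmetric_diagOp hp hsym hdeg k) ht]

theorem sum_aeval_crossOp (hn : 0 < n) (hq : q.natDegree ≤ n) (hp : p.natDegree ≤ n)
    {P : MvPolynomial (Fin l) ℂ} (hsym : P.IsSymmetric) (hdeg : DegLT n P) {s : Fin l → L}
    (hs : Function.Injective s) {u w : L} (hu : u ∉ Finset.univ.image s)
    (hw : w ∉ Finset.univ.image s) (huw : u ≠ w) :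
    (w - u) * ∑ j ∈ Finset.range (n + 1), ∑ k ∈ Finset.range (n + 1),
      (u ^ j * w ^ k) * aeval s (crossOp n q p l j k P) =
      diagSum 1 (fun x => Polynomial.aeval x q)
        (diagSum (-1) (fun x => Polynomial.aeval x p) (finsetVal P) w) u
        (Finset.univ.image s) -
      diagSum 1 (fun x => Polynomial.aeval x q)
        (diagSum (-1) (fun x => Polynomial.aeval x p) (finsetVal P) u) w
        (Finset.univ.image s) := by
  let a : ℕ → ℕ → L := fun j k => aeval s (diagOp n 1 q l j (diagOp n (-1) p l k P))
  have ha : ∀ j k, n < j ∨ n < k → a j k = 0 := fun j k hjk => by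
    change aeval s (diagOp n 1 q l j (diagOp n (-1) p l k P)) = 0
    rw [diagOp_diagOp_eq_zero hn hq hp hdeg j k hjk, map_zero]
  have hA := sum_antidiff ha u w
  simp only [smul_eq_mul, mul_sub, Finset.sum_sub_distrib] at hA
  have h2 := sum_aeval_diagOp_diagOp hn hq hp hsym hdeg hs hw hu huw.symm
  rw [Finset.sum_comm] at h2
  rw [← sum_aeval_diagOp_diagOp hn hq hp hsym hdeg hs hu hw huw, ← h2]
  simp only [crossOp_apply]
  rw [show ∑ j ∈ Finset.range (n + 1), ∑ k ∈ Finset.range (n + 1), (u ^ j * w ^ k) *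
    aeval s (antidiff (fun a b => diagOp n 1 q l a (diagOp n (-1) p l b P)) j k) =
      ∑ j ∈ Finset.range (n + 1), ∑ k ∈ Finset.range (n + 1), (u ^ j * w ^ k) *
      antidiff a j k from Finset.sum_congr rfl fun j _ => Finset.sum_congr rfl fun k _ =>
        congrArg _ (antidiff_map (aeval s) _ j k), hA]
  congr 1
  exact Finset.sum_congr rfl fun j _ => Finset.sum_congr rfl fun k _ => by
    rw [mul_comm (u ^ j)]

/-- The closed formula for the raising generator. -/
theorem sum_aeval_raiseOp (hn : 0 < n) (hq : q.natDegree ≤ n) (hp : p.natDegree ≤ n) :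
    ∀ {l : ℕ} {P : MvPolynomial (Fin l) ℂ},
    P.IsSymmetric → DegLT n P → ∀ {s : Fin (l + 1) → L}, Function.Injective s →
    ∀ {u : L}, u ∉ Finset.univ.image s →
    ∑ j ∈ Finset.range (n + 1), u ^ j * aeval s (raiseOp n q p l j P) =
      raiseSum (fun x => Polynomial.aeval x q) (fun x => Polynomial.aeval x p) (finsetVal P) u
        (Finset.univ.image s) := by
  intro l P hsym hdeg s hs u hu
  induction l with
  | zero =>
    obtain ⟨w, t, rfl⟩ : ∃ w t, s = Fin.cons w t := ⟨s 0, Fin.tail s, (Fin.cons_self_tail s).symm⟩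
    obtain ⟨hw, ht⟩ := Fin.cons_injective_iff.1 hs
    rw [image_cons] at hu ⊢
    have he : (Finset.univ.image t : Finset L) = ∅ := rfl
    have huw : u ≠ w := fun hh => hu (hh ▸ Finset.mem_insert_self _ _)
    have hwu : w - u ≠ 0 := sub_ne_zero.2 huw.symm
    have hX := sum_aeval_crossOp hn hq hp hsym hdeg ht (u := u) (w := w)
      (by rw [he]; exact Finset.notMem_empty _) (by rw [he]; exact Finset.notMem_empty _) huw
    refine mul_left_cancel₀ hwu ?_
    rw [he] at hX ⊢
    rw [raiseSum_insert _ _ _ (Finset.notMem_empty _) (Finset.notMem_empty _) huw]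
    -- With no further points nothing can be removed, so the commutator term is the whole
    -- contribution.
    have h0 : raiseSum (fun x => Polynomial.aeval x q) (fun x => Polynomial.aeval x p)
        (fun S => finsetVal P (insert w S)) u ∅ = 0 := by
      simp [raiseSum]
    rw [h0, mul_zero, zero_add (diagSum _ _ _ _ _ - _), ← hX]
    congr 1
    refine Finset.sum_congr rfl fun j _ => ?_
    rw [aeval_cons (hdeg.raiseOp hn j).succ, Finset.mul_sum]
    refine Finset.sum_congr rfl fun k _ => ?_
    rw [headCoeff_raiseOp_zero hn hq hp hdeg]
    ring
  | succ l ih =>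
    obtain ⟨w, t, rfl⟩ : ∃ w t, s = Fin.cons w t := ⟨s 0, Fin.tail s, (Fin.cons_self_tail s).symm⟩
    obtain ⟨hw, ht⟩ := Fin.cons_injective_iff.1 hs
    rw [image_cons] at hu ⊢
    have hTc : (Finset.univ.image t).card = l + 1 := by
      rw [Finset.card_image_of_injective _ ht, Finset.card_univ, Fintype.card_fin]
    have hwT : w ∉ Finset.univ.image t := by
      rw [Finset.mem_image]
      rintro ⟨i, -, hi⟩
      exact hw ⟨i, hi⟩
    have huT : u ∉ Finset.univ.image t := fun hh => hu (Finset.mem_insert_of_mem hh)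
    have huw : u ≠ w := fun hh => hu (hh ▸ Finset.mem_insert_self _ _)
    have hwu : w - u ≠ 0 := sub_ne_zero.2 huw.symm
    have hX := sum_aeval_crossOp hn hq hp hsym hdeg ht huT hwT huw
    have hI : raiseSum (fun x => Polynomial.aeval x q) (fun x => Polynomial.aeval x p)
        (fun S => finsetVal P (insert w S)) u (Finset.univ.image t) =
        ∑ k ∈ Finset.range (n + 1), w ^ k * ∑ j ∈ Finset.range (n + 1),
          u ^ j * aeval t (raiseOp n q p l j (headCoeff k P)) := by
      rw [raiseSum_congr (G := fun S => ∑ i ∈ Finset.range (n + 1),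
        w ^ i * finsetVal (headCoeff i P) S) huT, raiseSum_sum]
      · refine Finset.sum_congr rfl fun k _ => ?_
        rw [ih (isSymmetric_headCoeff hsym k) (hdeg.headCoeff k) ht huT]
      · intro S hS hST
        exact finsetVal_insert hsym hdeg.succ
          (fun hh => by
            rcases Finset.mem_insert.1 (hST hh) with e | e
            · exact huw e.symm
            · exact hwT e) (by omega)
    refine mul_left_cancel₀ hwu ?_
    rw [raiseSum_insert _ _ _ huT hwT huw, ← hX, hI, ← mul_add]
    congr 1
    simp only [Finset.mul_sum]
    rw [Finset.sum_comm, ← Finset.sum_add_distrib]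
    refine Finset.sum_congr rfl fun j _ => ?_
    rw [aeval_cons (hdeg.raiseOp hn j).succ, Finset.mul_sum, ← Finset.sum_add_distrib]
    refine Finset.sum_congr rfl fun k _ => ?_
    rw [headCoeff_raiseOp_succ hn hq hp hdeg, map_add]
    ring

theorem isSymmetric_raiseOp (hn : 0 < n) (hq : q.natDegree ≤ n) (hp : p.natDegree ≤ n)
    {P : MvPolynomial (Fin l) ℂ} (hsym : P.IsSymmetric) (hdeg : DegLT n P) (j : ℕ) :
    (raiseOp n q p l j P).IsSymmetric :=
  isSymmetric_of_sum_aeval (N := n + 1)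
    (fun _ hj => raiseOp_eq_zero hn hq hp hdeg (Nat.le_of_succ_le hj)) _
    (fun _ hs _ hu => sum_aeval_raiseOp hn hq hp hsym hdeg hs hu) j

end ClosedFormulas

/-! ### The space of symmetric sequences and passage to coefficients -/

open MvPolynomial in
/-- Finite sequences of symmetric polynomials in `0, 1, 2, …` variables, of degree less than `n` in
each variable. -/
def SymSpace (n : ℕ) [NeZero n] : Submodule ℂ (∀ l, MvPolynomial (Fin l) ℂ) where
  carrier := {v | (∀ l, (v l).IsSymmetric ∧ DegLT n (v l)) ∧ ∃ N, ∀ l, N ≤ l → v l = 0}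
  zero_mem' := ⟨fun _ => ⟨IsSymmetric.zero, DegLT.zero (Nat.pos_of_ne_zero (NeZero.ne n))⟩,
    0, fun _ _ => rfl⟩
  add_mem' := by
    rintro v w ⟨hv, N, hN⟩ ⟨hw, N', hN'⟩
    refine ⟨fun l => ⟨(hv l).1.add (hw l).1, (hv l).2.add (hw l).2⟩, max N N', fun l hl => ?_⟩
    rw [Pi.add_apply, hN l ((le_max_left _ _).trans hl), hN' l ((le_max_right _ _).trans hl),
      add_zero]
  smul_mem' := by
    rintro c v ⟨hv, N, hN⟩
    refine ⟨fun l => ⟨(hv l).1.smul c, (hv l).2.smul c⟩, N, fun l hl => ?_⟩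
    rw [Pi.smul_apply, hN l hl, smul_zero]

/-- The relations between coefficients that follow from relations between generating functions. -/
theorem rtt_of_genFun {R : Type} [Ring R] [Algebra ℂ R] {n : ℕ} {t : Fin 2 → Fin 2 → ℕ → R}
    {T : Fin 2 → Fin 2 → ℂ → R}
    (htT : ∀ i j, ∀ N, n + 1 ≤ N → ∀ ξ : ℂ, ξ ≠ 0 →
      ∑ s ∈ Finset.range N, ξ ^ s • t i j s = ξ ^ n • T i j ξ⁻¹)
    (h0 : ∀ i j X, t i j 0 * X = X * t i j 0)
    (hT : ∀ i j k l x y, (x - y) • (T i j x * T k l y - T k l y * T i j x) =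
      T k j y * T i l x - T k j x * T i l y) (i j k l : Fin 2) (r s : ℕ) :
    (t i j (r + 1) * t k l s - t k l s * t i j (r + 1)) -
      (t i j r * t k l (s + 1) - t k l (s + 1) * t i j r) =
      t k j s * t i l r - t k j r * t i l s := by
  let v : ℕ → ℕ → R := fun r s =>
    (t i j (r + 1) * t k l s - t k l s * t i j (r + 1)) -
      (t i j r * t k l (s + 1) - t k l (s + 1) * t i j r) -
      (t k j s * t i l r - t k j r * t i l s)
  suffices h : v r s = 0 from sub_eq_zero.1 h
  set N := n + 1 + r + s with hN
  -- With `ξ = x⁻¹` and `η = y⁻¹`, the coefficient relations are the relation of generating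
  -- functions multiplied by `(ξ η)^n`.
  have key : ∀ ξ η : ℂ, ξ ≠ 0 → η ≠ 0 →
      ∑ s ∈ Finset.range N, η ^ s • ∑ r ∈ Finset.range N, ξ ^ r • v r s = 0 := by
    intro ξ η hξ hη
    have hG : ∀ a b {x : ℂ}, x ≠ 0 → ∑ s ∈ Finset.range N, x ^ s • t a b s =
        x ^ n • T a b x⁻¹ := fun a b x hx => htT a b N (by omega) x hx
    have hG' : ∀ a b {x : ℂ}, x ≠ 0 → ∑ s ∈ Finset.range N, x ^ s • t a b (s + 1) =
        x⁻¹ • (x ^ n • T a b x⁻¹ - t a b 0) := by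
      intro a b x hx
      rw [← htT a b (N + 1) (by omega) x hx, Finset.sum_range_succ',
        pow_zero, one_smul, add_sub_cancel_right, Finset.smul_sum]
      refine Finset.sum_congr rfl fun s _ => ?_
      rw [smul_smul, pow_succ', inv_mul_cancel_left₀ hx]
    have hprod : ∀ (f g : ℕ → R),
        ∑ s ∈ Finset.range N, η ^ s • ∑ r ∈ Finset.range N, ξ ^ r • (f r * g s) =
        (∑ r ∈ Finset.range N, ξ ^ r • f r) * ∑ s ∈ Finset.range N, η ^ s • g s := by
      intro f g
      rw [Finset.mul_sum]
      refine Finset.sum_congr rfl fun s _ => ?_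
      rw [mul_smul_comm, Finset.sum_mul]
      simp only [smul_mul_assoc]
    have hprod' : ∀ (f g : ℕ → R),
        ∑ s ∈ Finset.range N, η ^ s • ∑ r ∈ Finset.range N, ξ ^ r • (g s * f r) =
        (∑ s ∈ Finset.range N, η ^ s • g s) * ∑ r ∈ Finset.range N, ξ ^ r • f r := by
      intro f g
      rw [Finset.sum_mul]
      refine Finset.sum_congr rfl fun s _ => ?_
      rw [smul_mul_assoc, Finset.mul_sum]
      simp only [mul_smul_comm]
    simp only [v, smul_sub, Finset.sum_sub_distrib]
    rw [hprod (fun r => t i j (r + 1)) (fun s => t k l s),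
      hprod' (fun r => t i j (r + 1)) (fun s => t k l s),
      hprod (fun r => t i j r) (fun s => t k l (s + 1)),
      hprod' (fun r => t i j r) (fun s => t k l (s + 1)),
      hprod' (fun r => t i l r) (fun s => t k j s), hprod (fun r => t k j r) (fun s => t i l s)]
    simp only [hG _ _ hξ, hG _ _ hη, hG' _ _ hξ, hG' _ _ hη]
    -- Shifting the index by one introduces corrections by `t i j 0` and `t k l 0`; these cancel
    -- since those elements commute with everything.
    simp only [smul_sub, sub_mul, mul_sub, smul_mul_assoc, mul_smul_comm, h0 i j, h0 k l,
      smul_smul]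
    have e := congrArg (fun X => (ξ ^ n * η ^ n) • X) (hT i j k l ξ⁻¹ η⁻¹)
    simp only [smul_sub, sub_smul, smul_smul] at e
    rw [← sub_eq_zero] at e
    rw [← e]
    module
  have h1 : ∀ ξ : ℂ, ξ ∉ ({0} : Finset ℂ) → ∑ r ∈ Finset.range N, ξ ^ r • v r s = 0 := by
    intro ξ hξ
    refine eq_zero_of_forall_sum_pow_smul {0} N (fun s => ∑ r ∈ Finset.range N, ξ ^ r • v r s)
      (fun η hη => key ξ η (fun hh => hξ (Finset.mem_singleton.2 hh))
        fun hh => hη (Finset.mem_singleton.2 hh)) s (by omega)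
  exact eq_zero_of_forall_sum_pow_smul {0} N (fun r => v r s) h1 r (by omega)

/-! ### The Yangian acting on symmetric sequences -/

namespace SymSpace

open MvPolynomial

variable {n : ℕ} [NeZero n] {ε : ℂ} {h q p : Polynomial ℂ}

theorem isSymmetric (v : SymSpace n) (l : ℕ) : (v.1 l).IsSymmetric := (v.2.1 l).1

theorem degLT (v : SymSpace n) (l : ℕ) : DegLT n (v.1 l) := (v.2.1 l).2

theorem pos (n : ℕ) [NeZero n] : 0 < n := Nat.pos_of_ne_zero (NeZero.ne n)

theorem ext {v w : SymSpace n} (hvw : ∀ l, v.1 l = w.1 l) : v = w := Subtype.ext (funext hvw)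

/-- The coefficients of a diagonal generator. -/
def diag (ε : ℂ) (hh : h.natDegree ≤ n) (j : ℕ) : Module.End ℂ (SymSpace n) :=
  (LinearMap.pi fun l => diagOp n ε h l j ∘ₗ LinearMap.proj l).restrict (by
    rintro v ⟨hv, N, hN⟩
    refine ⟨fun l => ⟨isSymmetric_diagOp hh (hv l).1 (hv l).2 j, (hv l).2.diagOp (pos n) j⟩,
      N, fun l hl => ?_⟩
    simp [hN l hl])

/-- The coefficients of the lowering generator. -/
def lower (j : ℕ) : Module.End ℂ (SymSpace n) :=
  (LinearMap.pi fun l => headCoeff j ∘ₗ LinearMap.proj (l + 1)).restrict (by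
    rintro v ⟨hv, N, hN⟩
    refine ⟨fun l => ⟨isSymmetric_headCoeff (hv (l + 1)).1 j, (hv (l + 1)).2.headCoeff j⟩,
      N, fun l hl => ?_⟩
    simp [hN (l + 1) (by omega)])

/-- The coefficients of the raising generator on all sequences of polynomials. -/
def raisePi (n : ℕ) (q p : Polynomial ℂ) (j : ℕ) :
    (∀ l, MvPolynomial (Fin l) ℂ) →ₗ[ℂ] ∀ l, MvPolynomial (Fin l) ℂ :=
  LinearMap.pi fun l => match l with
    | 0 => 0
    | l + 1 => raiseOp n q p l j ∘ₗ LinearMap.proj l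

/-- The coefficients of the raising generator. -/
def raise (hq : q.natDegree ≤ n) (hp : p.natDegree ≤ n) (j : ℕ) : Module.End ℂ (SymSpace n) :=
  (raisePi n q p j).restrict (by
    rintro v ⟨hv, N, hN⟩
    refine ⟨fun l => ?_, N + 1, fun l hl => ?_⟩
    · cases l with
      | zero => exact ⟨IsSymmetric.zero, DegLT.zero (pos n)⟩
      | succ l => exact ⟨isSymmetric_raiseOp (pos n) hq hp (hv l).1 (hv l).2 j,
          (hv l).2.raiseOp (pos n) j⟩
    · obtain ⟨l, rfl⟩ : ∃ m, l = m + 1 := ⟨l - 1, by omega⟩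
      change raiseOp n q p l j (v l) = 0
      rw [hN l (by omega), map_zero])

theorem diag_apply (hh : h.natDegree ≤ n) (j : ℕ) (v : SymSpace n) (l : ℕ) :
    (diag ε hh j v).1 l = diagOp n ε h l j (v.1 l) := rfl

theorem lower_apply (j : ℕ) (v : SymSpace n) (l : ℕ) :
    (lower j v).1 l = headCoeff j (v.1 (l + 1)) := rfl

theorem raise_apply_zero (hq : q.natDegree ≤ n) (hp : p.natDegree ≤ n) (j : ℕ) (v : SymSpace n) :
    (raise hq hp j v).1 0 = 0 := rfl

theorem raise_apply_succ (hq : q.natDegree ≤ n) (hp : p.natDegree ≤ n) (j : ℕ) (v : SymSpace n)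
    (l : ℕ) : (raise hq hp j v).1 (l + 1) = raiseOp n q p l j (v.1 l) := rfl

/-- The polynomial with operator coefficients `X j`, `j ≤ n`. -/
def genFun (X : ℕ → Module.End ℂ (SymSpace n)) (u : ℂ) : Module.End ℂ (SymSpace n) :=
  ∑ j ∈ Finset.range (n + 1), u ^ j • X j

theorem genFun_apply (X : ℕ → Module.End ℂ (SymSpace n)) (u : ℂ) (v : SymSpace n) (l : ℕ) :
    (genFun X u v).1 l = ∑ j ∈ Finset.range (n + 1), u ^ j • (X j v).1 l := by
  rw [genFun, LinearMap.sum_apply, Submodule.coe_sum, Finset.sum_apply]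
  rfl

/-- The generating function of the lowering operators is substitution for the first variable; this
is why `ι*` is a product of such operators. -/
theorem aeval_lower {L : Type} [Field L] [Algebra ℂ L] (w : ℂ) (v : SymSpace n) {l : ℕ}
    (t : Fin l → L) : aeval t ((genFun lower w v).1 l) =
      aeval (Fin.cons (algebraMap ℂ L w) t : Fin (l + 1) → L) (v.1 (l + 1)) := by
  rw [genFun_apply, map_sum, aeval_cons (degLT v (l + 1)).succ]
  refine Finset.sum_congr rfl fun j _ => ?_
  rw [map_smul, Algebra.smul_def, map_pow, lower_apply]

/-- Both orders substitute `x` and `y` for the first two variables, and symmetry allows these to be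
exchanged. -/
theorem lower_comm (x y : ℂ) (v : SymSpace n) :
    genFun lower x (genFun lower y v) = genFun lower y (genFun lower x v) := by
  refine ext fun l => MvPolynomial.funext fun t => ?_
  have key : ∀ x y : ℂ, eval t ((genFun lower x (genFun lower y v)).1 l) =
      aeval (Fin.cons y (Fin.cons x t : Fin (l + 1) → ℂ) : Fin (l + 2) → ℂ) (v.1 (l + 2)) := by
    intro x y
    exact (aeval_lower x (genFun lower y v) t).trans
      (aeval_lower y v (Fin.cons x t : Fin (l + 1) → ℂ))
  rw [key, key, ← aeval_comp_perm (isSymmetric v (l + 2)) _ (Equiv.swap 0 1)]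
  congr 2
  funext i
  refine Fin.cases ?_ (fun i => Fin.cases ?_ (fun i => ?_) i) i
  · simp
  · simp
  · rw [Function.comp_apply, Equiv.swap_apply_of_ne_of_ne]
    · simp
    · exact Fin.succ_ne_zero _
    · exact fun hh => Fin.succ_ne_zero i (Fin.succ_injective _ hh)

/-- The recursion for `diagOp` summed into generating functions: `sum_antidiff` clears the
denominator hidden in `antidiff`. -/
theorem lower_diag (hh : h.natDegree ≤ n) (x y : ℂ) (v : SymSpace n) :
    (x - y) • genFun lower x (genFun (diag ε hh) y v) =
      (x - y + ε) • genFun (diag ε hh) y (genFun lower x v) -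
        ε • genFun (diag ε hh) x (genFun lower y v) := by
  refine ext fun l => ?_
  let f : ℕ → ℕ → MvPolynomial (Fin l) ℂ := fun a b => diagOp n ε h l a (headCoeff b (v.1 (l + 1)))
  have hf : ∀ a b, n < a ∨ n < b → f a b = 0 := fun a b hab =>
    diagOp_headCoeff_eq_zero hh (degLT v (l + 1)) a b hab
  have h1 : (genFun lower x (genFun (diag ε hh) y v)).1 l =
      ∑ j ∈ Finset.range (n + 1), ∑ k ∈ Finset.range (n + 1),
        (y ^ j * x ^ k) • (f j k + ε • antidiff f j k) := by
    simp only [genFun_apply, lower_apply, map_sum, map_smul, diag_apply,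
      headCoeff_diagOp hh (degLT v (l + 1)), Finset.smul_sum, smul_smul]
    rw [Finset.sum_comm]
    exact Finset.sum_congr rfl fun j _ => Finset.sum_congr rfl fun k _ => by rw [mul_comm]
  have h2 : ∀ x y, (genFun (diag ε hh) y (genFun lower x v)).1 l =
      ∑ j ∈ Finset.range (n + 1), ∑ k ∈ Finset.range (n + 1), (y ^ j * x ^ k) • f j k := by
    intro x y
    simp only [genFun_apply, lower_apply, map_sum, map_smul, diag_apply, Finset.smul_sum,
      smul_smul]
    rfl
  have h3 : (genFun (diag ε hh) x (genFun lower y v)).1 l =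
      ∑ j ∈ Finset.range (n + 1), ∑ k ∈ Finset.range (n + 1), (y ^ j * x ^ k) • f k j := by
    rw [h2, Finset.sum_comm]
    exact Finset.sum_congr rfl fun j _ => Finset.sum_congr rfl fun k _ => by rw [mul_comm]
  have h4 := sum_antidiff hf y x
  change (x - y) • (genFun lower x (genFun (diag ε hh) y v)).1 l =
    (x - y + ε) • (genFun (diag ε hh) y (genFun lower x v)).1 l -
      ε • (genFun (diag ε hh) x (genFun lower y v)).1 l
  rw [h1, h2, h3]
  simp only [smul_add, smul_sub, Finset.sum_add_distrib, Finset.sum_sub_distrib,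
    smul_comm _ ε (antidiff _ _ _), ← Finset.smul_sum] at h4 ⊢
  rw [smul_comm (x - y) ε, h4]
  module

/-- In the recursion for `raiseOp` the first summand is `B(y) C(x)`, so the commutator is the
generating function of `crossOp`; in degree zero that first summand is absent. -/
theorem lower_raise (hq : q.natDegree ≤ n) (hp : p.natDegree ≤ n) (x y : ℂ) (v : SymSpace n) :
    (x - y) • (genFun lower x (genFun (raise hq hp) y v) -
        genFun (raise hq hp) y (genFun lower x v)) =
      genFun (diag 1 hq) y (genFun (diag (-1) hp) x v) -
        genFun (diag 1 hq) x (genFun (diag (-1) hp) y v) := by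
  refine ext fun l => ?_
  let f : ℕ → ℕ → MvPolynomial (Fin l) ℂ := fun a b => diagOp n 1 q l a (diagOp n (-1) p l b (v.1 l))
  have hf : ∀ a b, n < a ∨ n < b → f a b = 0 := fun a b hab =>
    diagOp_diagOp_eq_zero (pos n) hq hp (degLT v l) a b hab
  have h1 : (genFun lower x (genFun (raise hq hp) y v) -
        genFun (raise hq hp) y (genFun lower x v)).1 l =
      ∑ j ∈ Finset.range (n + 1), ∑ k ∈ Finset.range (n + 1),
        (y ^ j * x ^ k) • antidiff f j k := by
    change (genFun lower x (genFun (raise hq hp) y v)).1 l -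
        (genFun (raise hq hp) y (genFun lower x v)).1 l = _
    cases l with
    | zero =>
      simp only [genFun_apply, raise_apply_zero, smul_zero, Finset.sum_const_zero, sub_zero,
        lower_apply, raise_apply_succ, map_sum, map_smul,
        headCoeff_raiseOp_zero (pos n) hq hp (degLT v 0), Finset.smul_sum, smul_smul,
        crossOp_apply]
      rw [Finset.sum_comm]
      exact Finset.sum_congr rfl fun j _ => Finset.sum_congr rfl fun k _ => by rw [mul_comm]
    | succ l =>
      simp only [genFun_apply, lower_apply, raise_apply_succ, map_sum, map_smul,
        headCoeff_raiseOp_succ (pos n) hq hp (degLT v (l + 1)), Finset.smul_sum, smul_smul,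
        crossOp_apply]
      rw [Finset.sum_comm, ← Finset.sum_sub_distrib]
      refine Finset.sum_congr rfl fun j _ => ?_
      rw [← Finset.sum_sub_distrib]
      refine Finset.sum_congr rfl fun k _ => ?_
      rw [mul_comm, smul_add, add_sub_cancel_left]
  have h2 : ∀ x y, (genFun (diag 1 hq) y (genFun (diag (-1) hp) x v)).1 l =
      ∑ j ∈ Finset.range (n + 1), ∑ k ∈ Finset.range (n + 1), (y ^ j * x ^ k) • f j k := by
    intro x y
    simp only [genFun_apply, map_sum, map_smul, diag_apply, Finset.smul_sum, smul_smul]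
    rfl
  have h3 : (genFun (diag 1 hq) x (genFun (diag (-1) hp) y v)).1 l =
      ∑ j ∈ Finset.range (n + 1), ∑ k ∈ Finset.range (n + 1), (y ^ j * x ^ k) • f k j := by
    rw [h2, Finset.sum_comm]
    exact Finset.sum_congr rfl fun j _ => Finset.sum_congr rfl fun k _ => by rw [mul_comm]
  have h4 := sum_antidiff hf y x
  change (x - y) • (genFun lower x (genFun (raise hq hp) y v) -
        genFun (raise hq hp) y (genFun lower x v)).1 l =
    (genFun (diag 1 hq) y (genFun (diag (-1) hp) x v)).1 l -
      (genFun (diag 1 hq) x (genFun (diag (-1) hp) y v)).1 l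
  rw [h1, h2, h3, h4]
  simp only [smul_sub, Finset.sum_sub_distrib]

/-- The value of the component without variables. -/
def vacuum : SymSpace n →ₗ[ℂ] ℂ :=
  (aeval (Fin.elim0 : Fin 0 → ℂ)).toLinearMap ∘ₗ LinearMap.proj 0 ∘ₗ (SymSpace n).subtype

theorem vacuum_apply (v : SymSpace n) :
    vacuum v = aeval (Fin.elim0 : Fin 0 → ℂ) (v.1 0) := rfl

/-- Sequences with components in degrees less than `m` only. -/
def bounded (m : ℕ) : Submodule ℂ (SymSpace n) where
  carrier := {v | ∀ l, m ≤ l → v.1 l = 0}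
  zero_mem' := fun _ _ => rfl
  add_mem' := fun {v w} hv hw l hl => by
    change v.1 l + w.1 l = 0
    rw [hv l hl, hw l hl, add_zero]
  smul_mem' := fun c v hv l hl => by
    change c • v.1 l = 0
    rw [hv l hl, smul_zero]

theorem vacuum_diag (hh : h.natDegree ≤ n) (x : ℂ) (v : SymSpace n) :
    vacuum (genFun (diag ε hh) x v) = h.eval x * vacuum v := by
  rw [vacuum_apply, vacuum_apply, genFun_apply, map_sum, Polynomial.eval_eq_sum_range' (Nat.lt_succ_of_le hh), Finset.sum_mul]
  refine Finset.sum_congr rfl fun j _ => ?_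
  rw [diag_apply, diagOp, LinearMap.smul_apply, LinearMap.id_apply, map_smul, map_smul, smul_eq_mul,
    smul_eq_mul]
  ring

/-- A vector is zero if its vacuum component is and it is annihilated by almost all lowering
operators. -/
theorem eq_zero_of_lower (s : Finset ℂ) (v : SymSpace n) (hv : ∀ w ∉ s, genFun lower w v = 0)
    (h0 : vacuum v = 0) : v = 0 := by
  refine ext fun l => ?_
  change v.1 l = 0
  cases l with
  | zero =>
    refine MvPolynomial.funext fun t => ?_
    rw [map_zero, Subsingleton.elim t Fin.elim0]
    exact h0
  | succ l =>
    have key := eq_zero_of_forall_sum_pow_smul s (n + 1) (fun j => headCoeff j (v.1 (l + 1)))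
      (fun w hw => by
        have := genFun_apply lower w v l
        rw [hv w hw] at this
        exact this.symm)
    refine ext_headCoeff fun i => ?_
    rw [map_zero]
    rcases Nat.lt_or_ge i (n + 1) with hi | hi
    · exact key i hi
    · exact headCoeff_eq_zero (degLT v (l + 1)) (by omega)

/-- The generating functions of the action on `SymSpace n`. -/
def loweringData (hq : q.natDegree ≤ n) (hp : p.natDegree ≤ n) : LoweringData (SymSpace n) where
  A := genFun (diag 1 hq)
  B := genFun (raise hq hp)
  C := genFun lower
  D := genFun (diag (-1) hp)
  CC := lower_comm
  CA x y v := by rw [lower_diag, one_smul]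
  CD x y v := by rw [lower_diag]; module
  CB := lower_raise hq hp
  N := bounded
  N_zero v hv := ext fun l => hv l l.zero_le
  N_exhaust v := v.2.2
  C_N l w v hv m hm := by
    rw [genFun_apply]
    refine Finset.sum_eq_zero fun j _ => ?_
    rw [lower_apply, hv (m + 1) (by omega), map_zero, smul_zero]
  π := vacuum
  detect := eq_zero_of_lower
  q := fun x => q.eval x
  p := fun x => p.eval x
  π_A := vacuum_diag hq
  π_D := vacuum_diag hp
  π_B x v := by
    rw [vacuum_apply, genFun_apply]
    simp only [raise_apply_zero, smul_zero, Finset.sum_const_zero, map_zero]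

/-- The coefficients of `u^j` in the generating functions. -/
def coeffT (hq : q.natDegree ≤ n) (hp : p.natDegree ≤ n) (i j : Fin 2) :
    ℕ → Module.End ℂ (SymSpace n) :=
  (![![diag 1 hq, raise hq hp], ![lower, diag (-1) hp]] :
    Fin 2 → Fin 2 → ℕ → Module.End ℂ (SymSpace n)) i j

theorem genFun_coeffT (hq : q.natDegree ≤ n) (hp : p.natDegree ≤ n) (i j : Fin 2) (u : ℂ) :
    genFun (coeffT hq hp i j) u = (loweringData hq hp).T i j u := by
  fin_cases i <;> fin_cases j <;> rfl

/-- The coefficients of `u^{-s}` in the generating functions divided by `u^n`. -/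
def yangianT (hq : q.natDegree ≤ n) (hp : p.natDegree ≤ n) (i j : Fin 2) (s : ℕ) :
    Module.End ℂ (SymSpace n) :=
  if s ≤ n then coeffT hq hp i j (n - s) else 0

/-- The coefficients of `u^n`: `q` and `p` are monic of degree `n`, which gives the identity on the
diagonal, while raising and lowering have degree less than `n` in `u`. -/
theorem yangianT_zero (hq : q.natDegree ≤ n) (hp : p.natDegree ≤ n) (hq1 : q.coeff n = 1)
    (hp1 : p.coeff n = 1) (i j : Fin 2) :
    yangianT hq hp i j 0 = if i = j then 1 else 0 := by
  rw [yangianT, if_pos n.zero_le, Nat.sub_zero]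
  refine LinearMap.ext fun v => ext fun l => ?_
  fin_cases i <;> fin_cases j
  · exact diagOp_leading hq hq1 (degLT v l)
  · cases l with
    | zero => rfl
    | succ l => exact raiseOp_eq_zero (pos n) hq hp (degLT v l) le_rfl
  · exact headCoeff_eq_zero (degLT v (l + 1)) le_rfl
  · exact diagOp_leading hp hp1 (degLT v l)

theorem yangianT_zero_comm (hq : q.natDegree ≤ n) (hp : p.natDegree ≤ n) (hq1 : q.coeff n = 1)
    (hp1 : p.coeff n = 1) (i j : Fin 2) (X : Module.End ℂ (SymSpace n)) :
    yangianT hq hp i j 0 * X = X * yangianT hq hp i j 0 := by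
  rw [yangianT_zero hq hp hq1 hp1]
  split_ifs
  · rw [one_mul, mul_one]
  · rw [zero_mul, mul_zero]

theorem sum_yangianT (hq : q.natDegree ≤ n) (hp : p.natDegree ≤ n) (i j : Fin 2) {N : ℕ}
    (hN : n + 1 ≤ N) {ξ : ℂ} (hξ : ξ ≠ 0) :
    ∑ s ∈ Finset.range N, ξ ^ s • yangianT hq hp i j s =
      ξ ^ n • (loweringData hq hp).T i j ξ⁻¹ := by
  rw [← genFun_coeffT, genFun, ← Finset.sum_subset (Finset.range_subset_range.2 hN),
    ← Finset.sum_flip, Finset.smul_sum]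
  · refine Finset.sum_congr rfl fun s hs => ?_
    have hs' : s ≤ n := Nat.lt_succ_iff.1 (Finset.mem_range.1 hs)
    rw [yangianT, if_pos (Nat.sub_le n s), Nat.sub_sub_self hs', smul_smul, inv_pow,
      pow_sub₀ _ hξ hs']
  · intro s _ hs
    rw [Finset.mem_range, not_lt] at hs
    rw [yangianT, if_neg (by omega), smul_zero]

theorem yangianT_rtt (hq : q.natDegree ≤ n) (hp : p.natDegree ≤ n) (hq1 : q.coeff n = 1)
    (hp1 : p.coeff n = 1) (i j k l : Fin 2) (r s : ℕ) :
    (yangianT hq hp i j (r + 1) * yangianT hq hp k l s -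
        yangianT hq hp k l s * yangianT hq hp i j (r + 1)) -
      (yangianT hq hp i j r * yangianT hq hp k l (s + 1) -
        yangianT hq hp k l (s + 1) * yangianT hq hp i j r) =
      yangianT hq hp k j s * yangianT hq hp i l r - yangianT hq hp k j r * yangianT hq hp i l s := by
  exact rtt_of_genFun (n := n) (t := yangianT hq hp) (T := (loweringData hq hp).T)
    (fun a b N hN x hx => sum_yangianT hq hp a b hN hx) (yangianT_zero_comm hq hp hq1 hp1)
    (fun i j k l x y => LinearMap.ext fun w => (loweringData hq hp).rtt i j k l x y w) i j k l r s

end SymSpace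

/-! ### Transport to the hypergeometric space -/

open Polynomial in
/-- The monic polynomial with roots `c a`. -/
def rootPoly {n : ℕ} (c : Fin n → ℂ) : Polynomial ℂ := ∏ a, (X - C (c a))

theorem natDegree_rootPoly {n : ℕ} (c : Fin n → ℂ) : (rootPoly c).natDegree = n := by
  rw [rootPoly, Polynomial.natDegree_prod_of_monic _ _ fun a _ => Polynomial.monic_X_sub_C _]
  simp

theorem coeff_rootPoly {n : ℕ} (c : Fin n → ℂ) : (rootPoly c).coeff n = 1 := by
  have h : (rootPoly c).Monic :=
    Polynomial.monic_prod_of_monic _ _ fun a _ => Polynomial.monic_X_sub_C _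
  have h' := h.coeff_natDegree
  rwa [natDegree_rootPoly] at h'

theorem aeval_rootPoly {n : ℕ} (c : Fin n → ℂ) {L : Type} [Field L] [Algebra ℂ L] (x : L) :
    Polynomial.aeval x (rootPoly c) = ∏ a, (x - algebraMap ℂ L (c a)) := by
  simp [rootPoly, map_prod]

theorem RatFn.var_ne_algebraMap {l : ℕ} (b : Fin l) (c : ℂ) :
    RatFn.var b - algebraMap ℂ (RatFn l) c ≠ 0 := by
  rw [RatFn.var, IsScalarTower.algebraMap_apply ℂ (MvPolynomial (Fin l) ℂ) (RatFn l), ← map_sub,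
    Ne, FaithfulSMul.algebraMap_eq_zero_iff]
  intro h
  have := congrArg (MvPolynomial.eval fun _ => c + 1) h
  simp [MvPolynomial.algebraMap_eq] at this

theorem RatFn.var_sub_var_add_ne {l : ℕ} {a b : Fin l} (hab : a ≠ b) (c : ℂ) :
    RatFn.var a - RatFn.var b + algebraMap ℂ (RatFn l) c ≠ 0 := by
  rw [RatFn.var, RatFn.var, IsScalarTower.algebraMap_apply ℂ (MvPolynomial (Fin l) ℂ) (RatFn l),
    ← map_sub, ← map_add, Ne, FaithfulSMul.algebraMap_eq_zero_iff]
  intro h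
  have := congrArg (MvPolynomial.eval (Function.update (fun _ => c) a 1)) h
  simp [MvPolynomial.algebraMap_eq, Function.update_of_ne hab.symm] at this

theorem omegaFactor_ne_zero {l : ℕ} {L : Type} [Field L] {t : Fin l → L}
    (h0 : ∀ a b, a ≠ b → t a - t b ≠ 0) (h1 : ∀ a b, a ≠ b → t a - t b + 1 ≠ 0) :
    omegaFactor t ≠ 0 := by
  refine Finset.prod_ne_zero_iff.2 fun p hp => ?_
  have hp' : p.1 ≠ p.2 := (Finset.mem_filter.1 hp).2.ne
  exact div_ne_zero (h0 _ _ hp') (h1 _ _ hp')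

theorem hypWeight_ne_zero {n : ℕ} (z lam : Fin n → ℂ) (l : ℕ) : hypWeight z lam l ≠ 0 := by
  refine mul_ne_zero (Finset.prod_ne_zero_iff.2 fun a _ => Finset.prod_ne_zero_iff.2 fun b _ =>
    one_div_ne_zero (RatFn.var_ne_algebraMap b _)) (omegaFactor_ne_zero ?_ ?_)
  · intro a b hab
    simpa using RatFn.var_sub_var_add_ne hab 0
  · intro a b hab
    simpa using RatFn.var_sub_var_add_ne hab 1

section
variable {n : ℕ} [NeZero n]

theorem mem_hypComponent {z lam : Fin n → ℂ} {l : ℕ} {f : RatFn l} :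
    f ∈ hypComponent z lam l ↔ ∃ P : MvPolynomial (Fin l) ℂ, P.IsSymmetric ∧ DegLT n P ∧
      f = algebraMap _ (RatFn l) P * hypWeight z lam l := Iff.rfl

namespace SymSpace

/-- The sequence with one component. -/
def single (l : ℕ) (P : MvPolynomial (Fin l) ℂ) (hP : P.IsSymmetric) (hd : DegLT n P) :
    SymSpace n :=
  ⟨Pi.single l P, by
    refine ⟨fun m => ?_, l + 1, fun m hm => Pi.single_eq_of_ne (by omega) _⟩
    by_cases h : m = l
    · subst h
      rw [Pi.single_eq_same]
      exact ⟨hP, hd⟩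
    · rw [Pi.single_eq_of_ne h]
      exact ⟨MvPolynomial.IsSymmetric.zero, DegLT.zero (pos n)⟩⟩

variable {l : ℕ} {P : MvPolynomial (Fin l) ℂ} (hP : P.IsSymmetric) (hd : DegLT n P)

theorem single_same : (single l P hP hd).1 l = P := Pi.single_eq_same _ _

theorem single_of_ne {m : ℕ} (h : m ≠ l) : (single l P hP hd).1 m = 0 := Pi.single_eq_of_ne h _

/-- A bound for the degrees of the components. -/
def bound (v : SymSpace n) : ℕ := v.2.2.choose

theorem eq_zero_of_bound_le (v : SymSpace n) {l : ℕ} (h : bound v ≤ l) : v.1 l = 0 :=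
  v.2.2.choose_spec l h

/-- Multiplication by the weight functions, as a function. -/
def toDirectSum (z lam : Fin n → ℂ) (v : SymSpace n) : ⨁ l, RatFn l :=
  ∑ l ∈ Finset.range (bound v),
    DirectSum.lof ℂ ℕ RatFn l (algebraMap _ (RatFn l) (v.1 l) * hypWeight z lam l)

theorem _root_.lof_same (l : ℕ) (f : RatFn l) : DirectSum.lof ℂ ℕ RatFn l f l = f := by
  rw [DirectSum.lof_apply]

theorem _root_.lof_of_ne {l m : ℕ} (h : m ≠ l) (f : RatFn l) :
    DirectSum.lof ℂ ℕ RatFn l f m = 0 := by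
  rw [DirectSum.lof_eq_of, DirectSum.of_eq_of_ne _ _ _ h]

theorem toDirectSum_apply (z lam : Fin n → ℂ) (v : SymSpace n) (l : ℕ) :
    toDirectSum z lam v l = algebraMap _ (RatFn l) (v.1 l) * hypWeight z lam l := by
  rw [toDirectSum, DFinsupp.finsetSum_apply]
  by_cases h : l < bound v
  · rw [Finset.sum_eq_single l (fun m _ hm => lof_of_ne hm.symm _)
      (fun hl => absurd (Finset.mem_range.2 h) hl)]
    exact lof_same l _
  · rw [eq_zero_of_bound_le v (not_lt.1 h), map_zero, zero_mul]
    exact Finset.sum_eq_zero fun m hm => lof_of_ne (by have := Finset.mem_range.1 hm; omega) _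

/-- Multiplication by the weight functions. -/
def toHyp (z lam : Fin n → ℂ) : SymSpace n →ₗ[ℂ] hypSpace z lam where
  toFun v := ⟨toDirectSum z lam v, fun l => by
    rw [toDirectSum_apply]
    exact mem_hypComponent.2 ⟨_, isSymmetric v l, degLT v l, rfl⟩⟩
  map_add' v w := by
    refine Subtype.ext (DFinsupp.ext fun l => ?_)
    change toDirectSum z lam (v + w) l = toDirectSum z lam v l + toDirectSum z lam w l
    simp only [toDirectSum_apply]
    rw [← add_mul, ← map_add]
    rfl
  map_smul' c v := by
    refine Subtype.ext (DFinsupp.ext fun l => ?_)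
    change toDirectSum z lam (c • v) l = c • toDirectSum z lam v l
    simp only [toDirectSum_apply]
    rw [← smul_mul_assoc, show (c • v).1 l = c • v.1 l from rfl]
    congr 1
    exact map_smul (IsScalarTower.toAlgHom ℂ (MvPolynomial (Fin l) ℂ) (RatFn l)) c (v.1 l)

theorem toHyp_apply (z lam : Fin n → ℂ) (v : SymSpace n) (l : ℕ) :
    (toHyp z lam v : ⨁ l, RatFn l) l = algebraMap _ (RatFn l) (v.1 l) * hypWeight z lam l :=
  toDirectSum_apply z lam v l

/-- The weight functions are nonzero, so each component determines its polynomial. The finite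
support of an element of the direct sum provides the required degree bound. -/
theorem toHyp_bijective (z lam : Fin n → ℂ) : Function.Bijective (toHyp (n := n) z lam) := by
  constructor
  · intro v w h
    refine ext fun l => ?_
    have := congrArg (fun x : hypSpace z lam => (x : ⨁ l, RatFn l) l) h
    simp only [toHyp_apply] at this
    exact FaithfulSMul.algebraMap_injective _ _ (mul_right_cancel₀ (hypWeight_ne_zero z lam l) this)
  · intro x
    choose P hP hd hx using fun l => mem_hypComponent.1 (x.2 l)
    refine ⟨⟨P, fun l => ⟨hP l, hd l⟩, (DFinsupp.support (x : ⨁ l, RatFn l)).sup id + 1,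
      fun l hl => ?_⟩, Subtype.ext (DFinsupp.ext fun l => ?_)⟩
    · have h0 : (x : ⨁ l, RatFn l) l = 0 := by
        by_contra h
        have := Finset.le_sup (f := id) (DFinsupp.mem_support_iff.2 h)
        simp only [id] at this
        omega
      rw [hx l] at h0
      have := (mul_eq_zero.1 h0).resolve_right (hypWeight_ne_zero z lam l)
      exact (FaithfulSMul.algebraMap_eq_zero_iff _ _).1 this
    · exact (toHyp_apply z lam _ l).trans (hx l).symm

/-- Symmetric polynomials and functions of the hypergeometric space. -/
def equivHyp (z lam : Fin n → ℂ) : SymSpace n ≃ₗ[ℂ] hypSpace z lam :=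
  LinearEquiv.ofBijective (toHyp z lam) (toHyp_bijective z lam)

theorem equivHyp_eq_lof (z lam : Fin n → ℂ) (v : SymSpace n) (l : ℕ)
    (hv : ∀ m, m ≠ l → v.1 m = 0) : (equivHyp z lam v : ⨁ l, RatFn l) =
      DirectSum.lof ℂ ℕ RatFn l (algebraMap _ (RatFn l) (v.1 l) * hypWeight z lam l) := by
  refine DFinsupp.ext fun m => (toHyp_apply z lam v m).trans ?_
  by_cases h : m = l
  · subst h
    exact (lof_same m _).symm
  · rw [hv m h, map_zero, zero_mul]
    exact (lof_of_ne h _).symm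

theorem exists_homog_eq {z lam : Fin n → ℂ} {l : ℕ} (f : hypComponent z lam l) :
    ∃ (P : MvPolynomial (Fin l) ℂ) (hP : P.IsSymmetric) (hd : DegLT n P),
      (f : RatFn l) = algebraMap _ (RatFn l) P * hypWeight z lam l ∧
      hypSpace.homog f = equivHyp z lam (single l P hP hd) := by
  obtain ⟨P, hP, hd, hf⟩ := mem_hypComponent.1 f.2
  refine ⟨P, hP, hd, hf, Subtype.ext ?_⟩
  rw [equivHyp_eq_lof z lam _ l fun m hm => single_of_ne hP hd hm, single_same, ← hf]
  rfl

variable {q p : Polynomial ℂ}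

/-- The representation of the Yangian on `SymSpace n`. -/
def rep (hq : q.natDegree ≤ n) (hp : p.natDegree ≤ n) (hq1 : q.coeff n = 1)
    (hp1 : p.coeff n = 1) : Yangian →ₐ[ℂ] Module.End ℂ (SymSpace n) :=
  RingQuot.liftAlgHom ℂ ⟨FreeAlgebra.lift ℂ fun g => yangianT hq hp g.1 g.2.1 g.2.2, by
    intro x y hxy
    induction hxy with
    | unit i j =>
      rw [freeT, FreeAlgebra.lift_ι_apply, yangianT_zero hq hp hq1 hp1]
      split_ifs <;> simp
    | rtt i j k l r s =>
      simp only [freeT, map_sub, map_mul, FreeAlgebra.lift_ι_apply]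
      exact yangianT_rtt hq hp hq1 hp1 i j k l r s⟩

theorem rep_T (hq : q.natDegree ≤ n) (hp : p.natDegree ≤ n) (hq1 : q.coeff n = 1)
    (hp1 : p.coeff n = 1) (i j : Fin 2) (s : ℕ) :
    rep hq hp hq1 hp1 (Yangian.T i j s) = yangianT hq hp i j s := by
  rw [rep, Yangian.T, RingQuot.liftAlgHom_mkAlgHom_apply, freeT, FreeAlgebra.lift_ι_apply]

end SymSpace

/-- The roots of the numerator of `highestWeight`. -/
def numPoly {n : ℕ} (z lam : Fin n → ℂ) : Polynomial ℂ := rootPoly fun a => z a - lam a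

/-- The roots of the denominator of `highestWeight`. -/
def denPoly {n : ℕ} (z lam : Fin n → ℂ) : Polynomial ℂ := rootPoly fun a => z a + lam a

theorem numPoly_le {n : ℕ} (z lam : Fin n → ℂ) : (numPoly z lam).natDegree ≤ n :=
  (natDegree_rootPoly _).le

theorem denPoly_le {n : ℕ} (z lam : Fin n → ℂ) : (denPoly z lam).natDegree ≤ n :=
  (natDegree_rootPoly _).le

/-- The representation of the Yangian on the coordinates of `hypSpace z lam`. -/
def symRep (z lam : Fin n → ℂ) : Yangian →ₐ[ℂ] Module.End ℂ (SymSpace n) :=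
  SymSpace.rep (numPoly_le z lam) (denPoly_le z lam) (coeff_rootPoly _) (coeff_rootPoly _)

theorem symRep_T (z lam : Fin n → ℂ) (i j : Fin 2) (s : ℕ) : symRep z lam (Yangian.T i j s) =
    SymSpace.yangianT (numPoly_le z lam) (denPoly_le z lam) i j s :=
  SymSpace.rep_T _ _ _ _ i j s

/-- The representation of the Yangian on `hypSpace z lam`. -/
def hypRep (z lam : Fin n → ℂ) : Yangian →ₐ[ℂ] Module.End ℂ (hypSpace z lam) :=
  ((SymSpace.equivHyp z lam).conjAlgEquiv ℂ).toAlgHom.comp (symRep z lam)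

theorem hypRep_apply (z lam : Fin n → ℂ) (y : Yangian) (v : SymSpace n) :
    hypRep z lam y (SymSpace.equivHyp z lam v) = SymSpace.equivHyp z lam (symRep z lam y v) := by
  change SymSpace.equivHyp z lam (symRep z lam y ((SymSpace.equivHyp z lam).symm
    (SymSpace.equivHyp z lam v))) = _
  rw [LinearEquiv.symm_apply_apply]

end

/-! ### The factor `ω` under removal of a point -/

section Images

variable {L : Type} [Field L]

theorem omegaFactor_eq {l : ℕ} (t : Fin l → L) :
    omegaFactor t = ∏ a, ∏ b, if a < b then (t a - t b) / (t a - t b + 1) else 1 := by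
  rw [omegaFactor, Finset.prod_filter, Fintype.prod_prod_type]

theorem omegaFactor_cons {l : ℕ} (x : L) (s : Fin l → L) :
    omegaFactor (Fin.cons x s : Fin (l + 1) → L) =
      (∏ i, (x - s i) / (x - s i + 1)) * omegaFactor s := by
  simp only [omegaFactor_eq, Fin.prod_univ_succ, Fin.cons_zero, Fin.cons_succ, if_false,
    one_mul, Fin.succ_pos, if_true, Fin.not_lt_zero, Fin.succ_lt_succ_iff]

theorem omegaFactor_snoc {l : ℕ} (x : L) (s : Fin l → L) :
    omegaFactor (Fin.snoc s x : Fin (l + 1) → L) =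
      (∏ i, (s i - x) / (s i - x + 1)) * omegaFactor s := by
  have h : ∀ i : Fin l, ¬ Fin.last l < i.castSucc := fun i => not_lt.2 (Fin.le_last _)
  simp only [omegaFactor_eq, Fin.prod_univ_castSucc, Fin.snoc_last, Fin.snoc_castSucc, lt_irrefl,
    if_false, mul_one, Fin.castSucc_lt_last, if_true, h, Finset.prod_const_one,
    Fin.castSucc_lt_castSucc_iff, Finset.prod_mul_distrib]
  rw [mul_comm]

theorem image_snoc {L : Type} [DecidableEq L] {l : ℕ} (w : L) (t : Fin l → L) :
    Finset.univ.image (Fin.snoc t w : Fin (l + 1) → L) = insert w (Finset.univ.image t) := by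
  ext x
  simp only [Finset.mem_image, Finset.mem_univ, true_and, Finset.mem_insert, Fin.exists_fin_succ',
    Fin.snoc_last, Fin.snoc_castSucc, eq_comm (a := x)]
  exact or_comm

theorem image_comp_perm {L : Type} [DecidableEq L] {l : ℕ} (t : Fin l → L) (σ : Equiv.Perm (Fin l)) :
    Finset.univ.image (t ∘ σ) = Finset.univ.image t := by
  ext x
  simp only [Finset.mem_image, Finset.mem_univ, true_and, Function.comp_apply]
  exact ⟨fun ⟨a, ha⟩ => ⟨σ a, ha⟩, fun ⟨a, ha⟩ => ⟨σ.symm a, by rw [σ.apply_symm_apply, ha]⟩⟩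

theorem ratioProd_image [DecidableEq L] {l : ℕ} (ε x : L) {s : Fin l → L}
    (hs : Function.Injective s) :
    ratioProd ε x (Finset.univ.image s) = ∏ i, (x - s i - ε) / (x - s i) :=
  Finset.prod_image fun _ _ _ _ h => hs h

/-- The part of `ω` that involves a first point is the inverse of a `ratioProd` with `ε = -1`; for a
last point `prod_right` gives `ε = 1`. This turns brackets into the products of the closed formulas.
-/
theorem prod_left [DecidableEq L] {l : ℕ} (x : L) {s : Fin l → L} (hs : Function.Injective s) :
    ∏ i, (x - s i) / (x - s i + 1) = (ratioProd (-1) x (Finset.univ.image s))⁻¹ := by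
  rw [ratioProd_image _ _ hs, ← Finset.prod_inv_distrib]
  refine Finset.prod_congr rfl fun i _ => ?_
  rw [inv_div, sub_neg_eq_add]

theorem prod_right [DecidableEq L] {l : ℕ} (x : L) {s : Fin l → L} (hs : Function.Injective s) :
    ∏ i, (s i - x) / (s i - x + 1) = (ratioProd 1 x (Finset.univ.image s))⁻¹ := by
  rw [ratioProd_image _ _ hs, ← Finset.prod_inv_distrib]
  refine Finset.prod_congr rfl fun i _ => ?_
  rw [inv_div, ← neg_div_neg_eq]
  congr 1 <;> ring

end Images

/-! ### Values of hypergeometric functions at generic points -/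

section Values

open Polynomial (aeval)

variable {n : ℕ} (z lam : Fin n → ℂ) {L : Type} [Field L] [Algebra ℂ L]

/-- A set of points that avoid constants and whose differences avoid constants. -/
structure Generic (S : Finset L) : Prop where
  const : ∀ x ∈ S, ∀ c : ℂ, x - algebraMap ℂ L c ≠ 0
  diff : ∀ x ∈ S, ∀ y ∈ S, x ≠ y → ∀ c : ℂ, x - y + algebraMap ℂ L c ≠ 0

namespace Generic

variable {S : Finset L}

theorem mono (h : Generic S) {S' : Finset L} (h' : S' ⊆ S) : Generic S' where
  const x hx := h.const x (h' hx)
  diff x hx y hy := h.diff x (h' hx) y (h' hy)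

theorem add_one_ne (h : Generic S) {x y : L} (hx : x ∈ S) (hy : y ∈ S) (hxy : x ≠ y) :
    x - y + 1 ≠ 0 := by
  simpa using h.diff x hx y hy hxy 1

theorem sub_one_ne (h : Generic S) {x y : L} (hx : x ∈ S) (hy : y ∈ S) (hxy : x ≠ y) :
    x - y - 1 ≠ 0 := by
  simpa [sub_eq_add_neg] using h.diff x hx y hy hxy (-1)

theorem aeval_rootPoly_ne (h : Generic S) {x : L} (hx : x ∈ S) (c : Fin n → ℂ) :
    aeval x (rootPoly c) ≠ 0 := by
  rw [aeval_rootPoly]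
  exact Finset.prod_ne_zero_iff.2 fun a _ => h.const x hx _

theorem omegaFactor_ne (h : Generic S) {l : ℕ} {s : Fin l → L} (hs : Function.Injective s)
    (hsS : ∀ i, s i ∈ S) : omegaFactor s ≠ 0 :=
  omegaFactor_ne_zero (fun _ _ hab => sub_ne_zero.2 (hs.ne hab))
    fun a b hab => h.add_one_ne (hsS a) (hsS b) (hs.ne hab)

theorem ratioProd_ne (h : Generic S) {T : Finset L} (hT : T ⊆ S) {x : L} (hx : x ∈ S) (hxT : x ∉ T)
    {ε : L} (hε : ε = 1 ∨ ε = -1) : ratioProd ε x T ≠ 0 := by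
  refine Finset.prod_ne_zero_iff.2 fun c hc => ?_
  have hxc : x ≠ c := fun e => hxT (e ▸ hc)
  refine div_ne_zero ?_ (sub_ne_zero.2 hxc)
  rcases hε with rfl | rfl
  · exact h.sub_one_ne hx (hT hc) hxc
  · rw [sub_neg_eq_add]
    exact h.add_one_ne hx (hT hc) hxc

end Generic

/-- The value of the weight function. -/
def weightVal {l : ℕ} (t : Fin l → L) : L :=
  (∏ b, (aeval (t b) (denPoly z lam))⁻¹) * omegaFactor t

theorem highestWeight_eq (x : L) :
    highestWeight z lam x = aeval x (numPoly z lam) / aeval x (denPoly z lam) := by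
  rw [highestWeight, Finset.prod_div_distrib, numPoly, denPoly, aeval_rootPoly, aeval_rootPoly]
  congr 1
  · exact Finset.prod_congr rfl fun a _ => by rw [map_sub]; ring
  · exact Finset.prod_congr rfl fun a _ => by rw [map_add]; ring

open MvPolynomial in
/-- The numerator of the weight function. -/
def weightNum (l : ℕ) : MvPolynomial (Fin l) ℂ :=
  ∏ p : Fin l × Fin l with p.1 < p.2, (X p.1 - X p.2)

open MvPolynomial in
/-- The product of the denominators `t_a - t_b + 1`. -/
def weightDen (l : ℕ) : MvPolynomial (Fin l) ℂ :=
  ∏ p : Fin l × Fin l with p.1 < p.2, (X p.1 - X p.2 + 1)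

open MvPolynomial in
/-- The product of the denominators `t_b - z_a - λ_a`. -/
def poleDen (l : ℕ) : MvPolynomial (Fin l) ℂ :=
  ∏ b : Fin l, ∏ a : Fin n, (X b - C (z a + lam a))

theorem hypWeight_eq (l : ℕ) : hypWeight z lam l =
    algebraMap _ (RatFn l) (weightNum l) /
      algebraMap _ (RatFn l) (poleDen z lam l * weightDen l) := by
  rw [hypWeight, omegaFactor, Finset.prod_div_distrib, map_mul, mul_comm (algebraMap _ _ _),
    ← div_div, div_eq_mul_inv _ (algebraMap _ _ (poleDen _ _ _)), mul_comm]
  congr 1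
  · simp [weightNum, weightDen, RatFn.var, map_prod]
  · rw [Finset.prod_comm, poleDen]
    simp only [map_prod, map_sub, ← Finset.prod_inv_distrib]
    refine Finset.prod_congr rfl fun b _ => Finset.prod_congr rfl fun a _ => ?_
    rw [one_div, RatFn.var, IsScalarTower.algebraMap_apply ℂ (MvPolynomial (Fin l) ℂ) (RatFn l)]
    rfl

theorem aeval_poleDen {l : ℕ} (t : Fin l → L) :
    MvPolynomial.aeval t (poleDen z lam l) = ∏ b, aeval (t b) (denPoly z lam) := by
  simp [poleDen, denPoly, aeval_rootPoly, map_prod]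

theorem aeval_weightNum {l : ℕ} (t : Fin l → L) :
    MvPolynomial.aeval t (weightNum l) =
      ∏ p : Fin l × Fin l with p.1 < p.2, (t p.1 - t p.2) := by
  simp [weightNum, map_prod]

theorem aeval_weightDen {l : ℕ} (t : Fin l → L) :
    MvPolynomial.aeval t (weightDen l) =
      ∏ p : Fin l × Fin l with p.1 < p.2, (t p.1 - t p.2 + 1) := by
  simp [weightDen, map_prod]

/-- At generic points with different coordinates the visible denominator does not vanish, so the
value of the reduced fraction may be computed without reducing it. -/
theorem evalAt_hyp {S : Finset L} (hS : Generic S) {l : ℕ} (P : MvPolynomial (Fin l) ℂ)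
    {t : Fin l → L} (ht : Function.Injective t) (htS : ∀ i, t i ∈ S) :
    RatFn.evalAt (algebraMap _ (RatFn l) P * hypWeight z lam l) t =
      MvPolynomial.aeval t P * weightVal z lam t := by
  rw [hypWeight_eq, ← mul_div_assoc, ← map_mul, RatFn.evalAt_eq, map_mul, map_mul, aeval_poleDen,
    aeval_weightNum, aeval_weightDen, weightVal, omegaFactor, Finset.prod_div_distrib,
    Finset.prod_inv_distrib]
  · rw [mul_div_assoc, ← div_div, div_eq_mul_inv _ (∏ b, aeval (t b) (denPoly z lam))]
    ring
  · rw [map_mul, aeval_poleDen, aeval_weightDen]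
    refine mul_ne_zero (Finset.prod_ne_zero_iff.2 fun b _ => hS.aeval_rootPoly_ne (htS b) _)
      (Finset.prod_ne_zero_iff.2 fun p hp => hS.add_one_ne (htS _) (htS _)
        (ht.ne (Finset.mem_filter.1 hp).2.ne))

end Values

/-! ### The given formulas for the action in closed form -/

section Formulas

open Polynomial (aeval)

variable {n : ℕ} (z lam : Fin n → ℂ) {L : Type} [Field L] [Algebra ℂ L]

theorem weightVal_snoc [DecidableEq L] {l : ℕ} {s : Fin l → L} (hs : Function.Injective s) (x : L) :
    weightVal z lam (Fin.snoc s x : Fin (l + 1) → L) =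
      weightVal z lam s * (aeval x (denPoly z lam))⁻¹ *
        (ratioProd 1 x (Finset.univ.image s))⁻¹ := by
  rw [weightVal, weightVal, omegaFactor_snoc, prod_right x hs, Fin.prod_univ_castSucc]
  simp only [Fin.snoc_castSucc, Fin.snoc_last]
  ring

theorem weightVal_cons [DecidableEq L] {l : ℕ} {s : Fin l → L} (hs : Function.Injective s) (x : L) :
    weightVal z lam (Fin.cons x s : Fin (l + 1) → L) =
      weightVal z lam s * (aeval x (denPoly z lam))⁻¹ *
        (ratioProd (-1) x (Finset.univ.image s))⁻¹ := by
  rw [weightVal, weightVal, omegaFactor_cons, prod_left x hs, Fin.prod_univ_succ]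
  simp only [Fin.cons_zero, Fin.cons_succ]
  ring

/-- The poles enter symmetrically, so the weight changes under a permutation exactly as `ω` does.
Consequently a bracket is an ordinary permutation of arguments after division by the weight. -/
theorem weightVal_comp_perm {l : ℕ} (t : Fin l → L) (σ : Equiv.Perm (Fin l)) :
    weightVal z lam (t ∘ σ) * omegaFactor t = weightVal z lam t * omegaFactor (t ∘ σ) := by
  rw [weightVal, weightVal, ← Equiv.prod_comp σ fun b => (aeval (t b) (denPoly z lam))⁻¹]
  simp only [Function.comp_apply]
  ring

theorem weightVal_ne {S : Finset L} (hS : Generic S) {l : ℕ} {t : Fin l → L}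
    (ht : Function.Injective t) (htS : ∀ i, t i ∈ S) : weightVal z lam t ≠ 0 :=
  mul_ne_zero (Finset.prod_ne_zero_iff.2 fun b _ => inv_ne_zero (hS.aeval_rootPoly_ne (htS b) _))
    (hS.omegaFactor_ne ht htS)

/-- The factor in the definition of `bracket`. -/
theorem bracket_eq {S : Finset L} (hS : Generic S) {l : ℕ} {t : Fin l → L}
    (ht : Function.Injective t) (htS : ∀ i, t i ∈ S) (σ : Equiv.Perm (Fin l))
    (G : (Fin l → L) → L) :
    bracket σ G t = weightVal z lam t * (G (t ∘ σ) / weightVal z lam (t ∘ σ)) := by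
  have h1 := weightVal_ne z lam hS (ht.comp σ.injective) fun i => htS (σ i)
  have h2 := hS.omegaFactor_ne (ht.comp σ.injective) fun i => htS (σ i)
  have h3 := weightVal_comp_perm z lam t σ
  rw [bracket]
  field_simp
  rw [mul_assoc, mul_comm (omegaFactor t), h3]
  ring

theorem prod_eq_ratioProd_one {L : Type} [Field L] [DecidableEq L] {l : ℕ} {t : Fin l → L} (ht : Function.Injective t)
    (u : L) : ∏ a, (u - t a - 1) / (u - t a) = ratioProd 1 u (Finset.univ.image t) :=
  (ratioProd_image 1 u ht).symm

theorem prod_eq_ratioProd_neg_one {L : Type} [Field L] [DecidableEq L] {l : ℕ} {t : Fin l → L}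
    (ht : Function.Injective t) (u : L) :
    ∏ a, (u - t a + 1) / (u - t a) = ratioProd (-1) u (Finset.univ.image t) := by
  rw [ratioProd_image (-1) u ht]
  exact Finset.prod_congr rfl fun a _ => by rw [sub_neg_eq_add]

theorem sum_eq_sum_image {L : Type} [Field L] [DecidableEq L] {l : ℕ} {t : Fin l → L} (ht : Function.Injective t)
    (G : L → L) : ∑ a, G (t a) = ∑ x ∈ Finset.univ.image t, G x :=
  (Finset.sum_image fun _ _ _ _ h => ht h).symm

theorem sum_pairs_eq {L : Type} [Field L] [DecidableEq L] {l : ℕ} {t : Fin l → L} (ht : Function.Injective t)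
    (G : L → L → L) : ∑ p : Fin l × Fin l with p.1 ≠ p.2, G (t p.1) (t p.2) =
      ∑ x ∈ Finset.univ.image t, ∑ y ∈ (Finset.univ.image t).erase x, G x y := by
  rw [Finset.sum_image fun _ _ _ _ h => ht h,
    Finset.sum_finset_product' (f := fun a b => G (t a) (t b)) _ Finset.univ
      fun a => Finset.univ.erase a]
  · refine Finset.sum_congr rfl fun a _ => ?_
    rw [← Finset.image_erase ht, Finset.sum_image fun _ _ _ _ h => ht h]
  · intro p
    simp only [Finset.mem_filter, Finset.mem_univ, true_and, Finset.mem_erase, and_true]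
    exact ne_comm

variable {l : ℕ} {P : MvPolynomial (Fin l) ℂ} {u : L}

/-- The product over the points in the formula cancels the cross factors of the weight at the
appended last point `u`; symmetry then moves `u` to the first place. -/
theorem tilde21_eq [DecidableEq L] {P : MvPolynomial (Fin (l + 1)) ℂ} (hP : P.IsSymmetric)
    {t : Fin l → L} (ht : Function.Injective t) (hu : u ∉ Finset.univ.image t)
    (hS : Generic (insert u (Finset.univ.image t))) :
    tilde21 (algebraMap _ (RatFn (l + 1)) P * hypWeight z lam (l + 1)) u t =
      weightVal z lam t / aeval u (denPoly z lam) *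
        MvPolynomial.aeval (Fin.cons u t : Fin (l + 1) → L) P := by
  have htu : ∀ i, t i ≠ u := fun i e => hu (Finset.mem_image.2 ⟨i, Finset.mem_univ _, e⟩)
  have hc := cons_injective ht htu
  have hsn : Function.Injective (Fin.snoc t u : Fin (l + 1) → L) :=
    Fin.snoc_injective_iff.2 ⟨ht, fun ⟨i, hi⟩ => htu i hi⟩
  have hmem : ∀ i, (Fin.snoc t u : Fin (l + 1) → L) i ∈ insert u (Finset.univ.image t) := by
    intro i
    rw [← image_snoc]
    exact Finset.mem_image_of_mem _ (Finset.mem_univ _)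
  have hR := hS.ratioProd_ne (Finset.subset_insert _ _) (Finset.mem_insert_self _ _) hu
    (Or.inl rfl : (1 : L) = 1 ∨ (1 : L) = -1)
  rw [tilde21, evalAt_hyp z lam hS P hsn hmem, weightVal_snoc z lam ht, prod_eq_ratioProd_one ht,
    ← finsetVal_image hP hc, ← finsetVal_image hP hsn, image_cons, image_snoc]
  field_simp

/-- Each bracket moves the point to be replaced to the last place. The quotient of the weights with
`u` and with that point in the last place produces the summand of `diagSum`. -/
theorem tilde11_eq [DecidableEq L] (hP : P.IsSymmetric)
    {t : Fin l → L} (ht : Function.Injective t) (hu : u ∉ Finset.univ.image t)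
    (hS : Generic (insert u (Finset.univ.image t))) :
    tilde11 z lam (algebraMap _ (RatFn l) P * hypWeight z lam l) u t =
      weightVal z lam t / aeval u (denPoly z lam) *
        diagSum 1 (fun x => aeval x (numPoly z lam)) (finsetVal P) u (Finset.univ.image t) := by
  have hmem : ∀ i, t i ∈ insert u (Finset.univ.image t) := fun i =>
    Finset.mem_insert_of_mem (Finset.mem_image_of_mem _ (Finset.mem_univ _))
  have hpu : aeval u (denPoly z lam) ≠ 0 := hS.aeval_rootPoly_ne (Finset.mem_insert_self _ _) _
  rw [tilde11, evalAt_hyp z lam hS P ht hmem, prod_eq_ratioProd_one ht, highestWeight_eq, diagSum,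
    mul_add, finsetVal_image hP ht]
  congr 1
  · field_simp
  rw [← sum_eq_sum_image ht, Finset.mul_sum, Finset.mul_sum]
  refine Finset.sum_congr rfl fun a _ => ?_
  rw [bracket_eq z lam hS ht hmem]
  cases l with
  | zero => exact a.elim0
  | succ l =>
    set σ := Equiv.swap a (lastIdx a) with hσ
    have hl : lastIdx a = Fin.last l := rfl
    have hx : (t ∘ σ) (Fin.last l) = t a := by
      rw [Function.comp_apply, hσ, hl, Equiv.swap_apply_right]
    have hinj : Function.Injective (t ∘ σ) := ht.comp σ.injective
    obtain ⟨s, x, hsx⟩ : ∃ (s : Fin l → L) (x : L), t ∘ σ = Fin.snoc s x :=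
      ⟨_, _, (Fin.snoc_init_self _).symm⟩
    rw [hl]
    rw [hsx] at hinj hx ⊢
    have him : Finset.univ.image t = insert x (Finset.univ.image s) := by
      rw [← image_comp_perm t σ, hsx, image_snoc]
    have hsx' := Fin.snoc_injective_iff.1 hinj
    have hxs : x ∉ Finset.univ.image s := fun hh => hsx'.2 (by simpa using hh)
    rw [Fin.snoc_last] at hx ⊢
    rw [Fin.update_snoc_last, ← hx, him, Finset.erase_insert hxs, ratioProd_insert hxs,
      weightVal_snoc z lam hsx'.1]
    rw [him] at hS hu
    rw [Finset.mem_insert, not_or] at hu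
    have hsn : Function.Injective (Fin.snoc s u : Fin (l + 1) → L) :=
      Fin.snoc_injective_iff.2 ⟨hsx'.1, fun hh => hu.2 (by simpa using hh)⟩
    have hsub : insert u (Finset.univ.image s) ⊆ insert u (insert x (Finset.univ.image s)) :=
      Finset.insert_subset_insert _ (Finset.subset_insert _ _)
    have hS' := hS.mono hsub
    have hmu : u ∈ insert u (insert x (Finset.univ.image s)) := Finset.mem_insert_self _ _
    have hmx : x ∈ insert u (insert x (Finset.univ.image s)) :=
      Finset.mem_insert_of_mem (Finset.mem_insert_self _ _)
    have hms : Finset.univ.image s ⊆ insert u (insert x (Finset.univ.image s)) :=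
      (Finset.subset_insert _ _).trans (Finset.subset_insert _ _)
    rw [evalAt_hyp z lam hS' P hsn, ← finsetVal_image hP hsn, image_snoc,
      weightVal_snoc z lam hsx'.1, highestWeight_eq]
    · have h1 := hS.ratioProd_ne hms hmu hu.2 (Or.inl rfl : (1 : L) = 1 ∨ (1 : L) = -1)
      have h2 := hS.ratioProd_ne hms hmx hxs (Or.inl rfl : (1 : L) = 1 ∨ (1 : L) = -1)
      have h3 : u - x ≠ 0 := sub_ne_zero.2 hu.1
      have h4 := hS.sub_one_ne hmu hmx hu.1
      have h5 : aeval x (denPoly z lam) ≠ 0 := hS.aeval_rootPoly_ne hmx _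
      have h6 := weightVal_ne z lam hS hsx'.1 fun i =>
        hms (Finset.mem_image_of_mem _ (Finset.mem_univ i))
      field_simp
    · intro i
      rw [← image_snoc]
      exact Finset.mem_image_of_mem _ (Finset.mem_univ _)

theorem tilde22_eq [DecidableEq L] (hP : P.IsSymmetric)
    {t : Fin l → L} (ht : Function.Injective t) (hu : u ∉ Finset.univ.image t)
    (hS : Generic (insert u (Finset.univ.image t))) :
    tilde22 (algebraMap _ (RatFn l) P * hypWeight z lam l) u t =
      weightVal z lam t / aeval u (denPoly z lam) *
        diagSum (-1) (fun x => aeval x (denPoly z lam)) (finsetVal P) u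
          (Finset.univ.image t) := by
  have hmem : ∀ i, t i ∈ insert u (Finset.univ.image t) := fun i =>
    Finset.mem_insert_of_mem (Finset.mem_image_of_mem _ (Finset.mem_univ _))
  have hpu : aeval u (denPoly z lam) ≠ 0 := hS.aeval_rootPoly_ne (Finset.mem_insert_self _ _) _
  rw [tilde22, evalAt_hyp z lam hS P ht hmem, prod_eq_ratioProd_neg_one ht, diagSum,
    mul_add, finsetVal_image hP ht, sub_eq_add_neg]
  congr 1
  · field_simp
  rw [← sum_eq_sum_image ht, Finset.mul_sum, Finset.mul_sum, ← Finset.sum_neg_distrib]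
  refine Finset.sum_congr rfl fun a _ => ?_
  rw [bracket_eq z lam hS ht hmem]
  cases l with
  | zero => exact a.elim0
  | succ l =>
    -- Here the replaced point goes to the first place, whence the products with `ε = -1`.
    set σ := Equiv.swap (firstIdx a) a with hσ
    have hl : firstIdx a = 0 := rfl
    have hx : (t ∘ σ) 0 = t a := by
      rw [Function.comp_apply, hσ, hl, Equiv.swap_apply_left]
    have hinj : Function.Injective (t ∘ σ) := ht.comp σ.injective
    obtain ⟨s, x, hsx⟩ : ∃ (s : Fin l → L) (x : L), t ∘ σ = Fin.cons x s :=
      ⟨_, _, (Fin.cons_self_tail _).symm⟩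
    rw [hl]
    rw [hsx] at hinj hx ⊢
    have him : Finset.univ.image t = insert x (Finset.univ.image s) := by
      rw [← image_comp_perm t σ, hsx, image_cons]
    have hsx' := Fin.cons_injective_iff.1 hinj
    have hxs : x ∉ Finset.univ.image s := fun hh => hsx'.1 (by simpa using hh)
    rw [Fin.cons_zero] at hx ⊢
    rw [Fin.update_cons_zero, ← hx, him, Finset.erase_insert hxs, ratioProd_insert hxs,
      weightVal_cons z lam hsx'.2]
    rw [him] at hS hu
    rw [Finset.mem_insert, not_or] at hu
    have hsn : Function.Injective (Fin.cons u s : Fin (l + 1) → L) :=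
      Fin.cons_injective_iff.2 ⟨fun hh => hu.2 (by simpa using hh), hsx'.2⟩
    have hsub : insert u (Finset.univ.image s) ⊆ insert u (insert x (Finset.univ.image s)) :=
      Finset.insert_subset_insert _ (Finset.subset_insert _ _)
    have hS' := hS.mono hsub
    have hmu : u ∈ insert u (insert x (Finset.univ.image s)) := Finset.mem_insert_self _ _
    have hmx : x ∈ insert u (insert x (Finset.univ.image s)) :=
      Finset.mem_insert_of_mem (Finset.mem_insert_self _ _)
    have hms : Finset.univ.image s ⊆ insert u (insert x (Finset.univ.image s)) :=
      (Finset.subset_insert _ _).trans (Finset.subset_insert _ _)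
    rw [evalAt_hyp z lam hS' P hsn, ← finsetVal_image hP hsn, image_cons,
      weightVal_cons z lam hsx'.2]
    · have h1 := hS.ratioProd_ne hms hmu hu.2 (Or.inr rfl : (-1 : L) = 1 ∨ (-1 : L) = -1)
      have h2 := hS.ratioProd_ne hms hmx hxs (Or.inr rfl : (-1 : L) = 1 ∨ (-1 : L) = -1)
      have h3 : u - x ≠ 0 := sub_ne_zero.2 hu.1
      have h4 := hS.add_one_ne hmu hmx hu.1
      have h5 : aeval x (denPoly z lam) ≠ 0 := hS.aeval_rootPoly_ne hmx _
      have h6 := weightVal_ne z lam hS hsx'.2 fun i =>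
        hms (Finset.mem_image_of_mem _ (Finset.mem_univ i))
      rw [sub_neg_eq_add]
      field_simp
    · intro i
      rw [← image_cons]
      exact Finset.mem_image_of_mem _ (Finset.mem_univ _)

/-- The single brackets give the terms that remove one point, and the brackets over pairs give those
that remove two and insert `u`. Only the images of the first and last index under `pairPerm` matter.
-/
theorem tilde12_eq [DecidableEq L] (hP : P.IsSymmetric)
    {t : Fin (l + 1) → L} (ht : Function.Injective t) (hu : u ∉ Finset.univ.image t)
    (hS : Generic (insert u (Finset.univ.image t))) :
    tilde12 z lam (algebraMap _ (RatFn l) P * hypWeight z lam l) u t =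
      weightVal z lam t / aeval u (denPoly z lam) *
        raiseSum (fun x => aeval x (numPoly z lam)) (fun x => aeval x (denPoly z lam))
          (finsetVal P) u (Finset.univ.image t) := by
  have hmem : ∀ i, t i ∈ insert u (Finset.univ.image t) := fun i =>
    Finset.mem_insert_of_mem (Finset.mem_image_of_mem _ (Finset.mem_univ _))
  have hpu : aeval u (denPoly z lam) ≠ 0 := hS.aeval_rootPoly_ne (Finset.mem_insert_self _ _) _
  rw [tilde12, prod_eq_ratioProd_neg_one ht, raiseSum, mul_sub]
  congr 1
  · rw [← sum_eq_sum_image ht, Finset.mul_sum]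
    refine Finset.sum_congr rfl fun a _ => ?_
    rw [bracket_eq z lam hS ht hmem]
    set σ := Equiv.swap 0 a with hσ
    have hx : (t ∘ σ) 0 = t a := by
      rw [Function.comp_apply, hσ, Equiv.swap_apply_left]
    have hinj : Function.Injective (t ∘ σ) := ht.comp σ.injective
    obtain ⟨s, x, hsx⟩ : ∃ (s : Fin l → L) (x : L), t ∘ σ = Fin.cons x s :=
      ⟨_, _, (Fin.cons_self_tail _).symm⟩
    rw [hsx] at hinj hx ⊢
    have him : Finset.univ.image t = insert x (Finset.univ.image s) := by
      rw [← image_comp_perm t σ, hsx, image_cons]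
    have hsx' := Fin.cons_injective_iff.1 hinj
    have hxs : x ∉ Finset.univ.image s := fun hh => hsx'.1 (by simpa using hh)
    simp only [Fin.cons_zero, Fin.cons_succ] at hx ⊢
    rw [← hx, him, Finset.erase_insert hxs, weightVal_cons z lam hsx'.2]
    rw [him] at hS hu
    rw [Finset.mem_insert, not_or] at hu
    have hmu : u ∈ insert u (insert x (Finset.univ.image s)) := Finset.mem_insert_self _ _
    have hmx : x ∈ insert u (insert x (Finset.univ.image s)) :=
      Finset.mem_insert_of_mem (Finset.mem_insert_self _ _)
    have hms : Finset.univ.image s ⊆ insert u (insert x (Finset.univ.image s)) :=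
      (Finset.subset_insert _ _).trans (Finset.subset_insert _ _)
    have hsS := fun i => hms (Finset.mem_image_of_mem s (Finset.mem_univ i))
    have hR : ∏ c, (x - s c - 1) / (x - s c + 1) =
        ratioProd 1 x (Finset.univ.image s) / ratioProd (-1) x (Finset.univ.image s) := by
      rw [ratioProd_image _ _ hsx'.2, ratioProd_image _ _ hsx'.2, ← Finset.prod_div_distrib]
      refine Finset.prod_congr rfl fun i _ => ?_
      have : x - s i ≠ 0 :=
        sub_ne_zero.2 fun e => hxs (e ▸ Finset.mem_image_of_mem _ (Finset.mem_univ _))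
      rw [div_div_div_cancel_right₀ this, sub_neg_eq_add]
    rw [evalAt_hyp z lam hS P hsx'.2 hsS, ← finsetVal_image hP hsx'.2, highestWeight_eq,
      highestWeight_eq, Finset.prod_mul_distrib, prod_eq_ratioProd_one hsx'.2,
      prod_eq_ratioProd_neg_one hsx'.2, hR]
    have h2 := hS.ratioProd_ne hms hmx hxs (Or.inr rfl : (-1 : L) = 1 ∨ (-1 : L) = -1)
    have h3 : u - x ≠ 0 := sub_ne_zero.2 hu.1
    have h5 : aeval x (denPoly z lam) ≠ 0 := hS.aeval_rootPoly_ne hmx _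
    have h6 := weightVal_ne z lam hS hsx'.2 hsS
    field_simp
  · rw [← sum_pairs_eq ht, Finset.mul_sum, Finset.mul_sum]
    refine Finset.sum_congr rfl fun ab hab => ?_
    obtain ⟨a, b⟩ := ab
    have hab : a ≠ b := (Finset.mem_filter.1 hab).2
    change ratioProd (-1) u (Finset.univ.image t) * bracket (pairPerm a b) _ t = _
    rw [bracket_eq z lam hS ht hmem]
    cases l with
    | zero => exact absurd (Fin.ext (by omega)) hab
    | succ l =>
      set σ := pairPerm a b with hσ
      have hx : (t ∘ σ) 0 = t a := by
        rw [Function.comp_apply, hσ, pairPerm_first a b hab]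
      have hy : (t ∘ σ) (Fin.last _) = t b := by
        rw [Function.comp_apply, hσ, pairPerm_last a b hab]
      have hinj : Function.Injective (t ∘ σ) := ht.comp σ.injective
      obtain ⟨s, x, y, hsx⟩ : ∃ (s : Fin l → L) (x y : L),
          t ∘ σ = Fin.cons x (Fin.snoc s y : Fin (l + 1) → L) :=
        ⟨_, _, _, by rw [Fin.snoc_init_self, Fin.cons_self_tail]⟩
      rw [hsx] at hinj hx hy ⊢
      have him : Finset.univ.image t = insert x (insert y (Finset.univ.image s)) := by
        rw [← image_comp_perm t σ, hsx, image_cons, image_snoc]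
      have hsx' := Fin.cons_injective_iff.1 hinj
      have hsy' := Fin.snoc_injective_iff.1 hsx'.2
      have hxs : x ∉ insert y (Finset.univ.image s) := fun hh => hsx'.1 (by
        rw [← image_snoc] at hh
        obtain ⟨i, _, hi⟩ := Finset.mem_image.1 hh
        exact ⟨i, hi⟩)
      have hys : y ∉ Finset.univ.image s := fun hh => hsy'.2 (by simpa using hh)
      have hlast : (Fin.cons x (Fin.snoc s y : Fin (l + 1) → L) : Fin (l + 2) → L)
          (Fin.last (l + 1)) = y := by
        rw [← Fin.succ_last, Fin.cons_succ, Fin.snoc_last]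
      -- The first point has become `u` and the last one is dropped, so the argument of the function
      -- is `u` followed by the points other than `x` and `y`.
      have hmid : (fun i : Fin (l + 1) => if (i : ℕ) = 0 then u else
          (Fin.cons x (Fin.snoc s y : Fin (l + 1) → L) : Fin (l + 2) → L) i.castSucc) =
          Fin.cons u s := by
        funext i
        refine Fin.cases ?_ (fun i => ?_) i
        · simp
        · rw [if_neg (by simp), Fin.castSucc_succ, Fin.cons_succ, Fin.snoc_castSucc,
            Fin.cons_succ]
      rw [hlast] at hy
      simp only [Fin.cons_zero] at hx ⊢
      rw [hlast, hmid, ← hx, ← hy, him, Finset.erase_insert hxs, Finset.erase_insert hys,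
        weightVal_cons z lam hsx'.2, weightVal_snoc z lam hsy'.1, image_snoc, ratioProd_insert hxs,
        ratioProd_insert hys, ratioProd_insert hys]
      rw [him] at hS hu
      rw [Finset.mem_insert, Finset.mem_insert, not_or, not_or] at hu
      rw [Finset.mem_insert, not_or] at hxs
      have hmu : u ∈ insert u (insert x (insert y (Finset.univ.image s))) :=
        Finset.mem_insert_self _ _
      have hmx : x ∈ insert u (insert x (insert y (Finset.univ.image s))) :=
        Finset.mem_insert_of_mem (Finset.mem_insert_self _ _)
      have hmy : y ∈ insert u (insert x (insert y (Finset.univ.image s))) :=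
        Finset.mem_insert_of_mem (Finset.mem_insert_of_mem (Finset.mem_insert_self _ _))
      have hms : Finset.univ.image s ⊆ insert u (insert x (insert y (Finset.univ.image s))) :=
        ((Finset.subset_insert _ _).trans (Finset.subset_insert _ _)).trans
          (Finset.subset_insert _ _)
      have hsS := fun i => hms (Finset.mem_image_of_mem s (Finset.mem_univ i))
      have hsn : Function.Injective (Fin.cons u s : Fin (l + 1) → L) :=
        Fin.cons_injective_iff.2 ⟨fun hh => hu.2.2 (by simpa using hh), hsy'.1⟩
      rw [evalAt_hyp z lam hS P hsn (Fin.cases hmu hsS), ← finsetVal_image hP hsn, image_cons,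
        weightVal_cons z lam hsy'.1, highestWeight_eq]
      have h1 := hS.ratioProd_ne hms hmu hu.2.2 (Or.inr rfl : (-1 : L) = 1 ∨ (-1 : L) = -1)
      have h2 := hS.ratioProd_ne hms hmx hxs.2 (Or.inr rfl : (-1 : L) = 1 ∨ (-1 : L) = -1)
      have h2' := hS.ratioProd_ne hms hmy hys (Or.inl rfl : (1 : L) = 1 ∨ (1 : L) = -1)
      have h3 : u - x ≠ 0 := sub_ne_zero.2 hu.1
      have h3' : u - y ≠ 0 := sub_ne_zero.2 hu.2.1
      have h3'' : x - y ≠ 0 := sub_ne_zero.2 hxs.1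
      have h4 := hS.add_one_ne hmu hmx hu.1
      have h4' := hS.add_one_ne hmu hmy hu.2.1
      have h4'' := hS.add_one_ne hmx hmy hxs.1
      have h5 : aeval x (denPoly z lam) ≠ 0 := hS.aeval_rootPoly_ne hmx _
      have h5' : aeval y (denPoly z lam) ≠ 0 := hS.aeval_rootPoly_ne hmy _
      have h6 := weightVal_ne z lam hS hsy'.1 hsS
      simp only [sub_neg_eq_add]
      field_simp

end Formulas

/-! ### Extraction of coefficients at infinity -/

section Coefficients

open Polynomial (aeval)

variable {n : ℕ} (z lam : Fin n → ℂ) {K L : Type} [Field K] [Algebra ℂ K] [Field L] [Algebra ℂ L]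

theorem weightVal_map (φ : K →+* L) (hφ : ∀ c, algebraMap ℂ L c = φ (algebraMap ℂ K c)) {l : ℕ}
    (t : Fin l → K) : weightVal z lam (fun i => φ (t i)) = φ (weightVal z lam t) := by
  simp only [weightVal, denPoly, aeval_rootPoly, omegaFactor, map_mul, map_prod, map_inv₀, map_sub,
    map_div₀, map_add, map_one, hφ]

/-- The factor `∏_a (u - z_a - λ_a) / u`. -/
def denFactor (u : L) : L :=
  ∏ a : Fin n, (u - algebraMap ℂ L (z a) - algebraMap ℂ L (lam a)) / u

theorem denFactor_eq (u : L) : denFactor z lam u = aeval u (denPoly z lam) / u ^ n := by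
  rw [denFactor, Finset.prod_div_distrib, denPoly, aeval_rootPoly]
  congr 1
  · exact Finset.prod_congr rfl fun a _ => by rw [map_add]; ring
  · simp

/-- The generating function with coefficients given by the polynomials `Q j`. -/
def genVal {l : ℕ} (t : Fin l → L) (u : L) (Q : ℕ → MvPolynomial (Fin l) ℂ) : L :=
  weightVal z lam t / aeval u (denPoly z lam) *
    ∑ j ∈ Finset.range (n + 1), u ^ j * MvPolynomial.aeval t (Q j)

theorem aeval_map (φ : K →+* L) (hφ : ∀ c, algebraMap ℂ L c = φ (algebraMap ℂ K c)) {l : ℕ}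
    (t : Fin l → K) (P : MvPolynomial (Fin l) ℂ) :
    MvPolynomial.aeval (fun i => φ (t i)) P = φ (MvPolynomial.aeval t P) := by
  induction P using MvPolynomial.induction_on with
  | C a => rw [MvPolynomial.aeval_C, MvPolynomial.aeval_C, hφ]
  | add p q hp hq => rw [map_add, map_add, map_add, hp, hq]
  | mul_X p i hp => rw [map_mul, map_mul, map_mul, hp, MvPolynomial.aeval_X, MvPolynomial.aeval_X]

/-- The passage from `T̃` to `T` cancels the denominator in `genVal` and divides by `u^n`. With `e =
u⁻¹`, a polynomial in `e` remains, and the coefficient of `e^s` comes from `j = n - s`. -/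
theorem coeff_genVal {φ : K →+* L} (hφ : ∀ c, algebraMap ℂ L c = φ (algebraMap ℂ K c)) {l : ℕ}
    (t : Fin l → K) (ψ : L →+ K) (s : ℕ) {u e : L} (hue : u * e = 1)
    (hψ : ∀ i c, ψ (e ^ i * φ c) = if i = s then c else 0) (Q : ℕ → MvPolynomial (Fin l) ℂ)
    (h0 : aeval u (denPoly z lam) ≠ 0) :
    ψ (genVal z lam (fun i => φ (t i)) u Q * denFactor z lam u) =
      MvPolynomial.aeval t (if s ≤ n then Q (n - s) else 0) * weightVal z lam t := by
  have hu : u ≠ 0 := left_ne_zero_of_mul_eq_one hue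
  have h1 : genVal z lam (fun i => φ (t i)) u Q * denFactor z lam u =
      ∑ j ∈ Finset.range (n + 1), e ^ (n - j) *
        φ (MvPolynomial.aeval t (Q j) * weightVal z lam t) := by
    rw [genVal, denFactor_eq, Finset.mul_sum, Finset.sum_mul]
    refine Finset.sum_congr rfl fun j hj => ?_
    have hj' : j ≤ n := Nat.lt_succ_iff.1 (Finset.mem_range.1 hj)
    have h2 : u ^ j = e ^ (n - j) * u ^ n := by
      rw [← Nat.sub_add_cancel hj', pow_add u, Nat.sub_add_cancel hj', ← mul_assoc, ← mul_pow,
        mul_comm e, hue, one_pow, one_mul]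
    rw [weightVal_map z lam φ hφ, aeval_map φ hφ, map_mul, h2]
    field_simp
  rw [h1, map_sum]
  simp only [hψ]
  split_ifs with hs
  · rw [Finset.sum_eq_single (n - s), if_pos (by omega)]
    · exact fun j hj hjs => if_neg (by have := Finset.mem_range.1 hj; omega)
    · exact fun h => absurd (Finset.mem_range.2 (by omega)) h
  · rw [map_zero, zero_mul]
    exact Finset.sum_eq_zero fun j _ => if_neg (by omega)

variable {l : ℕ} {P : MvPolynomial (Fin l) ℂ} {u : L} [DecidableEq L]

theorem tilde11_eq_sum (hP : P.IsSymmetric) (hd : DegLT n P)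
    {t : Fin l → L} (ht : Function.Injective t) (hu : u ∉ Finset.univ.image t)
    (hS : Generic (insert u (Finset.univ.image t))) :
    tilde11 z lam (algebraMap _ (RatFn l) P * hypWeight z lam l) u t =
      genVal z lam t u fun j => diagOp n 1 (numPoly z lam) l j P := by
  rw [genVal, tilde11_eq z lam hP ht hu hS, sum_aeval_diagOp (numPoly_le z lam) hP hd ht hu, map_one]

theorem tilde22_eq_sum (hP : P.IsSymmetric) (hd : DegLT n P)
    {t : Fin l → L} (ht : Function.Injective t) (hu : u ∉ Finset.univ.image t)
    (hS : Generic (insert u (Finset.univ.image t))) :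
    tilde22 (algebraMap _ (RatFn l) P * hypWeight z lam l) u t =
      genVal z lam t u fun j => diagOp n (-1) (denPoly z lam) l j P := by
  rw [genVal, tilde22_eq z lam hP ht hu hS, sum_aeval_diagOp (denPoly_le z lam) hP hd ht hu, map_neg,
    map_one]

theorem tilde12_eq_sum (hn : 0 < n) (hP : P.IsSymmetric) (hd : DegLT n P)
    {t : Fin (l + 1) → L} (ht : Function.Injective t) (hu : u ∉ Finset.univ.image t)
    (hS : Generic (insert u (Finset.univ.image t))) :
    tilde12 z lam (algebraMap _ (RatFn l) P * hypWeight z lam l) u t =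
      genVal z lam t u fun j => raiseOp n (numPoly z lam) (denPoly z lam) l j P := by
  rw [genVal, tilde12_eq z lam hP ht hu hS,
    sum_aeval_raiseOp hn (numPoly_le z lam) (denPoly_le z lam) hP hd ht hu]

theorem tilde21_eq_sum {P : MvPolynomial (Fin (l + 1)) ℂ} (hP : P.IsSymmetric) (hd : DegLT n P)
    {t : Fin l → L} (ht : Function.Injective t) (hu : u ∉ Finset.univ.image t)
    (hS : Generic (insert u (Finset.univ.image t))) :
    tilde21 (algebraMap _ (RatFn (l + 1)) P * hypWeight z lam (l + 1)) u t =
      genVal z lam t u fun j => headCoeff j P := by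
  rw [genVal, tilde21_eq z lam hP ht hu hS, aeval_cons hd.succ]

end Coefficients

/-! ### Genericity of the Laurent point -/

section Series

open Polynomial (aeval)

variable {n : ℕ} (z lam : Fin n → ℂ) {l : ℕ}

theorem uVar_sub_C_ne_zero (f : RatFn l) : uVar l - HahnSeries.C f ≠ 0 := by
  intro h
  have := congrArg (fun x => HahnSeries.coeff x (-1 : ℤ)) h
  simp [uVar, HahnSeries.C_apply, HahnSeries.coeff_single_of_ne] at this

theorem varPoint_injective : Function.Injective (varPoint l) := by
  intro a b h
  by_contra hab
  have := RatFn.var_sub_var_add_ne hab 0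
  rw [map_zero, add_zero] at this
  exact this (sub_eq_zero.2 (HahnSeries.C_injective h))

theorem uVar_notMem [DecidableEq (SeriesAtInfinity l)] :
    uVar l ∉ Finset.univ.image (varPoint l) := by
  intro h
  obtain ⟨a, _, ha⟩ := Finset.mem_image.1 h
  exact uVar_sub_C_ne_zero (RatFn.var a) (sub_eq_zero.2 ha.symm)

/-- The variables are independent over the constants, and `u` has a nonzero coefficient in a degree
where constant series have none. Therefore the closed formulas apply to the point that defines the
action. -/
theorem generic_series [DecidableEq (SeriesAtInfinity l)] :
    Generic (insert (uVar l) (Finset.univ.image (varPoint l))) where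
  const x hx c := by
    rw [algebraMap_series]
    rcases Finset.mem_insert.1 hx with rfl | hx
    · exact uVar_sub_C_ne_zero _
    · obtain ⟨a, _, rfl⟩ := Finset.mem_image.1 hx
      rw [varPoint, ← map_sub]
      exact (map_ne_zero_iff _ HahnSeries.C_injective).2 (RatFn.var_ne_algebraMap a c)
  diff x hx y hy hxy c := by
    rw [algebraMap_series]
    rcases Finset.mem_insert.1 hx with rfl | hx
    · rcases Finset.mem_insert.1 hy with rfl | hy
      · exact absurd rfl hxy
      · obtain ⟨b, _, rfl⟩ := Finset.mem_image.1 hy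
        rw [varPoint, sub_add, ← map_sub]
        exact uVar_sub_C_ne_zero _
    · obtain ⟨a, _, rfl⟩ := Finset.mem_image.1 hx
      rcases Finset.mem_insert.1 hy with rfl | hy
      · rw [varPoint, sub_add_eq_add_sub, ← map_add, ← neg_sub]
        exact neg_ne_zero.2 (uVar_sub_C_ne_zero _)
      · obtain ⟨b, _, rfl⟩ := Finset.mem_image.1 hy
        rw [varPoint, varPoint, ← map_sub, ← map_add]
        exact (map_ne_zero_iff _ HahnSeries.C_injective).2
          (RatFn.var_sub_var_add_ne (fun e => hxy (congrArg _ e)) c)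

theorem aeval_var (P : MvPolynomial (Fin l) ℂ) :
    MvPolynomial.aeval (RatFn.var : Fin l → RatFn l) P = algebraMap _ (RatFn l) P := by
  induction P using MvPolynomial.induction_on with
  | C a =>
    rw [MvPolynomial.aeval_C,
      IsScalarTower.algebraMap_apply ℂ (MvPolynomial (Fin l) ℂ) (RatFn l)]
    rfl
  | add p q hp hq => rw [map_add, map_add, hp, hq]
  | mul_X p i hp => rw [map_mul, map_mul, hp, MvPolynomial.aeval_X, RatFn.var]

theorem weightVal_var : weightVal z lam (RatFn.var : Fin l → RatFn l) = hypWeight z lam l := by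
  rw [weightVal, hypWeight, Finset.prod_comm]
  congr 1
  refine Finset.prod_congr rfl fun b _ => ?_
  rw [denPoly, aeval_rootPoly, ← Finset.prod_inv_distrib]
  exact Finset.prod_congr rfl fun a _ => (one_div _).symm

/-- The coefficient of `u^{-s}`. -/
def seriesCoeff (l s : ℕ) : SeriesAtInfinity l →+ RatFn l where
  toFun x := HahnSeries.coeff x (s : ℤ)
  map_zero' := rfl
  map_add' _ _ := rfl

theorem seriesCoeff_pow_mul_C (s i : ℕ) (c : RatFn l) :
    seriesCoeff l s (HahnSeries.single (1 : ℤ) (1 : RatFn l) ^ i * HahnSeries.C c) =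
      if i = s then c else 0 := by
  change HahnSeries.coeff (HahnSeries.single (1 : ℤ) (1 : RatFn l) ^ i * HahnSeries.C c) (s : ℤ) = _
  rw [HahnSeries.single_pow, HahnSeries.C_apply, HahnSeries.single_mul_single,
    HahnSeries.coeff_single, one_pow, one_mul]
  congr 1
  rw [eq_iff_iff, nsmul_eq_mul]
  omega

theorem uVar_mul_single : uVar l * HahnSeries.single (1 : ℤ) (1 : RatFn l) = 1 := by
  rw [uVar, HahnSeries.single_mul_single]
  simp

theorem yangianCoeff_eq_seriesCoeff (G : SeriesAtInfinity l) (s : ℕ) :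
    yangianCoeff z lam G s = seriesCoeff l s (G * denFactor z lam (uVar l)) := rfl

theorem yangianCoeff_genVal (Q : ℕ → MvPolynomial (Fin l) ℂ) (s : ℕ) :
    yangianCoeff z lam (genVal z lam (varPoint l) (uVar l) Q) s =
      algebraMap _ (RatFn l) (if s ≤ n then Q (n - s) else 0) * hypWeight z lam l := by
  classical
  rw [yangianCoeff_eq_seriesCoeff, ← weightVal_var, ← aeval_var]
  exact coeff_genVal z lam (L := SeriesAtInfinity l) (φ := HahnSeries.C) (algebraMap_series l)
    RatFn.var (seriesCoeff l s) s uVar_mul_single (seriesCoeff_pow_mul_C s) Q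
    ((generic_series (l := l)).aeval_rootPoly_ne (Finset.mem_insert_self _ _) _)

end Series

/-! ### Verification of the formulas for the action -/

section Action

variable {n : ℕ} [NeZero n] (z lam : Fin n → ℂ)

open SymSpace

theorem hypRep_T_single (i j : Fin 2) (s l m : ℕ) {P : MvPolynomial (Fin l) ℂ}
    (hP : P.IsSymmetric) (hd : DegLT n P) (Q : ℕ → MvPolynomial (Fin m) ℂ)
    (hQ : ∀ a, (coeffT (numPoly_le z lam) (denPoly_le z lam) i j a (single l P hP hd)).1 m = Q a)
    (h0 : ∀ a, ∀ m' ≠ m,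
      (coeffT (numPoly_le z lam) (denPoly_le z lam) i j a (single l P hP hd)).1 m' = 0) :
    (hypRep z lam (Yangian.T i j s) (equivHyp z lam (single l P hP hd)) : ⨁ l, RatFn l) =
      DirectSum.lof ℂ ℕ RatFn m
      (algebraMap _ (RatFn m) (if s ≤ n then Q (n - s) else 0) * hypWeight z lam m) := by
  rw [hypRep_apply, symRep_T, yangianT]
  split_ifs with h
  · rw [equivHyp_eq_lof z lam _ m (h0 _), hQ]
  · rw [LinearMap.zero_apply, map_zero, map_zero, zero_mul, map_zero]
    rfl

theorem coeffT_00 {q p : Polynomial ℂ} (hq : q.natDegree ≤ n) (hp : p.natDegree ≤ n) :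
    coeffT hq hp 0 0 = diag 1 hq := rfl

theorem coeffT_01 {q p : Polynomial ℂ} (hq : q.natDegree ≤ n) (hp : p.natDegree ≤ n) :
    coeffT hq hp 0 1 = raise hq hp := rfl

theorem coeffT_10 {q p : Polynomial ℂ} (hq : q.natDegree ≤ n) (hp : p.natDegree ≤ n) :
    coeffT hq hp 1 0 = lower := rfl

theorem coeffT_11 {q p : Polynomial ℂ} (hq : q.natDegree ≤ n) (hp : p.natDegree ≤ n) :
    coeffT hq hp 1 1 = diag (-1) hp := rfl

theorem hypRep_act11 (s l : ℕ) (f : hypComponent z lam l) :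
    (hypRep z lam (Yangian.T 0 0 s) (hypSpace.homog f) : ⨁ l, RatFn l) =
      DirectSum.lof ℂ ℕ RatFn l (yangianCoeff z lam (tilde11 z lam (f : RatFn l) (uVar l) (varPoint l)) s) := by
  classical
  obtain ⟨P, hP, hd, hf, hf'⟩ := exists_homog_eq f
  have h := tilde11_eq_sum z lam hP hd varPoint_injective uVar_notMem generic_series
  rw [hf', hf, h, yangianCoeff_genVal]
  refine hypRep_T_single z lam 0 0 s l l hP hd (fun j => diagOp n 1 (numPoly z lam) l j P) (fun a => ?_) fun a m hm => ?_
  · rw [coeffT_00, diag_apply, single_same]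
  · rw [coeffT_00, diag_apply, single_of_ne _ _ hm, map_zero]

theorem hypRep_act22 (s l : ℕ) (f : hypComponent z lam l) :
    (hypRep z lam (Yangian.T 1 1 s) (hypSpace.homog f) : ⨁ l, RatFn l) =
      DirectSum.lof ℂ ℕ RatFn l (yangianCoeff z lam (tilde22 (f : RatFn l) (uVar l) (varPoint l)) s) := by
  classical
  obtain ⟨P, hP, hd, hf, hf'⟩ := exists_homog_eq f
  have h := tilde22_eq_sum z lam hP hd varPoint_injective uVar_notMem generic_series
  rw [hf', hf, h, yangianCoeff_genVal]
  refine hypRep_T_single z lam 1 1 s l l hP hd (fun j => diagOp n (-1) (denPoly z lam) l j P) (fun a => ?_) fun a m hm => ?_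
  · rw [coeffT_11, diag_apply, single_same]
  · rw [coeffT_11, diag_apply, single_of_ne _ _ hm, map_zero]

theorem hypRep_act12 (s l : ℕ) (f : hypComponent z lam l) :
    (hypRep z lam (Yangian.T 0 1 s) (hypSpace.homog f) : ⨁ l, RatFn l) =
      DirectSum.lof ℂ ℕ RatFn (l + 1) (yangianCoeff z lam (tilde12 z lam (f : RatFn l) (uVar (l + 1)) (varPoint (l + 1))) s) := by
  classical
  obtain ⟨P, hP, hd, hf, hf'⟩ := exists_homog_eq f
  have h := tilde12_eq_sum z lam (pos n) hP hd varPoint_injective uVar_notMem generic_series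
  rw [hf', hf, h, yangianCoeff_genVal]
  refine hypRep_T_single z lam 0 1 s l (l + 1) hP hd (fun j => raiseOp n (numPoly z lam) (denPoly z lam) l j P) (fun a => ?_) fun a m hm => ?_
  · rw [coeffT_01, raise_apply_succ, single_same]
  · cases m with
    | zero => rw [coeffT_01, raise_apply_zero]
    | succ m => rw [coeffT_01, raise_apply_succ, single_of_ne _ _ (by omega), map_zero]

theorem hypRep_act21 (s l : ℕ) (f : hypComponent z lam (l + 1)) :
    (hypRep z lam (Yangian.T 1 0 s) (hypSpace.homog f) : ⨁ l, RatFn l) =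
      DirectSum.lof ℂ ℕ RatFn l (yangianCoeff z lam (tilde21 (f : RatFn (l + 1)) (uVar l) (varPoint l)) s) := by
  classical
  obtain ⟨P, hP, hd, hf, hf'⟩ := exists_homog_eq f
  have h := tilde21_eq_sum z lam hP hd varPoint_injective uVar_notMem generic_series
  rw [hf', hf, h, yangianCoeff_genVal]
  refine hypRep_T_single z lam 1 0 s (l + 1) l hP hd (fun j => headCoeff j P) (fun a => ?_) fun a m hm => ?_
  · rw [coeffT_10, lower_apply, single_same]
  · rw [coeffT_10, lower_apply, single_of_ne _ _ (by omega), map_zero]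

theorem hypRep_act21_zero (s : ℕ) (f : hypComponent z lam 0) :
    hypRep z lam (Yangian.T 1 0 s) (hypSpace.homog f) = 0 := by
  obtain ⟨P, hP, hd, hf, hf'⟩ := exists_homog_eq f
  have h0 : ∀ a m, (coeffT (numPoly_le z lam) (denPoly_le z lam) 1 0 a
      (single 0 P hP hd)).1 m = 0 := fun a m => by
    rw [coeffT_10, lower_apply, single_of_ne _ _ (by omega), map_zero]
  have := hypRep_T_single z lam 1 0 s 0 0 hP hd (fun _ => 0) (fun a => h0 a 0) fun a m _ => h0 a m
  rw [hf']
  refine Subtype.ext (this.trans ?_)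
  rw [ite_self, map_zero, zero_mul, map_zero]
  rfl

theorem hypRep_isHypergeometricAction : IsHypergeometricAction z lam (hypRep z lam) where
  act11 := hypRep_act11 z lam
  act22 := hypRep_act22 z lam
  act12 := hypRep_act12 z lam
  act21 := hypRep_act21 z lam
  act21_zero := hypRep_act21_zero z lam

end Action

/-! ### Absorption of a fixed set of points -/

section Absorption

variable {L : Type} [Field L] [DecidableEq L]

theorem ratioProd_union {ε x : L} {R S : Finset L} (h : Disjoint R S) :
    ratioProd ε x (R ∪ S) = ratioProd ε x R * ratioProd ε x S :=
  Finset.prod_union h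

theorem union_erase_left {L : Type} [DecidableEq L] {R T : Finset L} {a : L} (h : Disjoint R T) (ha : a ∈ R) :
    (R ∪ T).erase a = R.erase a ∪ T := by
  rw [Finset.erase_union_distrib, Finset.erase_eq_of_notMem (Finset.disjoint_left.1 h ha)]

theorem union_erase_right {L : Type} [DecidableEq L] {R T : Finset L} {a : L} (h : Disjoint R T) (ha : a ∈ T) :
    (R ∪ T).erase a = R ∪ T.erase a := by
  rw [Finset.erase_union_distrib, Finset.erase_eq_of_notMem (Finset.disjoint_right.1 h ha)]

/-- The factors at `R` change `h` into `h'`, and `h0` kills the terms that would replace a point of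
`R`. The set `R` thus stays in every argument of `F`. -/
theorem diagSum_union {ε : L} {h h' : L → L} {F : Finset L → L} {u : L} {R T : Finset L}
    (hRT : Disjoint R T) (huR : u ∉ R) (hh : ∀ x ∉ R, h x * ratioProd ε x R = h' x)
    (h0 : ∀ a ∈ R, h a * ratioProd ε a (R.erase a) = 0) :
    diagSum ε h F u (R ∪ T) = diagSum ε h' (fun S => F (R ∪ S)) u T := by
  unfold diagSum
  rw [Finset.sum_union hRT, Finset.sum_eq_zero (s := R), zero_add]
  · congr 1
    · rw [← hh u huR, ratioProd_union hRT]
      ring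
    · refine Finset.sum_congr rfl fun a ha => ?_
      rw [union_erase_right hRT ha, ratioProd_union (hRT.mono_right (Finset.erase_subset _ _)),
        ← hh a (Finset.disjoint_right.1 hRT ha)]
      beta_reduce
      rw [Finset.union_insert]
      ring
  · intro a ha
    rw [union_erase_left hRT ha, ratioProd_union (hRT.mono_left (Finset.erase_subset _ _))]
    linear_combination (ε * F (insert u (R.erase a ∪ T)) / (u - a) * ratioProd ε a T) * h0 a ha

/-- As in the diagonal case, with the additional point that in the double sum either removed point
could lie in `R`; `hpR` and `hqR` exclude this. -/
theorem raiseSum_union {q p q' p' : L → L} {F : Finset L → L} {u : L} {R T : Finset L}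
    (hRT : Disjoint R T) (huR : u ∉ R) (hq : ∀ x ∉ R, q x * ratioProd 1 x R = q' x)
    (hp : ∀ x ∉ R, p x * ratioProd (-1) x R = p' x)
    (hq0 : ∀ a ∈ R, q a * ratioProd 1 a (R.erase a) = 0)
    (hp0 : ∀ a ∈ R, p a * ratioProd (-1) a (R.erase a) = 0) :
    raiseSum q p F u (R ∪ T) = raiseSum q' p' (fun S => F (R ∪ S)) u T := by
  have hq1 : ∀ a ∈ R, q a * ratioProd 1 a ((R ∪ T).erase a) = 0 := fun a ha => by
    rw [union_erase_left hRT ha, ratioProd_union (hRT.mono_left (Finset.erase_subset _ _)),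
      ← mul_assoc, hq0 a ha, zero_mul]
  have hp1 : ∀ a ∈ R, p a * ratioProd (-1) a ((R ∪ T).erase a) = 0 := fun a ha => by
    rw [union_erase_left hRT ha, ratioProd_union (hRT.mono_left (Finset.erase_subset _ _)),
      ← mul_assoc, hp0 a ha, zero_mul]
  -- The factor `(a - b + 1) / (a - b)` equals `(b - a - 1) / (b - a)`, the one lost when `a` is
  -- erased; it completes the vanishing product at `b`.
  have hqR : ∀ b ∈ R, ∀ a ∈ (R ∪ T).erase b,
      q b * ((a - b + 1) / (a - b)) * ratioProd 1 b (((R ∪ T).erase a).erase b) = 0 := by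
    intro b hb a ha
    have := hq1 b hb
    rw [ratioProd_erase ha, Finset.erase_right_comm] at this
    rw [mul_assoc, ← this, ← neg_div_neg_eq]
    congr 3 <;> ring
  have hpR : ∀ a ∈ R, ∀ b ∈ (R ∪ T).erase a,
      p a * ((a - b + 1) / (a - b)) * ratioProd (-1) a (((R ∪ T).erase a).erase b) = 0 := by
    intro a ha b hb
    have := hp1 a ha
    rwa [ratioProd_erase hb, sub_neg_eq_add, ← mul_assoc] at this
  unfold raiseSum
  congr 1
  · rw [Finset.sum_union hRT, Finset.sum_eq_zero (s := R), zero_add]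
    · refine Finset.sum_congr rfl fun a ha => ?_
      have haR := Finset.disjoint_right.1 hRT ha
      have hd : Disjoint R (T.erase a) := hRT.mono_right (Finset.erase_subset _ _)
      rw [union_erase_right hRT ha, ratioProd_union hd, ratioProd_union hd, ratioProd_union hd,
        ratioProd_union hd, ← hq a haR, ← hp a haR, ← hq u huR, ← hp u huR]
      ring
    · intro a ha
      linear_combination (F ((R ∪ T).erase a) / (u - a) * p u *
        ratioProd (-1) u ((R ∪ T).erase a)) * hq1 a ha - (F ((R ∪ T).erase a) / (u - a) * q u *
        ratioProd 1 u ((R ∪ T).erase a)) * hp1 a ha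
  · rw [Finset.sum_union hRT, Finset.sum_eq_zero (s := R), zero_add]
    · refine Finset.sum_congr rfl fun a ha => ?_
      have haR := Finset.disjoint_right.1 hRT ha
      have hd : Disjoint R (T.erase a) := hRT.mono_right (Finset.erase_subset _ _)
      rw [union_erase_right hRT ha, Finset.sum_union hd, Finset.sum_eq_zero (s := R), zero_add]
      · refine Finset.sum_congr rfl fun b hb => ?_
        have hbR := Finset.disjoint_right.1 hd hb
        have hd' : Disjoint R ((T.erase a).erase b) := hd.mono_right (Finset.erase_subset _ _)
        rw [union_erase_right hd hb, ratioProd_union hd', ratioProd_union hd', ← hq b hbR,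
          ← hp a haR]
        beta_reduce
        rw [Finset.union_insert]
        ring
      · intro b hb
        have := hqR b hb a (Finset.mem_erase.2 ⟨fun e => haR (e ▸ hb), Finset.mem_union_right _ ha⟩)
        rw [union_erase_right hRT ha] at this
        linear_combination (F (insert u ((R ∪ T.erase a).erase b)) * p a / ((u - a) * (u - b)) *
          ratioProd (-1) a ((R ∪ T.erase a).erase b)) * this
    · intro a ha
      refine Finset.sum_eq_zero fun b hb => ?_
      linear_combination (F (insert u (((R ∪ T).erase a).erase b)) * q b / ((u - a) * (u - b)) *
          ratioProd 1 b (((R ∪ T).erase a).erase b)) * hpR a ha b hb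

end Absorption

/-! ### Ladders and products of lowering operators -/

namespace SymSpace

open MvPolynomial

variable {n : ℕ} [NeZero n] {ε : ℂ} {h q p : Polynomial ℂ} {L : Type} [Field L] [Algebra ℂ L]

/-- The value at a finite set of points. -/
def val (v : SymSpace n) (S : Finset L) : L := finsetVal (v.1 S.card) S

theorem finsetVal_eq_val (v : SymSpace n) {l : ℕ} {S : Finset L} (hS : S.card = l) :
    finsetVal (v.1 l) S = val v S := by
  subst hS
  rfl

/-- The points `c, c - 1, …, c - k + 1`. -/
def ladderPt (L : Type) [Field L] [Algebra ℂ L] (c : ℂ) (k : ℕ) (i : Fin k) : L :=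
  algebraMap ℂ L (c - ((i : ℕ) : ℂ))

theorem ladderPt_injective (c : ℂ) (k : ℕ) : Function.Injective (ladderPt L c k) := by
  intro i j hij
  have := (algebraMap ℂ L).injective hij
  simpa [Fin.ext_iff] using this

theorem ladderPt_succ (c : ℂ) (k : ℕ) :
    ladderPt L c (k + 1) = Fin.snoc (ladderPt L c k) (algebraMap ℂ L (c - k)) := by
  funext i
  refine Fin.lastCases ?_ (fun i => ?_) i
  · rw [Fin.snoc_last, ladderPt, Fin.val_last]
  · rw [Fin.snoc_castSucc, ladderPt, ladderPt, Fin.val_castSucc]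

variable [DecidableEq L]

theorem val_image (v : SymSpace n) {l : ℕ} {s : Fin l → L} (hs : Function.Injective s) :
    val v (Finset.univ.image s) = aeval s (v.1 l) := by
  rw [← finsetVal_image (isSymmetric v l) hs]
  refine (finsetVal_eq_val v ?_).symm
  rw [Finset.card_image_of_injective _ hs, Finset.card_univ, Fintype.card_fin]

theorem val_lower (w : ℂ) (v : SymSpace n) {T : Finset L} (hw : algebraMap ℂ L w ∉ T) :
    val (genFun lower w v) T = val v (insert (algebraMap ℂ L w) T) := by
  obtain ⟨s, hs, hT⟩ := exists_eq_image T
  have hc := cons_injective (w := algebraMap ℂ L w) hs fun i e => hw (by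
    rw [← hT]
    exact Finset.mem_image.2 ⟨i, Finset.mem_univ _, e⟩)
  rw [← hT, val_image _ hs, aeval_lower, ← image_cons, val_image _ hc]

theorem sum_val_diag (hh : h.natDegree ≤ n) (v : SymSpace n) {u : L} {T : Finset L} (hu : u ∉ T) :
    ∑ j ∈ Finset.range (n + 1), u ^ j * val (diag ε hh j v) T =
      diagSum (algebraMap ℂ L ε) (fun x => Polynomial.aeval x h) (val v) u T := by
  obtain ⟨s, hs, hT⟩ := exists_eq_image T
  have hu' := hu
  rw [← hT] at hu'
  rw [← diagSum_congr hu (F := finsetVal (v.1 T.card)) fun S hS _ => finsetVal_eq_val v hS]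
  refine Eq.trans ?_ ((sum_aeval_diagOp (ε := ε) hh (isSymmetric v _) (degLT v _) hs hu').trans ?_)
  · refine Finset.sum_congr rfl fun j _ => ?_
    rw [← diag_apply hh, ← val_image _ hs, hT]
  · rw [hT]

theorem sum_val_raise (hq : q.natDegree ≤ n) (hp : p.natDegree ≤ n) (v : SymSpace n) {u : L}
    {T : Finset L} (hu : u ∉ T) :
    ∑ j ∈ Finset.range (n + 1), u ^ j * val (raise hq hp j v) T =
      raiseSum (fun x => Polynomial.aeval x q) (fun x => Polynomial.aeval x p) (val v) u T := by
  obtain ⟨s, hs, hT⟩ := exists_eq_image T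
  generalize hl : T.card = l at s
  cases l with
  | zero =>
    rw [Finset.card_eq_zero] at hl
    subst hl
    rw [raiseSum, Finset.sum_empty, Finset.sum_empty, sub_zero]
    refine Finset.sum_eq_zero fun j _ => ?_
    rw [← hT, val_image _ hs, raise_apply_zero, map_zero, mul_zero]
  | succ l =>
    have hu' := hu
    rw [← hT] at hu'
    rw [← raiseSum_congr hu (F := finsetVal (v.1 l)) fun S hS _ =>
      finsetVal_eq_val v (by omega)]
    refine Eq.trans ?_ ((sum_aeval_raiseOp (pos n) hq hp (isSymmetric v _) (degLT v _) hs
      hu').trans ?_)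
    · refine Finset.sum_congr rfl fun j _ => ?_
      rw [← raise_apply_succ hq hp, ← val_image _ hs, hT]
    · rw [hT]

theorem ext_val (A : Finset ℂ) {v w : SymSpace n}
    (hvw : ∀ T : Finset ℂ, Disjoint A T → val v T = val w T) : v = w := by
  refine ext fun l => eq_of_forall_injective A fun s hs hA => ?_
  rw [← val_image v hs, ← val_image w hs]
  refine hvw _ (Finset.disjoint_right.2 fun a ha => ?_)
  obtain ⟨i, _, rfl⟩ := Finset.mem_image.1 ha
  exact hA i

/-- The set of the points `c, c - 1, …, c - k + 1`. -/
def ladder (L : Type) [Field L] [Algebra ℂ L] [DecidableEq L] (c : ℂ) (k : ℕ) : Finset L :=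
  Finset.univ.image (ladderPt L c k)

theorem ladder_succ (c : ℂ) (k : ℕ) :
    ladder L c (k + 1) = insert (algebraMap ℂ L (c - k)) (ladder L c k) := by
  rw [ladder, ladderPt_succ, image_snoc, ladder]

theorem notMem_ladder (c : ℂ) (k : ℕ) : algebraMap ℂ L (c - k) ∉ ladder L c k := by
  intro hk
  have := ladderPt_injective (L := L) c (k + 1)
  rw [ladderPt_succ] at this
  refine (Fin.snoc_injective_iff.1 this).2 ?_
  obtain ⟨i, _, hi⟩ := Finset.mem_image.1 hk
  exact ⟨i, hi⟩

/-- The product of the lowering operators at `c, c - 1, …, c - k + 1`. -/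
def lowerProd (c : ℂ) : ℕ → Module.End ℂ (SymSpace n)
  | 0 => 1
  | k + 1 => genFun lower (c - k) * lowerProd c k

theorem val_lowerProd (c : ℂ) (k : ℕ) (v : SymSpace n) {T : Finset L}
    (hT : Disjoint (ladder L c k) T) : val (lowerProd c k v) T = val v (ladder L c k ∪ T) := by
  induction k generalizing T with
  | zero =>
    rw [show ladder L c 0 = ∅ from rfl, Finset.empty_union]
    rfl
  | succ k ih =>
    rw [ladder_succ, Finset.disjoint_insert_left] at hT
    rw [lowerProd, Module.End.mul_apply, val_lower _ _ hT.1, ih, ladder_succ, Finset.union_insert,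
      Finset.insert_union]
    rw [Finset.disjoint_insert_right]
    exact ⟨notMem_ladder c k, hT.2⟩

/-- Consecutive points differ by one, so each numerator `x - y - 1` cancels the denominator of the
preceding ladder point and only the two ends survive. -/
theorem ratioProd_one_ladder (c : ℂ) (k : ℕ) {x : L} (hx : x ∉ ladder L c k) :
    (x - algebraMap ℂ L (c - k) - 1) * ratioProd 1 x (ladder L c k) =
      x - algebraMap ℂ L c - 1 := by
  induction k with
  | zero =>
    rw [show ladder L c 0 = ∅ from rfl, ratioProd, Finset.prod_empty]
    simp
  | succ k ih =>
    rw [ladder_succ, Finset.mem_insert, not_or] at hx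
    have h1 : x - algebraMap ℂ L (c - k) ≠ 0 := sub_ne_zero.2 hx.1
    rw [ladder_succ, ratioProd_insert (notMem_ladder c k), ← ih hx.2]
    have h2 : x - algebraMap ℂ L (c - (k + 1 : ℕ)) - 1 = x - algebraMap ℂ L (c - k) := by
      simp only [map_sub, Nat.cast_add, Nat.cast_one, map_add, map_one]
      ring
    rw [h2]
    field_simp

theorem ratioProd_neg_one_ladder (c : ℂ) (k : ℕ) {x : L} (hx : x ∉ ladder L c k) :
    (x - algebraMap ℂ L c) * ratioProd (-1) x (ladder L c k) = x - algebraMap ℂ L (c - k) := by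
  induction k with
  | zero =>
    rw [show ladder L c 0 = ∅ from rfl, ratioProd, Finset.prod_empty]
    simp
  | succ k ih =>
    rw [ladder_succ, Finset.mem_insert, not_or] at hx
    have h1 : x - algebraMap ℂ L (c - k) ≠ 0 := sub_ne_zero.2 hx.1
    rw [ladder_succ, ratioProd_insert (notMem_ladder c k), mul_left_comm, ih hx.2,
      div_mul_cancel₀ _ h1]
    simp only [map_sub, Nat.cast_add, Nat.cast_one, map_add, map_one]
    ring

/-- Unless `a` is the lowest point, `a - 1` is also in the ladder and contributes the factor `a - (a
- 1) - 1 = 0`. -/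
theorem ratioProd_one_ladder_erase (c : ℂ) (k : ℕ) {a : L} (ha : a ∈ ladder L c (k + 1))
    (hk : a ≠ algebraMap ℂ L (c - k)) : ratioProd 1 a ((ladder L c (k + 1)).erase a) = 0 := by
  obtain ⟨i, _, rfl⟩ := Finset.mem_image.1 ha
  have hi : (i : ℕ) ≠ k := fun e => hk (by rw [ladderPt, e])
  have hi' : (i : ℕ) + 1 < k + 1 := by omega
  refine Finset.prod_eq_zero (i := ladderPt L c (k + 1) ⟨i + 1, hi'⟩)
    (Finset.mem_erase.2 ⟨(ladderPt_injective c _).ne fun e => ?_,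
      Finset.mem_image_of_mem _ (Finset.mem_univ _)⟩) ?_
  · have := congrArg Fin.val e
    simp at this
  · simp [ladderPt]

/-- Unless `a` is the highest point, `a + 1` is also in the ladder and contributes the factor `a -
(a + 1) + 1 = 0`. -/
theorem ratioProd_neg_one_ladder_erase (c : ℂ) (k : ℕ) {a : L} (ha : a ∈ ladder L c k)
    (hc : a ≠ algebraMap ℂ L c) : ratioProd (-1) a ((ladder L c k).erase a) = 0 := by
  obtain ⟨i, _, rfl⟩ := Finset.mem_image.1 ha
  have hi : (i : ℕ) ≠ 0 := fun e => hc (by rw [ladderPt, e, Nat.cast_zero, sub_zero])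
  obtain ⟨j, hj⟩ := Nat.exists_eq_succ_of_ne_zero hi
  refine Finset.prod_eq_zero (i := ladderPt L c k ⟨j, by omega⟩)
    (Finset.mem_erase.2 ⟨(ladderPt_injective c _).ne fun e => ?_,
      Finset.mem_image_of_mem _ (Finset.mem_univ _)⟩) ?_
  · have := congrArg Fin.val e
    simp only at this
    omega
  · simp [ladderPt, hj]

end SymSpace

/-! ### Intertwining property of the product of lowering operators -/

namespace SymSpace

open MvPolynomial

variable {n : ℕ} [NeZero n] {ε : ℂ} {h h' q p q' p' : Polynomial ℂ}

theorem eq_of_sum_pow_mul (A : Finset ℂ) {N : ℕ} {a b : ℕ → ℂ}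
    (hab : ∀ u ∉ A, ∑ j ∈ Finset.range N, u ^ j * a j = ∑ j ∈ Finset.range N, u ^ j * b j) :
    ∀ j < N, a j = b j := by
  intro j hj
  rw [← sub_eq_zero]
  refine eq_zero_of_forall_sum_pow_smul A N (fun j => a j - b j) (fun u hu => ?_) j hj
  simp only [smul_eq_mul, mul_sub, Finset.sum_sub_distrib]
  rw [hab u hu, sub_self]

/-- Values at sets `T` disjoint from the ladder determine both sides. The product of lowerings adds
the ladder to `T`, after which `diagSum_union` absorbs it. -/
theorem lowerProd_diag (hh : h.natDegree ≤ n) (hh' : h'.natDegree ≤ n) (c : ℂ) (k : ℕ)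
    (H : ∀ x ∉ ladder ℂ c k,
      Polynomial.aeval x h * ratioProd ε x (ladder ℂ c k) = Polynomial.aeval x h')
    (H0 : ∀ a ∈ ladder ℂ c k, Polynomial.aeval a h * ratioProd ε a ((ladder ℂ c k).erase a) = 0)
    {j : ℕ} (hj : j ≤ n) (v : SymSpace n) :
    lowerProd c k (diag ε hh j v) = diag ε hh' j (lowerProd c k v) := by
  refine ext_val (ladder ℂ c k) fun T hT => ?_
  refine eq_of_sum_pow_mul (ladder ℂ c k ∪ T)
    (a := fun j => val (lowerProd c k (diag ε hh j v)) T)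
    (b := fun j => val (diag ε hh' j (lowerProd c k v)) T) (fun u hu => ?_) j (Nat.lt_succ_of_le hj)
  have hu' := hu
  rw [Finset.mem_union, not_or] at hu'
  simp only [val_lowerProd c k _ hT]
  rw [sum_val_diag hh v hu, sum_val_diag hh' _ hu'.2, Algebra.algebraMap_self, RingHom.id_apply,
    diagSum_union hT hu'.1 H H0]
  refine diagSum_congr hu'.2 fun S _ hS => (val_lowerProd c k v ?_).symm
  exact (Finset.disjoint_insert_right.2 ⟨hu'.1, hT⟩).mono_right hS

theorem lowerProd_raise (hq : q.natDegree ≤ n) (hp : p.natDegree ≤ n) (hq' : q'.natDegree ≤ n)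
    (hp' : p'.natDegree ≤ n) (c : ℂ) (k : ℕ)
    (Hq : ∀ x ∉ ladder ℂ c k,
      Polynomial.aeval x q * ratioProd 1 x (ladder ℂ c k) = Polynomial.aeval x q')
    (Hp : ∀ x ∉ ladder ℂ c k,
      Polynomial.aeval x p * ratioProd (-1) x (ladder ℂ c k) = Polynomial.aeval x p')
    (Hq0 : ∀ a ∈ ladder ℂ c k, Polynomial.aeval a q * ratioProd 1 a ((ladder ℂ c k).erase a) = 0)
    (Hp0 : ∀ a ∈ ladder ℂ c k,
      Polynomial.aeval a p * ratioProd (-1) a ((ladder ℂ c k).erase a) = 0)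
    {j : ℕ} (hj : j ≤ n) (v : SymSpace n) :
    lowerProd c k (raise hq hp j v) = raise hq' hp' j (lowerProd c k v) := by
  refine ext_val (ladder ℂ c k) fun T hT => ?_
  refine eq_of_sum_pow_mul (ladder ℂ c k ∪ T)
    (a := fun j => val (lowerProd c k (raise hq hp j v)) T)
    (b := fun j => val (raise hq' hp' j (lowerProd c k v)) T) (fun u hu => ?_) j
    (Nat.lt_succ_of_le hj)
  have hu' := hu
  rw [Finset.mem_union, not_or] at hu'
  simp only [val_lowerProd c k _ hT]
  rw [sum_val_raise hq hp v hu, sum_val_raise hq' hp' _ hu'.2,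
    raiseSum_union hT hu'.1 Hq Hp Hq0 Hp0]
  refine raiseSum_congr hu'.2 fun S _ hS => (val_lowerProd c k v ?_).symm
  exact (Finset.disjoint_insert_right.2 ⟨hu'.1, hT⟩).mono_right hS

theorem genFun_lower_lower (x : ℂ) {j : ℕ} (hj : j ≤ n) (v : SymSpace n) :
    genFun lower x (lower j v) = lower j (genFun lower x v) := by
  rw [← sub_eq_zero]
  refine eq_zero_of_forall_sum_pow_smul ∅ (n + 1)
    (fun j => genFun lower x (lower j v) - lower j (genFun lower x v)) (fun u _ => ?_) j
    (Nat.lt_succ_of_le hj)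
  have hu : ∀ w : SymSpace n,
      genFun lower u w = ∑ i ∈ Finset.range (n + 1), u ^ i • lower i w := fun w => by
    rw [genFun, LinearMap.sum_apply]
    rfl
  have hx := lower_comm x u v
  rw [hu v, hu (genFun lower x v), map_sum, ← sub_eq_zero, ← Finset.sum_sub_distrib] at hx
  rw [← hx]
  exact Finset.sum_congr rfl fun i _ => by rw [map_smul, smul_sub]

theorem lowerProd_lower (c : ℂ) (k : ℕ) {j : ℕ} (hj : j ≤ n) (v : SymSpace n) :
    lowerProd c k (lower j v) = lower j (lowerProd c k v) := by
  induction k with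
  | zero => rfl
  | succ k ih =>
    rw [lowerProd, Module.End.mul_apply, ih, genFun_lower_lower _ hj, Module.End.mul_apply]

variable {L : Type} [Field L] [Algebra ℂ L] [DecidableEq L] {z lam : Fin n → ℂ} {k : ℕ}

theorem aeval_rootPoly_eq_mul {L : Type} [Field L] [Algebra ℂ L] (c : Fin n → ℂ) (x : L) :
    Polynomial.aeval x (rootPoly c) =
      (x - algebraMap ℂ L (c 0)) * ∏ a ∈ Finset.univ.erase 0, (x - algebraMap ℂ L (c a)) := by
  rw [aeval_rootPoly]
  exact (Finset.mul_prod_erase Finset.univ (fun a => x - algebraMap ℂ L (c a))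
    (Finset.mem_univ 0)).symm

/-- Since `2λ_1 = k`, the root `z_1 - λ_1` is the lowest ladder point `c - k`. Telescoping over `k +
1` points moves it to `c + 1 = z_1 - λ'_1`. -/
theorem numPoly_ladder (hk : 2 * lam 0 = (k : ℂ)) {x : L} (hx : x ∉ ladder L (z 0 + lam 0) (k + 1)) :
    Polynomial.aeval x (numPoly z lam) * ratioProd 1 x (ladder L (z 0 + lam 0) (k + 1)) =
      Polynomial.aeval x (numPoly z (reflectFirst lam)) := by
  have h1 := ratioProd_one_ladder (z 0 + lam 0) (k + 1) hx
  rw [numPoly, numPoly, aeval_rootPoly_eq_mul, aeval_rootPoly_eq_mul, mul_right_comm]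
  congr 1
  · have h2 : x - algebraMap ℂ L (z 0 - lam 0) =
        x - algebraMap ℂ L (z 0 + lam 0 - ((k + 1 : ℕ) : ℂ)) - 1 := by
      rw [sub_sub, ← map_one (algebraMap ℂ L), ← map_add]
      congr 2
      push_cast
      rw [← hk]
      ring
    rw [h2, h1, reflectFirst, Function.update_self, sub_sub, ← map_one (algebraMap ℂ L), ← map_add]
    congr 2
    ring
  · refine Finset.prod_congr rfl fun a ha => ?_
    rw [reflectFirst, Function.update_of_ne (Finset.ne_of_mem_erase ha)]

/-- Telescoping moves the root `c` to `c - k - 1`, which is `z_1 + λ'_1` because `2λ_1 = k`. -/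
theorem denPoly_ladder (hk : 2 * lam 0 = (k : ℂ)) {x : L} (hx : x ∉ ladder L (z 0 + lam 0) (k + 1)) :
    Polynomial.aeval x (denPoly z lam) * ratioProd (-1) x (ladder L (z 0 + lam 0) (k + 1)) =
      Polynomial.aeval x (denPoly z (reflectFirst lam)) := by
  have h1 := ratioProd_neg_one_ladder (z 0 + lam 0) (k + 1) hx
  rw [denPoly, denPoly, aeval_rootPoly_eq_mul, aeval_rootPoly_eq_mul, mul_right_comm]
  congr 1
  · rw [h1, reflectFirst, Function.update_self]
    congr 2
    push_cast
    rw [← hk]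
    ring
  · refine Finset.prod_congr rfl fun a ha => ?_
    rw [reflectFirst, Function.update_of_ne (Finset.ne_of_mem_erase ha)]

/-- The one ladder point at which the product need not vanish, the lowest, is a root of `numPoly`.
For `denPoly` the exceptional point is the highest one, also a root. -/
theorem numPoly_ladder_erase (hk : 2 * lam 0 = (k : ℂ)) {a : L}
    (ha : a ∈ ladder L (z 0 + lam 0) (k + 1)) : Polynomial.aeval a (numPoly z lam) *
      ratioProd 1 a ((ladder L (z 0 + lam 0) (k + 1)).erase a) = 0 := by
  by_cases h : a = algebraMap ℂ L (z 0 + lam 0 - k)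
  · have h2 : z 0 + lam 0 - k = z 0 - lam 0 := by rw [← hk]; ring
    rw [numPoly, aeval_rootPoly_eq_mul, h, h2, sub_self, zero_mul, zero_mul]
  · rw [ratioProd_one_ladder_erase _ _ ha h, mul_zero]

theorem denPoly_ladder_erase {a : L} (ha : a ∈ ladder L (z 0 + lam 0) k) :
    Polynomial.aeval a (denPoly z lam) *
      ratioProd (-1) a ((ladder L (z 0 + lam 0) k).erase a) = 0 := by
  by_cases h : a = algebraMap ℂ L (z 0 + lam 0)
  · rw [denPoly, aeval_rootPoly_eq_mul, h, sub_self, zero_mul, zero_mul]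
  · rw [ratioProd_neg_one_ladder_erase _ _ ha h, mul_zero]

theorem lowerProd_yangianT (hk : 2 * lam 0 = (k : ℂ)) (i j : Fin 2) (s : ℕ) (v : SymSpace n) :
    lowerProd (z 0 + lam 0) (k + 1)
        (yangianT (numPoly_le z lam) (denPoly_le z lam) i j s v) =
      yangianT (numPoly_le z (reflectFirst lam)) (denPoly_le z (reflectFirst lam)) i j s
        (lowerProd (z 0 + lam 0) (k + 1) v) := by
  unfold yangianT
  split_ifs with hs
  · have hs' := Nat.sub_le n s
    fin_cases i <;> fin_cases j
    · exact lowerProd_diag (numPoly_le z lam) (numPoly_le z _) _ _ (fun _ hx => numPoly_ladder hk hx)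
        (fun _ ha => numPoly_ladder_erase hk ha) hs' v
    · exact lowerProd_raise (numPoly_le z lam) (denPoly_le z lam) (numPoly_le z _)
        (denPoly_le z _) _ _ (fun _ hx => numPoly_ladder hk hx)
        (fun _ hx => denPoly_ladder hk hx) (fun _ ha => numPoly_ladder_erase hk ha)
        (fun _ ha => denPoly_ladder_erase ha) hs' v
    · exact lowerProd_lower _ _ hs' v
    · exact lowerProd_diag (denPoly_le z lam) (denPoly_le z _) _ _ (fun _ hx => denPoly_ladder hk hx)
        (fun _ ha => denPoly_ladder_erase ha) hs' v
  · rw [LinearMap.zero_apply, LinearMap.zero_apply, map_zero]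

theorem lowerProd_symRep (hk : 2 * lam 0 = (k : ℂ)) (y : Yangian) :
    ∀ v : SymSpace n, lowerProd (z 0 + lam 0) (k + 1) (symRep z lam y v) =
      symRep z (reflectFirst lam) y (lowerProd (z 0 + lam 0) (k + 1) v) := by
  obtain ⟨x, rfl⟩ := RingQuot.mkAlgHom_surjective ℂ YangianRel y
  induction x using FreeAlgebra.induction with
  | grade0 c =>
    intro v
    simp only [AlgHom.commutes, Module.algebraMap_end_apply, map_smul]
  | grade1 g =>
    intro v
    have hT : RingQuot.mkAlgHom ℂ YangianRel (FreeAlgebra.ι ℂ g) = Yangian.T g.1 g.2.1 g.2.2 := rfl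
    rw [hT, symRep_T, symRep_T, lowerProd_yangianT hk]
  | mul a b ha hb =>
    intro v
    rw [map_mul, map_mul, map_mul, Module.End.mul_apply, Module.End.mul_apply, ha, hb]
  | add a b ha hb =>
    intro v
    rw [map_add, map_add, map_add, LinearMap.add_apply, LinearMap.add_apply, map_add, ha, hb]

end SymSpace

/-! ### Surjectivity of the lowering operators -/

/-- A locally nilpotent operator `c` is surjective if there is an operator `e` with `[c, e] = 1`. -/
theorem surjective_of_commutator {E : Type} [AddCommGroup E] [Module ℂ E] (c e : Module.End ℂ E)
    (hce : ∀ v, c (e v) = v + e (c v)) (hc : ∀ v, ∃ N, (c ^ N) v = 0) : Function.Surjective c := by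
  have hpow : ∀ i v, c ((e ^ (i + 1)) v) = ((i + 1 : ℕ) : ℂ) • (e ^ i) v + (e ^ (i + 1)) (c v) := by
    intro i
    induction i with
    | zero =>
      intro v
      simp [hce]
    | succ i ih =>
      intro v
      rw [pow_succ' e (i + 1), Module.End.mul_apply, hce, ih, map_add, map_smul,
        ← Module.End.mul_apply, ← Module.End.mul_apply, ← pow_succ', add_left_comm, ← add_assoc,
        ← pow_succ']
      push_cast
      module
  -- Induction on the order of nilpotency for all `i` at once: `hpow` expresses `(i + 1) e^i v`
  -- through an image of `c` and `e^(i+1) (c v)`, where `c v` has smaller order.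
  have key : ∀ N i v, (c ^ N) v = 0 → (e ^ i) v ∈ LinearMap.range c := by
    intro N
    induction N with
    | zero =>
      intro i v hv
      rw [show v = 0 from hv, map_zero]
      exact zero_mem _
    | succ N ih =>
      intro i v hv
      have h1 := ih (i + 1) (c v) (by rwa [pow_succ, Module.End.mul_apply] at hv)
      have h2 : ((i + 1 : ℕ) : ℂ) • (e ^ i) v ∈ LinearMap.range c := by
        rw [eq_sub_of_add_eq (hpow i v).symm]
        exact sub_mem ⟨_, rfl⟩ h1
      -- Division by `i + 1` uses characteristic zero.
      exact (Submodule.smul_mem_iff _ (Nat.cast_ne_zero.2 i.succ_ne_zero)).1 h2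
  intro v
  obtain ⟨N, hN⟩ := hc v
  exact key N 0 v hN

namespace SymSpace

open MvPolynomial

/-- The sum over all ways to forget a variable. -/
def spread (l : ℕ) : MvPolynomial (Fin l) ℂ →ₗ[ℂ] MvPolynomial (Fin (l + 1)) ℂ :=
  ∑ a : Fin (l + 1), (rename a.succAbove).toLinearMap

variable {n : ℕ} {l : ℕ} {P : MvPolynomial (Fin l) ℂ}

theorem aeval_spread (P : MvPolynomial (Fin l) ℂ) (s : Fin (l + 1) → ℂ) :
    aeval s (spread l P) = ∑ a : Fin (l + 1), aeval (s ∘ a.succAbove) P := by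
  rw [spread, LinearMap.sum_apply, map_sum]
  exact Finset.sum_congr rfl fun a _ => aeval_rename _ _ _

theorem aeval_spread_eq_sum (hP : P.IsSymmetric) {s : Fin (l + 1) → ℂ}
    (hs : Function.Injective s) : aeval s (spread l P) =
      ∑ x ∈ Finset.univ.image s, finsetVal P ((Finset.univ.image s).erase x) := by
  rw [aeval_spread, Finset.sum_image fun _ _ _ _ h => hs h]
  refine Finset.sum_congr rfl fun a _ => ?_
  rw [← Finset.image_erase hs, ← Finset.compl_singleton, ← Fin.image_succAbove_univ,
    Finset.image_image, finsetVal_image hP (hs.comp Fin.succAbove_right_injective)]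

theorem isSymmetric_spread (hP : P.IsSymmetric) : (spread l P).IsSymmetric := by
  intro σ
  refine eq_of_forall_injective ∅ fun s hs _ => ?_
  rw [aeval_rename, aeval_spread_eq_sum hP hs, aeval_spread_eq_sum hP (hs.comp σ.injective),
    image_comp_perm]

/-- In each summand one variable does not occur and the others keep their degrees; no degree is
raised, so the bound by `n` survives. -/
theorem _root_.DegLT.spread (hn : 0 < n) (hd : DegLT n P) : DegLT n (spread l P) := by
  rw [SymSpace.spread, LinearMap.sum_apply]
  refine DegLT.sum hn _ fun a _ i => ?_
  change degreeOf i (rename a.succAbove P) < n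
  by_cases h : i = a
  · have : i ∉ (rename a.succAbove P).vars := fun hi => by
      obtain ⟨j, _, hj⟩ := Finset.mem_image.1 (vars_rename _ _ hi)
      exact Fin.succAbove_ne a j (hj.trans h)
    rwa [not_not.1 (mem_vars_iff_degreeOf_ne_zero.not.1 this)]
  · obtain ⟨j, rfl⟩ := Fin.exists_succAbove_eq h
    rw [degreeOf_rename_of_injective Fin.succAbove_right_injective]
    exact hd j

variable [NeZero n]

/-- The operator of multiplication by the function `1` of one variable. -/
def addPoint : Module.End ℂ (SymSpace n) :=
  (LinearMap.pi (fun l => match l with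
    | 0 => 0
    | l + 1 => spread l ∘ₗ LinearMap.proj l) :
      (∀ l, MvPolynomial (Fin l) ℂ) →ₗ[ℂ] ∀ l, MvPolynomial (Fin l) ℂ).restrict (by
    rintro v ⟨hv, N, hN⟩
    refine ⟨fun l => ?_, N + 1, fun l hl => ?_⟩
    · cases l with
      | zero => exact ⟨IsSymmetric.zero, DegLT.zero (pos n)⟩
      | succ l => exact ⟨isSymmetric_spread (hv l).1, (hv l).2.spread (pos n)⟩
    · obtain ⟨l, rfl⟩ : ∃ m, l = m + 1 := ⟨l - 1, by omega⟩
      change spread l (v l) = 0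
      rw [hN l (by omega), map_zero])

theorem addPoint_apply_zero (v : SymSpace n) : (addPoint v).1 0 = 0 := rfl

theorem addPoint_apply_succ (v : SymSpace n) (l : ℕ) :
    (addPoint v).1 (l + 1) = spread l (v.1 l) := rfl

/-- When `w` is substituted for the first variable, the summand that forgets this variable returns
`v`, and the other summands forget one of the remaining variables after the substitution. -/
theorem lower_addPoint (w : ℂ) (v : SymSpace n) :
    genFun lower w (addPoint v) = v + addPoint (genFun lower w v) := by
  refine ext fun l => MvPolynomial.funext fun t => ?_
  change aeval t _ = aeval t (v.1 l + (addPoint (genFun lower w v)).1 l)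
  rw [aeval_lower, addPoint_apply_succ, aeval_spread, Fin.sum_univ_succ, map_add]
  congr 1
  cases l with
  | zero => rw [addPoint_apply_zero, map_zero, Finset.univ_eq_empty, Finset.sum_empty]
  | succ l =>
    rw [addPoint_apply_succ, aeval_spread]
    refine Finset.sum_congr rfl fun b _ => ?_
    rw [aeval_lower]
    congr 2
    funext i
    refine Fin.cases ?_ (fun i => ?_) i
    · simp
    · simp

theorem lower_pow_eq_zero (w : ℂ) (N : ℕ) : ∀ v : SymSpace n, (∀ l, N ≤ l → v.1 l = 0) →
    (genFun lower w ^ N) v = 0 := by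
  induction N with
  | zero => exact fun v hv => ext fun l => hv l l.zero_le
  | succ N ih =>
    intro v hv
    rw [pow_succ, Module.End.mul_apply]
    refine ih _ fun l hl => ?_
    rw [genFun_apply]
    refine Finset.sum_eq_zero fun j _ => ?_
    rw [lower_apply, hv (l + 1) (by omega), map_zero, smul_zero]

theorem lower_surjective (w : ℂ) : Function.Surjective (genFun lower w : Module.End ℂ (SymSpace n)) :=
  surjective_of_commutator _ addPoint (lower_addPoint w) fun v =>
    ⟨v.2.2.choose, lower_pow_eq_zero w _ v v.2.2.choose_spec⟩

theorem lowerProd_surjective (c : ℂ) (k : ℕ) :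
    Function.Surjective (lowerProd c k : Module.End ℂ (SymSpace n)) := by
  induction k with
  | zero => exact Function.surjective_id
  | succ k ih => exact (lower_surjective (c - k)).comp ih

theorem lowerProd_apply_eq_zero (c : ℂ) (k : ℕ) {v : SymSpace n} {m : ℕ} (h : v.1 (m + k) = 0) :
    (lowerProd c k v).1 m = 0 := by
  induction k generalizing m with
  | zero => exact h
  | succ k ih =>
    rw [lowerProd, Module.End.mul_apply, genFun_apply]
    refine Finset.sum_eq_zero fun j _ => ?_
    rw [lower_apply, ih (by rwa [add_right_comm, add_assoc]), map_zero, smul_zero]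

end SymSpace

/-! ### Concatenation of points -/

section Append

variable {L : Type}

theorem image_append [DecidableEq L] {k m : ℕ} (s : Fin k → L) (t : Fin m → L) :
    Finset.univ.image (Fin.append s t) = Finset.univ.image s ∪ Finset.univ.image t := by
  ext x
  simp only [Finset.mem_image, Finset.mem_univ, true_and, Finset.mem_union]
  constructor
  · rintro ⟨i, hi⟩
    revert hi
    refine Fin.addCases (fun i hi => Or.inl ⟨i, ?_⟩) (fun i hi => Or.inr ⟨i, ?_⟩) i
    · rwa [Fin.append_left] at hi
    · rwa [Fin.append_right] at hi
  · rintro (⟨i, rfl⟩ | ⟨i, rfl⟩)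
    · exact ⟨_, Fin.append_left s t i⟩
    · exact ⟨_, Fin.append_right s t i⟩

theorem omegaFactor_append [Field L] {k m : ℕ} (s : Fin k → L) (t : Fin m → L) :
    omegaFactor (Fin.append s t) = omegaFactor s * omegaFactor t *
      ∏ b, ∏ a, (s a - t b) / (s a - t b + 1) := by
  have h1 : ∀ (i j : Fin k), Fin.castAdd m i < Fin.castAdd m j ↔ i < j := fun i j => Iff.rfl
  have h2 : ∀ (i : Fin k) (j : Fin m), Fin.castAdd m i < Fin.natAdd k j := fun i j => by
    rw [Fin.lt_def, Fin.val_castAdd, Fin.val_natAdd]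
    omega
  have h3 : ∀ (i : Fin k) (j : Fin m), ¬ Fin.natAdd k j < Fin.castAdd m i := fun i j =>
    not_lt.2 (h2 i j).le
  have h4 : ∀ (i j : Fin m), Fin.natAdd k i < Fin.natAdd k j ↔ i < j := fun i j => by
    rw [Fin.lt_def, Fin.lt_def, Fin.val_natAdd, Fin.val_natAdd, Nat.add_lt_add_iff_left]
  rw [Finset.prod_comm]
  simp only [omegaFactor_eq, Fin.prod_univ_add, Fin.append_left, Fin.append_right, h1, h2, h3, h4,
    if_true, if_false, Finset.prod_const_one, Finset.prod_mul_distrib]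
  ring

theorem iota_arith [Field L] (P a b X D N M C V : L) (hD : D ≠ 0) :
    P * (a * b * X * D) * N / (C * V * D * M) = a / C * P * (X * (N / M) / V * b) := by
  field_simp

end Append

/-! ### The map `ι*` as a product of lowering operators -/

section Iota

open Polynomial (aeval)
open SymSpace

variable {n : ℕ} [NeZero n] (z lam : Fin n → ℂ) (k m : ℕ)

theorem iotaPoint_eq : iotaPoint z lam k m =
    Fin.append (ladderPt (RatFn m) (z 0 + lam 0) (k + 1)) RatFn.var := rfl

theorem var_injective : Function.Injective (RatFn.var : Fin m → RatFn m) := by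
  intro a b h
  by_contra hab
  have := RatFn.var_sub_var_add_ne hab 0
  rw [map_zero, add_zero] at this
  exact this (sub_eq_zero.2 h)

theorem disjoint_ladder_var [DecidableEq (RatFn m)] (c : ℂ) :
    Disjoint (ladder (RatFn m) c k) (Finset.univ.image (RatFn.var : Fin m → RatFn m)) := by
  refine Finset.disjoint_right.2 fun x hx hx' => ?_
  obtain ⟨b, _, rfl⟩ := Finset.mem_image.1 hx
  obtain ⟨i, _, hi⟩ := Finset.mem_image.1 hx'
  exact RatFn.var_ne_algebraMap b _ (sub_eq_zero.2 hi.symm)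

theorem iotaPoint_injective : Function.Injective (iotaPoint z lam k m) := by
  classical
  rw [iotaPoint_eq]
  refine Fin.append_injective_iff.2 ⟨ladderPt_injective _ _, var_injective m, fun i j h => ?_⟩
  exact RatFn.var_ne_algebraMap j _ (sub_eq_zero.2 h.symm)

/-- The variables are disjoint from the ladder, so the successive lowerings substitute the ladder
points for `k + 1` variables, in any order by symmetry. -/
theorem algebraMap_lowerProd (v : SymSpace n) :
    algebraMap _ (RatFn m) ((lowerProd (z 0 + lam 0) (k + 1) v).1 m) =
      MvPolynomial.aeval (iotaPoint z lam k m) (v.1 (k + 1 + m)) := by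
  classical
  rw [← aeval_var, ← val_image _ (var_injective m), val_lowerProd _ _ _ (disjoint_ladder_var _ _ _),
    ← val_image _ (iotaPoint_injective z lam k m), iotaPoint_eq, image_append, ladder]

open MvPolynomial in
/-- The numerator of the cross factor of `iotaTilde`. -/
def crossNum : MvPolynomial (Fin (k + 1 + m)) ℂ :=
  ∏ a : Fin (k + 1), ∏ b : Fin m, (X (Fin.castAdd m a) - X (Fin.natAdd (k + 1) b) + 1)

open MvPolynomial in
/-- The denominator of the cross factor of `iotaTilde`. -/
def crossDen : MvPolynomial (Fin (k + 1 + m)) ℂ :=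
  ∏ a : Fin (k + 1), ∏ b : Fin m, (X (Fin.castAdd m a) - X (Fin.natAdd (k + 1) b) - 1)

open MvPolynomial in
/-- The denominators `t_b - z_a - λ_a` except for the first one. -/
def poleRest : MvPolynomial (Fin (k + 1 + m)) ℂ :=
  (∏ a ∈ Finset.univ.erase 0, (X (Fin.castAdd m 0) - C (z a + lam a))) *
    (∏ j : Fin k, ∏ a, (X (Fin.castAdd m j.succ) - C (z a + lam a))) *
    ∏ b : Fin m, ∏ a, (X (Fin.natAdd (k + 1) b) - C (z a + lam a))

open MvPolynomial in
theorem poleDen_eq : poleDen z lam (k + 1 + m) =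
    (X (Fin.castAdd m 0) - C (z 0 + lam 0)) * poleRest z lam k m := by
  rw [poleDen, Fin.prod_univ_add, Fin.prod_univ_succ, poleRest,
    ← Finset.mul_prod_erase Finset.univ (fun a => (X (Fin.castAdd m 0) - C (z a + lam a) :
      MvPolynomial (Fin (k + 1 + m)) ℂ)) (Finset.mem_univ 0)]
  ring

/-- The factor `t_1 - z_1 - λ_1` cancels the only denominator that vanishes at the ladder point,
leaving a fraction that can be evaluated there. -/
theorem iotaTilde_eq (P : MvPolynomial (Fin (k + 1 + m)) ℂ) :
    iotaTilde z lam k m (algebraMap _ (RatFn (k + 1 + m)) P * hypWeight z lam (k + 1 + m)) =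
      algebraMap _ (RatFn (k + 1 + m)) (P * weightNum _ * crossNum k m) /
        algebraMap _ (RatFn (k + 1 + m)) (poleRest z lam k m * weightDen _ * crossDen k m) := by
  have h0 := RatFn.var_ne_algebraMap (Fin.castAdd m (0 : Fin (k + 1))) (z 0 + lam 0)
  have h1 : algebraMap _ (RatFn (k + 1 + m)) (poleDen z lam (k + 1 + m)) =
      (RatFn.var (Fin.castAdd m 0) - algebraMap ℂ (RatFn (k + 1 + m)) (z 0 + lam 0)) *
        algebraMap _ (RatFn (k + 1 + m)) (poleRest z lam k m) := by
    rw [poleDen_eq, map_mul, map_sub, RatFn.var,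
      IsScalarTower.algebraMap_apply ℂ (MvPolynomial (Fin (k + 1 + m)) ℂ) (RatFn (k + 1 + m))]
    rfl
  have h2 : ∏ a : Fin (k + 1), ∏ b : Fin m,
      (RatFn.var (Fin.castAdd m a) - RatFn.var (Fin.natAdd (k + 1) b) + 1) /
        (RatFn.var (Fin.castAdd m a) - RatFn.var (Fin.natAdd (k + 1) b) - 1) =
      algebraMap _ (RatFn (k + 1 + m)) (crossNum k m) /
        algebraMap _ (RatFn (k + 1 + m)) (crossDen k m) := by
    simp only [Finset.prod_div_distrib, crossNum, crossDen, map_prod, map_sub, map_add, map_one,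
      RatFn.var]
  rw [iotaTilde, hypWeight_eq, h2]
  simp only [map_mul, h1]
  generalize RatFn.var (Fin.castAdd m 0) - algebraMap ℂ (RatFn (k + 1 + m)) (z 0 + lam 0) = x at h0
  field_simp

/-- The constant in `ι*`. -/
def iotaConst : ℂ :=
  omegaFactor (ladderPt ℂ (z 0 + lam 0) (k + 1)) /
    ((∏ a ∈ Finset.univ.erase 0, (z 0 + lam 0 - (z a + lam a))) *
      ∏ j : Fin k, aeval (ladderPt ℂ (z 0 + lam 0) (k + 1) j.succ) (denPoly z lam))

theorem algebraMap_iotaConst {L : Type} [Field L] [Algebra ℂ L] :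
    algebraMap ℂ L (iotaConst z lam k) =
    omegaFactor (ladderPt L (z 0 + lam 0) (k + 1)) /
    ((∏ a ∈ Finset.univ.erase 0, (algebraMap ℂ L (z 0 + lam 0) - algebraMap ℂ L (z a + lam a))) *
      ∏ j : Fin k, aeval (ladderPt L (z 0 + lam 0) (k + 1) j.succ) (denPoly z lam)) := by
  simp only [iotaConst, omegaFactor, ladderPt, denPoly, aeval_rootPoly, map_div₀, map_mul, map_prod,
    map_sub, map_add, map_one, Algebra.algebraMap_self, RingHom.id_apply]

variable {z lam k}

theorem rest_ne_zero (hpole : ∀ a : Fin n, a ≠ 0 → ∀ j : ℕ, j ≤ k →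
    z 0 + lam 0 - (j : ℂ) ≠ z a + lam a) :
    (∏ a ∈ Finset.univ.erase 0, (z 0 + lam 0 - (z a + lam a))) *
      ∏ j : Fin k, aeval (ladderPt ℂ (z 0 + lam 0) (k + 1) j.succ) (denPoly z lam) ≠ 0 := by
  refine mul_ne_zero (Finset.prod_ne_zero_iff.2 fun a ha => sub_ne_zero.2 ?_)
    (Finset.prod_ne_zero_iff.2 fun j _ => ?_)
  · simpa using hpole a (Finset.ne_of_mem_erase ha) 0 k.zero_le
  · rw [denPoly, aeval_rootPoly]
    refine Finset.prod_ne_zero_iff.2 fun a _ => ?_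
    rw [ladderPt, Algebra.algebraMap_self, RingHom.id_apply, RingHom.id_apply, sub_ne_zero]
    -- The pole at `c` itself is met only by the first ladder point, which is absent here; the poles
    -- with `a ≠ 0` are excluded by `hpole`.
    by_cases ha : a = 0
    · subst ha
      rw [Ne, sub_eq_self, Nat.cast_eq_zero]
      simp
    · exact hpole a ha _ (by rw [Fin.val_succ]; omega)

/-- The ladder is listed in decreasing order, so the differences in `ω` are positive integers and
neither they nor their successors vanish. -/
theorem omegaFactor_ladderPt_ne (L : Type) [Field L] [Algebra ℂ L] (c : ℂ) (k : ℕ) :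
    omegaFactor (ladderPt L c k) ≠ 0 := by
  refine Finset.prod_ne_zero_iff.2 fun p hp => ?_
  have hp' := (Finset.mem_filter.1 hp).2
  refine div_ne_zero (sub_ne_zero.2 ((ladderPt_injective c k).ne hp'.ne)) ?_
  rw [ladderPt, ladderPt, ← map_sub, ← map_one (algebraMap ℂ L), ← map_add,
    Ne, map_eq_zero]
  intro h
  have h1 : (((p.2 : ℕ) + 1 : ℕ) : ℂ) = ((p.1 : ℕ) : ℂ) := by
    push_cast
    linear_combination h
  have := Nat.cast_injective h1
  have := Fin.lt_def.1 hp'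
  omega

theorem iotaConst_ne_zero (hpole : ∀ a : Fin n, a ≠ 0 → ∀ j : ℕ, j ≤ k →
    z 0 + lam 0 - (j : ℂ) ≠ z a + lam a) : iotaConst z lam k ≠ 0 :=
  div_ne_zero (omegaFactor_ladderPt_ne ℂ _ _) (rest_ne_zero hpole)

/-- The weight at the ladder point splits into a constant, the factor `ω` of the remaining
variables, and cross factors. Together with the extra factor in `iotaTilde` these change the poles
of `λ` into those of `λ'`. -/
theorem evalAt_iotaTilde (hk : 2 * lam 0 = (k : ℂ))
    (hpole : ∀ a : Fin n, a ≠ 0 → ∀ j : ℕ, j ≤ k → z 0 + lam 0 - (j : ℂ) ≠ z a + lam a)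
    (P : MvPolynomial (Fin (k + 1 + m)) ℂ) :
    (iotaTilde z lam k m (algebraMap _ (RatFn (k + 1 + m)) P *
        hypWeight z lam (k + 1 + m))).evalAt (iotaPoint z lam k m) =
      algebraMap ℂ (RatFn m) (iotaConst z lam k) *
        MvPolynomial.aeval (iotaPoint z lam k m) P * hypWeight z (reflectFirst lam) m := by
  classical
  set ρ := ladderPt (RatFn m) (z 0 + lam 0) (k + 1) with hρ
  have hvar : ∀ (b : Fin m) (c : ℂ), aeval (RatFn.var b) (denPoly z lam) ≠ 0 := fun b c => by
    rw [denPoly, aeval_rootPoly]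
    exact Finset.prod_ne_zero_iff.2 fun a _ => RatFn.var_ne_algebraMap b _
  have hcross : ∀ (a : Fin (k + 1)) (b : Fin m) (c : ℂ),
      ρ a - RatFn.var b + algebraMap ℂ (RatFn m) c ≠ 0 := fun a b c => by
    rw [hρ, ladderPt, sub_add_eq_add_sub, ← map_add, ← neg_sub]
    exact neg_ne_zero.2 (RatFn.var_ne_algebraMap b _)
  have hcross1 : ∀ (a : Fin (k + 1)) (b : Fin m), ρ a - RatFn.var b + 1 ≠ 0 := fun a b => by
    simpa using hcross a b 1
  have hcross2 : ∀ (a : Fin (k + 1)) (b : Fin m), ρ a - RatFn.var b - 1 ≠ 0 := fun a b => by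
    simpa [sub_eq_add_neg] using hcross a b (-1)
  have hrest : MvPolynomial.aeval (iotaPoint z lam k m) (poleRest z lam k m) =
      (∏ a ∈ Finset.univ.erase 0, (algebraMap ℂ (RatFn m) (z 0 + lam 0) -
        algebraMap ℂ (RatFn m) (z a + lam a))) * (∏ j : Fin k, aeval (ρ j.succ) (denPoly z lam)) *
      ∏ b : Fin m, aeval (RatFn.var b) (denPoly z lam) := by
    have h0 : ρ 0 = algebraMap ℂ (RatFn m) (z 0 + lam 0) := by
      rw [hρ, ladderPt, Fin.val_zero, Nat.cast_zero, sub_zero]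
    simp only [poleRest, map_mul, map_prod, map_sub, MvPolynomial.aeval_X, MvPolynomial.aeval_C,
      denPoly, aeval_rootPoly, iotaPoint_eq, Fin.append_left, Fin.append_right, ← hρ, h0]
  have hcN : MvPolynomial.aeval (iotaPoint z lam k m) (crossNum k m) =
      ∏ a, ∏ b, (ρ a - RatFn.var b + 1) := by
    simp only [crossNum, map_prod, map_sub, map_add, map_one, MvPolynomial.aeval_X, iotaPoint_eq,
      Fin.append_left, Fin.append_right, ← hρ]
  have hcD : MvPolynomial.aeval (iotaPoint z lam k m) (crossDen k m) =
      ∏ a, ∏ b, (ρ a - RatFn.var b - 1) := by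
    simp only [crossDen, map_prod, map_sub, map_one, MvPolynomial.aeval_X, iotaPoint_eq,
      Fin.append_left, Fin.append_right, ← hρ]
  have hω : MvPolynomial.aeval (iotaPoint z lam k m) (weightNum (k + 1 + m)) /
      MvPolynomial.aeval (iotaPoint z lam k m) (weightDen (k + 1 + m)) =
      omegaFactor (iotaPoint z lam k m) := by
    rw [aeval_weightNum, aeval_weightDen, omegaFactor, Finset.prod_div_distrib]
  have hω0 : omegaFactor (iotaPoint z lam k m) ≠ 0 := by
    rw [iotaPoint_eq, omegaFactor_append]
    refine mul_ne_zero (mul_ne_zero (omegaFactor_ladderPt_ne _ _ _) ?_)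
      (Finset.prod_ne_zero_iff.2 fun b _ => Finset.prod_ne_zero_iff.2 fun a _ => ?_)
    · refine omegaFactor_ne_zero (fun a b hab => ?_) fun a b hab => ?_
      · simpa using RatFn.var_sub_var_add_ne hab 0
      · simpa using RatFn.var_sub_var_add_ne hab 1
    · exact div_ne_zero (by simpa using hcross a b 0) (hcross1 a b)
  have hD0 : MvPolynomial.aeval (iotaPoint z lam k m) (weightDen (k + 1 + m)) ≠ 0 := fun h =>
    hω0 (by rw [← hω, h, div_zero])
  have hconst := algebraMap_iotaConst z lam k (L := RatFn m)
  have hC0 : (∏ a ∈ Finset.univ.erase 0, (algebraMap ℂ (RatFn m) (z 0 + lam 0) -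
      algebraMap ℂ (RatFn m) (z a + lam a))) *
      (∏ j : Fin k, aeval (ρ j.succ) (denPoly z lam)) ≠ 0 := by
    intro h
    rw [h, div_zero, map_eq_zero] at hconst
    exact iotaConst_ne_zero hpole hconst
  -- For a ladder point `ρ`, the cross factors multiply to `(t - ρ) / (t - ρ + 1)`, the inverse of a
  -- factor of `ratioProd (-1)`. Hence `denPoly_ladder` gives the new denominators.
  have hratio : (∏ b : Fin m, ∏ a, (ρ a - RatFn.var b) / (ρ a - RatFn.var b + 1)) *
      ((∏ a, ∏ b : Fin m, (ρ a - RatFn.var b + 1)) / ∏ a, ∏ b : Fin m, (ρ a - RatFn.var b - 1)) /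
      (∏ b : Fin m, aeval (RatFn.var b) (denPoly z lam)) =
      ∏ b : Fin m, (aeval (RatFn.var b) (denPoly z (reflectFirst lam)))⁻¹ := by
    rw [Finset.prod_comm (f := fun a (b : Fin m) => ρ a - RatFn.var b + 1),
      Finset.prod_comm (f := fun a (b : Fin m) => ρ a - RatFn.var b - 1),
      ← Finset.prod_div_distrib, ← Finset.prod_mul_distrib, ← Finset.prod_div_distrib]
    refine Finset.prod_congr rfl fun b _ => ?_
    have hb : RatFn.var b ∉ ladder (RatFn m) (z 0 + lam 0) (k + 1) :=
      Finset.disjoint_right.1 (disjoint_ladder_var (k + 1) m _)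
        (Finset.mem_image_of_mem _ (Finset.mem_univ b))
    rw [← denPoly_ladder hk hb, ladder, ratioProd_image _ _ (ladderPt_injective _ _), mul_inv,
      ← Finset.prod_inv_distrib, div_eq_mul_inv, mul_comm, ← Finset.prod_div_distrib,
      ← Finset.prod_mul_distrib]
    congr 1
    refine Finset.prod_congr rfl fun a _ => ?_
    rw [div_mul_div_cancel₀ (hcross1 a b), inv_div, ← neg_div_neg_eq, ← hρ]
    congr 1 <;> ring
  rw [iotaTilde_eq, RatFn.evalAt_eq]
  · rw [map_mul, map_mul, map_mul, map_mul, hcN, hcD, hrest, ← weightVal_var, weightVal, ← hratio,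
      hconst, ← hρ]
    rw [iotaPoint_eq, omegaFactor_append, ← iotaPoint_eq, ← hρ] at hω
    generalize MvPolynomial.aeval (iotaPoint z lam k m) (weightNum (k + 1 + m)) = N at hω ⊢
    generalize MvPolynomial.aeval (iotaPoint z lam k m) (weightDen (k + 1 + m)) = D at hω hD0 ⊢
    rw [div_eq_iff hD0] at hω
    rw [hω]
    exact iota_arith _ _ _ _ _ _ _ _ _ hD0
  · rw [map_mul, map_mul, hrest, hcD]
    exact mul_ne_zero (mul_ne_zero (mul_ne_zero hC0 (Finset.prod_ne_zero_iff.2 fun b _ =>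
      hvar b 0)) hD0) (Finset.prod_ne_zero_iff.2 fun a _ => Finset.prod_ne_zero_iff.2 fun b _ =>
        hcross2 a b)

variable (z lam k)

/-- The map `ι*`. -/
def iotaStar : hypSpace z lam →ₗ[ℂ] hypSpace z (reflectFirst lam) :=
  (equivHyp z (reflectFirst lam)).toLinearMap ∘ₗ
    (iotaConst z lam k • lowerProd (z 0 + lam 0) (k + 1)) ∘ₗ (equivHyp z lam).symm.toLinearMap

theorem iotaStar_equivHyp (v : SymSpace n) : iotaStar z lam k (equivHyp z lam v) =
    equivHyp z (reflectFirst lam) (iotaConst z lam k • lowerProd (z 0 + lam 0) (k + 1) v) := by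
  rw [iotaStar, LinearMap.comp_apply, LinearMap.comp_apply, LinearEquiv.coe_coe,
    LinearEquiv.coe_coe, LinearEquiv.symm_apply_apply, LinearMap.smul_apply]

variable {z lam k}

theorem isIotaStar_iotaStar (hk : 2 * lam 0 = (k : ℂ))
    (hpole : ∀ a : Fin n, a ≠ 0 → ∀ j : ℕ, j ≤ k → z 0 + lam 0 - (j : ℂ) ≠ z a + lam a) :
    IsIotaStar z lam k (iotaStar z lam k) where
  low l f hl := by
    obtain ⟨P, hP, hd, hf, hf'⟩ := exists_homog_eq f
    -- The component in degree `m` comes from degree `m + k + 1`, which is greater than `l`.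
    have h0 : lowerProd (z 0 + lam 0) (k + 1) (single l P hP hd) = 0 := SymSpace.ext fun m =>
      lowerProd_apply_eq_zero _ _ (single_of_ne _ _ (by omega))
    rw [hf', iotaStar_equivHyp, h0, smul_zero, map_zero]
  high m f := by
    obtain ⟨P, hP, hd, hf, hf'⟩ := exists_homog_eq f
    rw [hf', iotaStar_equivHyp, equivHyp_eq_lof _ _ _ m, hf, evalAt_iotaTilde m hk hpole]
    · congr 2
      change algebraMap _ (RatFn m) (iotaConst z lam k •
        (lowerProd (z 0 + lam 0) (k + 1) (single _ P hP hd)).1 m) = _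
      have hs := map_smul (IsScalarTower.toAlgHom ℂ (MvPolynomial (Fin m) ℂ) (RatFn m))
        (iotaConst z lam k) ((lowerProd (z 0 + lam 0) (k + 1) (single _ P hP hd)).1 m)
      refine hs.trans ?_
      rw [Algebra.smul_def]
      congr 1
      refine (algebraMap_lowerProd z lam k m _).trans ?_
      rw [single_same]
    · intro l hl
      change iotaConst z lam k •
        (lowerProd (z 0 + lam 0) (k + 1) (single _ P hP hd)).1 l = 0
      rw [lowerProd_apply_eq_zero _ _ (single_of_ne _ _ (by omega)), smul_zero]

theorem iotaStar_hypRep (hk : 2 * lam 0 = (k : ℂ)) (y : Yangian) (f : hypSpace z lam) :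
    iotaStar z lam k (hypRep z lam y f) =
      hypRep z (reflectFirst lam) y (iotaStar z lam k f) := by
  obtain ⟨v, rfl⟩ := (equivHyp z lam).surjective f
  rw [hypRep_apply, iotaStar_equivHyp, iotaStar_equivHyp, hypRep_apply, lowerProd_symRep hk,
    map_smul (symRep z (reflectFirst lam) y)]

/-- Surjectivity of the product of lowerings suffices because the constant is invertible. -/
theorem iotaStar_surjective (hpole : ∀ a : Fin n, a ≠ 0 → ∀ j : ℕ, j ≤ k →
    z 0 + lam 0 - (j : ℂ) ≠ z a + lam a) : Function.Surjective (iotaStar z lam k) := by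
  intro g
  obtain ⟨w, rfl⟩ := (equivHyp z (reflectFirst lam)).surjective g
  obtain ⟨v, hv⟩ := lowerProd_surjective (z 0 + lam 0) (k + 1) ((iotaConst z lam k)⁻¹ • w)
  refine ⟨equivHyp z lam v, ?_⟩
  rw [iotaStar_equivHyp, hv, smul_inv_smul₀ (iotaConst_ne_zero hpole)]

end Iota

end

theorem mainTheorem8 (n : ℕ) [NeZero n] (z lam : Fin n → ℂ) (k : ℕ)
    (hk : 2 * lam 0 = (k : ℂ))
    (hpole : ∀ a : Fin n, a ≠ 0 → ∀ j : ℕ, j ≤ k → z 0 + lam 0 - (j : ℂ) ≠ z a + lam a) :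
    ∃ (ρ : Yangian →ₐ[ℂ] Module.End ℂ (hypSpace z lam))
      (ρ' : Yangian →ₐ[ℂ] Module.End ℂ (hypSpace z (reflectFirst lam)))
      (ι : hypSpace z lam →ₗ[ℂ] hypSpace z (reflectFirst lam)),
      IsHypergeometricAction z lam ρ ∧
      IsHypergeometricAction z (reflectFirst lam) ρ' ∧
      IsIotaStar z lam k ι ∧
      (∀ (y : Yangian) (f : hypSpace z lam), ι (ρ y f) = ρ' y (ι f)) ∧
      Function.Surjective ι := by
  exact ⟨hypRep z lam, hypRep z (reflectFirst lam), iotaStar z lam k,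
    hypRep_isHypergeometricAction z lam, hypRep_isHypergeometricAction z (reflectFirst lam),
    isIotaStar_iotaStar hk hpole, iotaStar_hypRep hk, iotaStar_surjective hpole⟩
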